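/- Let $V$ be a set of $n$ nodes. A \emph{biset} on $V$ is a pair $\hat S=(S,S^+)$ with $S\subseteq S^+\subseteq V$; it is \emph{proper} if $S\neq\emptyset$ and $S^+\neq V$; its \emph{boundary} is $\Gamma(\hat S)=S^+\setminus S$ and its \emph{co-biset} is $(V\setminus S^+,V\setminus S)$. Put $\hat X\cap\hat Y=(X\cap Y,X^+\cap Y^+)$ and $\hat X\cup\hat Y=(X\cup Y,X^+\cup Y^+)$. Bisets $\hat X,\hat Y$ \emph{intersect} if $X\cap Y\ne\emptyset$, and \emph{cross} if in addition $X^+\cup Y^+\neq V$. All biset-families below consist of proper bisets. A family $\mathcal F$ is \emph{crossing} if $\hat X\cap\hat Y,\hat X\cup\hat Y\in\mathcal F$ for all crossing $\hat X,\hat Y\in\mathcal F$, and \emph{$k$-regular} if $\hat X\cap\hat Y,\hat X\cup\hat Y\in\mathcal F$ for all intersecting $\hat X,\hat Y\in\mathcal F$ with $|V\setminus(X\cup Y)|\ge k+1$. The \emph{co-family} of $\mathcal F$ consists of the co-bisets of its members. The biset $\hat X$ is \emph{properly contained} in $\hat Y$ if $X\subsetneq Y$, or $X=Y$ and $X^+\subsetneq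 Y^+$; the \emph{cores} of $\mathcal F$ are its members that properly contain no member, and $\nu(\mathcal F)$ is their number. An edge $uv$ \emph{covers} $\hat S$ if $u\in S$ and $v\in V\setminus S^+$, and an edge set covers $\mathcal F$ if every member of $\mathcal F$ is covered by one of its edges. In the problem Biset-Family Edge-Cover we are given a directed graph $G=(V,E)$ with edge costs $c_e\ge 0$ and a biset-family $\mathcal F$ on $V$, and seek a minimum-cost $J\subseteq E$ that covers $\mathcal F$. Let $$\tau(\mathcal F)=\min\Big\{\sum_{e\in E}c_ex_e:\ \sum_{e\in E,\ e\text{ covers }\hat S}x_e\ge1\ \ \forall\hat S\in\mathcal F,\ \ x_e\ge0\ \ \forall e\in E\Big\}.$$ The family $\mathcal F$ is accessed only through an oracle: for any edge set $J$ on $V$ and $u,v\in V$, one query returns the core of $\mathcal F(u,v)=\{\hat S\in\mathcal F:\ \hat S\text{ is not covered by }J,\ u\in S,\ v\in V\setminus S^+\}$, or the core of the co-family of $\mathcal F(u,v)$, or reports that $\mathcal F(u,v)=\emptyset$ (these cores are unique if $\mathcal F$ is crossing). \textbf{Theorem.} There are an algorithm, a polynomial $p$ and a constant $C$ such that the following holds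 for every instance with $\mathcal F$ crossing and every integer $k\ge 0$ (which is given to the algorithm as a part of the input). The algorithm halts after at most $p(n)$ steps, where a step is an oracle query or an elementary instruction of a random access machine whose only arithmetic operations are addition, subtraction and comparison. If $E$ covers $\mathcal F$, then the output is a set $J\subseteq E$ that covers $\mathcal F$ and has cost $\sum_{e\in J}c_e\le\rho\cdot\tau(\mathcal F)$, where (writing $1+\log$ for $O(\log)$, so that arguments equal to $1$ are included, and with $\log 0$ read as $0$): (i) $\rho= C\,(1+\log\nu(\mathcal F))$, and $1+\log\nu(\mathcal F)\le C\log n$ if $n\ge 2$; (ii) $\rho= C\left(1+\log\min\left\{\frac n{n-k},\,n-k\right\}\right)$ if $k<n$, both $\mathcal F$ and its co-family are $k$-regular, and $|\Gamma(\hat S)|=k$ for all $\hat S\in\mathcal F$; (iii) $\rho= C\,\frac n{n-k}\left(1+\log\frac n{n-k}\right)$ if $k<n$, both $\mathcal F$ and its co-family are $k$-regular, and $|\Gamma(\hat S)|\le k$ for all $\hat S\in\mathcal F$. -/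

import Mathlib

namespace BisetCover

/-! ### Bisets and biset-families -/

section Bisets

variable {V : Type*} [Fintype V] [DecidableEq V]

/-- A biset on `V`: a pair `(S, S⁺)` of subsets of `V` with `S ⊆ S⁺`. -/
@[ext]
structure Biset (V : Type*) where
  inner : Finset V
  outer : Finset V
  subset : inner ⊆ outer

/-- The boundary `Γ(S) = S⁺ \ S`. -/
def Biset.boundary (S : Biset V) : Finset V := S.outer \ S.inner

/-- The co-biset `(V \ S⁺, V \ S)`. -/
def Biset.co (S : Biset V) : Biset V where
  inner := S.outerᶜ
  outer := S.innerᶜ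
  subset := Finset.compl_subset_compl.mpr S.subset

/-- `X ∩ Y = (X ∩ Y, X⁺ ∩ Y⁺)`. -/
def Biset.inter (X Y : Biset V) : Biset V where
  inner := X.inner ∩ Y.inner
  outer := X.outer ∩ Y.outer
  subset := Finset.inter_subset_inter X.subset Y.subset

/-- `X ∪ Y = (X ∪ Y, X⁺ ∪ Y⁺)`. -/
def Biset.union (X Y : Biset V) : Biset V where
  inner := X.inner ∪ Y.inner
  outer := X.outer ∪ Y.outer
  subset := Finset.union_subset_union X.subset Y.subset

/-- Both `S` and `V \ S⁺` are nonempty. -/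
def Biset.Proper (S : Biset V) : Prop := S.inner.Nonempty ∧ S.outerᶜ.Nonempty

def Intersect (X Y : Biset V) : Prop := (X.inner ∩ Y.inner).Nonempty

def Cross (X Y : Biset V) : Prop :=
  (X.inner ∩ Y.inner).Nonempty ∧ X.outer ∪ Y.outer ≠ Finset.univ

/-- A family of bisets is crossing if it is closed under the intersection and the union of
crossing members. -/
def IsCrossing (F : Set (Biset V)) : Prop :=
  ∀ X ∈ F, ∀ Y ∈ F, Cross X Y → X.inter Y ∈ F ∧ X.union Y ∈ F

/-- A family is `k`-regular if it is closed under the intersection and the union of intersecting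
members `X, Y` with `|V \ (X ∪ Y)| ≥ k + 1`. -/
def IsRegular (k : ℕ) (F : Set (Biset V)) : Prop :=
  ∀ X ∈ F, ∀ Y ∈ F, Intersect X Y → k + 1 ≤ (X.inner ∪ Y.inner)ᶜ.card →
    X.inter Y ∈ F ∧ X.union Y ∈ F

/-- The co-family: all co-bisets of members. -/
def coFamily (F : Set (Biset V)) : Set (Biset V) := Biset.co '' F

/-- `X` is properly contained in `Y`. -/
def ProperlyContained (X Y : Biset V) : Prop :=
  X.inner ⊂ Y.inner ∨ (X.inner = Y.inner ∧ X.outer ⊂ Y.outer)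

/-- The cores of a family are its inclusion-minimal members. -/
def IsCore (F : Set (Biset V)) (C : Biset V) : Prop :=
  C ∈ F ∧ ∀ S ∈ F, ¬ ProperlyContained S C

/-- The number `ν(F)` of cores. -/
noncomputable def numCores (F : Set (Biset V)) : ℕ := Set.ncard {C | IsCore F C}

/-- The directed edge `e = (u, v)` covers `S` if it goes from `S` to `V \ S⁺`. -/
def Covers (e : V × V) (S : Biset V) : Prop := e.1 ∈ S.inner ∧ e.2 ∉ S.outer

instance (e : V × V) (S : Biset V) : Decidable (Covers e S) :=
  inferInstanceAs (Decidable (e.1 ∈ S.inner ∧ e.2 ∉ S.outer))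

/-- `J` is an edge-cover of `F`. -/
def IsEdgeCover (J : Finset (V × V)) (F : Set (Biset V)) : Prop :=
  ∀ S ∈ F, ∃ e ∈ J, Covers e S

/-- The residual family: the members of `F` that `J` does not cover. -/
def residual (F : Set (Biset V)) (J : Finset (V × V)) : Set (Biset V) :=
  {S ∈ F | ∀ e ∈ J, ¬ Covers e S}

/-- The members `S` of `F` with `u ∈ S` and `v ∈ V \ S⁺`. -/
def separating (F : Set (Biset V)) (u v : V) : Set (Biset V) :=
  {S ∈ F | u ∈ S.inner ∧ v ∉ S.outer}

/-- `x` is a feasible solution of the linear program for covering `F` by edges of `E`. -/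
def LPFeasible (E : Finset (V × V)) (F : Set (Biset V)) (x : V × V → ℝ) : Prop :=
  (∀ e ∈ E, 0 ≤ x e) ∧ ∀ S ∈ F, 1 ≤ ∑ e ∈ E with Covers e S, x e

/-- The optimal value `τ(F)` of the linear program.  (It is meaningful if the program is feasible,
that is, if `E` covers `F`, and the costs are nonnegative; it is only used then.) -/
noncomputable def lpValue (E : Finset (V × V)) (c : V × V → ℝ) (F : Set (Biset V)) : ℝ :=
  sInf {z | ∃ x, LPFeasible E F x ∧ z = ∑ e ∈ E, c e * x e}

end Bisets

/-! ### Core oracles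

The family `F` is accessed only through the following oracle. -/

/-- An oracle on node set `{0, …, n-1}`.  The Boolean selects the family (`false`) or the co-family
(`true`); the other arguments are an edge set `J` and two nodes `u, v`. -/
abbrev Oracle (n : ℕ) : Type :=
  Bool → Finset (Fin n × Fin n) → Fin n → Fin n → Option (Biset (Fin n))

/-- The oracle answers the query `(false, J, u, v)` with a core of
`F(u,v) = {S ∈ F^J : u ∈ S, v ∈ V \ S⁺}` and the query `(true, J, u, v)` with a core of the
co-family of `F(u,v)`; it answers `none` only if `F(u,v)` is empty.
(If `F` is crossing, then all members of `F(u,v)` cross each other, so these cores are unique.) -/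
def Oracle.IsCoreOracle {n : ℕ} (O : Oracle n) (F : Set (Biset (Fin n))) : Prop :=
  ∀ (J : Finset (Fin n × Fin n)) (u v : Fin n),
    (∀ C, O false J u v = some C → IsCore (separating (residual F J) u v) C) ∧
    (O false J u v = none → separating (residual F J) u v = ∅) ∧
    (∀ C, O true J u v = some C → IsCore (coFamily (separating (residual F J) u v)) C) ∧
    (O true J u v = none → separating (residual F J) u v = ∅)

/-! ### The machine model

A random access machine with oracle, programmed in a structured language.  The memory consists of
three-dimensional arrays of natural numbers and three-dimensional arrays of cost values, all named
by natural numbers.  The only arithmetic operations are addition, subtraction and comparison, there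
is no multiplication, the only constant for cost values is zero, and a cost value influences the
rest of the computation only through comparisons.  Every executed instruction costs one step.
(In the absence of multiplication the bit length of the numbers grows by at most a constant per
step beyond the bit length of the whole input, so on rational costs a polynomial number of steps is
polynomial time on a Turing machine.) -/

/-- The memory: `nat a i j l` is the entry `a[i, j, l]` of the `a`-th array of natural numbers,
`val a i j l` that of the `a`-th array of cost values. -/
structure Mem where
  nat : ℕ → ℕ → ℕ → ℕ → ℕ
  val : ℕ → ℕ → ℕ → ℕ → ℝ

/-- Expressions for natural numbers. -/
inductive NExp where
  | const (m : ℕ)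
  | read (a : ℕ) (i j l : NExp)
  | add (e f : NExp)
  | sub (e f : NExp)

/-- Expressions for cost values. -/
inductive VExp where
  | zero
  | read (a : ℕ) (i j l : NExp)
  | add (e f : VExp)
  | sub (e f : VExp)

/-- Conditions. -/
inductive BExp where
  | leN (e f : NExp)
  | leV (e f : VExp)
  | not (b : BExp)
  | and (b b' : BExp)

/-- Value of an expression; subtraction of natural numbers is truncated. -/
def NExp.eval (m : Mem) : NExp → ℕ
  | .const r => r
  | .read a i j l => m.nat a (i.eval m) (j.eval m) (l.eval m)
  | .add e f => e.eval m + f.eval m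
  | .sub e f => e.eval m - f.eval m

noncomputable def VExp.eval (m : Mem) : VExp → ℝ
  | .zero => 0
  | .read a i j l => m.val a (i.eval m) (j.eval m) (l.eval m)
  | .add e f => e.eval m + f.eval m
  | .sub e f => e.eval m - f.eval m

def BExp.holds (m : Mem) : BExp → Prop
  | .leN e f => e.eval m ≤ f.eval m
  | .leV e f => e.eval m ≤ f.eval m
  | .not b => ¬ b.holds m
  | .and b b' => b.holds m ∧ b'.holds m

/-- Programs. -/
inductive Prog where
  | skip
  /-- `a[i, j, l] := e` for natural numbers -/
  | setN (a : ℕ) (i j l : NExp) (e : NExp)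
  /-- `a[i, j, l] := e` for cost values -/
  | setV (a : ℕ) (i j l : NExp) (e : VExp)
  | seq (p q : Prog)
  | ite (b : BExp) (p q : Prog)
  | while (b : BExp) (p : Prog)
  /-- Oracle call for the nodes `u`, `v` and the edge set stored in the array `a`; the answer is
  stored in the array `d`. -/
  | query (co : Bool) (a : ℕ) (u v : NExp) (d : ℕ)

/-- The entry `a[i, j, l]` is set to `r`. -/
def Mem.setN (m : Mem) (a i j l r : ℕ) : Mem where
  nat := fun a' i' j' l' =>
    if a' = a ∧ i' = i ∧ j' = j ∧ l' = l then r else m.nat a' i' j' l'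
  val := m.val

noncomputable def Mem.setV (m : Mem) (a i j l : ℕ) (r : ℝ) : Mem where
  nat := m.nat
  val := fun a' i' j' l' =>
    if a' = a ∧ i' = i ∧ j' = j ∧ l' = l then r else m.val a' i' j' l'

/-- The edge set whose adjacency matrix is stored in the array `a`. -/
def Mem.edgeSet (m : Mem) (n a : ℕ) : Finset (Fin n × Fin n) :=
  Finset.univ.filter fun e => m.nat a e.1 e.2 0 ≠ 0

/-- The encoding of an answer of the oracle as an array: the entry `[0, 0, 0]` tells whether there
is a core, the entries `[1, w, 0]` and `[2, w, 0]` tell whether the node `w` belongs to its inner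
part and to its outer part. -/
def encodeAnswer {n : ℕ} : Option (Biset (Fin n)) → ℕ → ℕ → ℕ → ℕ
  | none => fun _ _ _ => 0
  | some S => fun i w l =>
      if (i = 0 ∧ w = 0 ∧ l = 0) ∨
        (i = 1 ∧ l = 0 ∧ ∃ x : Fin n, x.val = w ∧ x ∈ S.inner) ∨
        (i = 2 ∧ l = 0 ∧ ∃ x : Fin n, x.val = w ∧ x ∈ S.outer) then 1 else 0

/-- The array `d` is replaced by an answer of the oracle. -/
def Mem.putAnswer {n : ℕ} (m : Mem) (d : ℕ) (ans : Option (Biset (Fin n))) : Mem where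
  nat := fun a => if a = d then encodeAnswer ans else m.nat a
  val := m.val

/-- `Exec O p m t m'`: with oracle `O`, the program `p` started in memory `m` halts after `t` steps
in memory `m'`.  (An oracle call for numbers that are not nodes does not halt.) -/
inductive Exec {n : ℕ} (O : Oracle n) : Prog → Mem → ℕ → Mem → Prop
  | skip (m : Mem) : Exec O .skip m 1 m
  | setN (m : Mem) (a : ℕ) (i j l e : NExp) :
      Exec O (.setN a i j l e) m 1 (m.setN a (i.eval m) (j.eval m) (l.eval m) (e.eval m))
  | setV (m : Mem) (a : ℕ) (i j l : NExp) (e : VExp) :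
      Exec O (.setV a i j l e) m 1 (m.setV a (i.eval m) (j.eval m) (l.eval m) (e.eval m))
  | seq {p q : Prog} {m m' m'' : Mem} {t t' : ℕ} :
      Exec O p m t m' → Exec O q m' t' m'' → Exec O (.seq p q) m (t + t') m''
  | iteTrue {b : BExp} {p q : Prog} {m m' : Mem} {t : ℕ} :
      b.holds m → Exec O p m t m' → Exec O (.ite b p q) m (t + 1) m'
  | iteFalse {b : BExp} {p q : Prog} {m m' : Mem} {t : ℕ} :
      ¬ b.holds m → Exec O q m t m' → Exec O (.ite b p q) m (t + 1) m'
  | whileTrue {b : BExp} {p : Prog} {m m' m'' : Mem} {t t' : ℕ} :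
      b.holds m → Exec O p m t m' → Exec O (.while b p) m' t' m'' →
        Exec O (.while b p) m (t + t' + 1) m''
  | whileFalse {b : BExp} {p : Prog} {m : Mem} :
      ¬ b.holds m → Exec O (.while b p) m 1 m
  | query (m : Mem) (co : Bool) (a : ℕ) (u v : NExp) (d : ℕ)
      (hu : u.eval m < n) (hv : v.eval m < n) :
      Exec O (.query co a u v d) m 1
        (m.putAnswer d (O co (m.edgeSet n a) ⟨u.eval m, hu⟩ ⟨v.eval m, hv⟩))

/-- The input memory: `n` and `k` in the arrays `0` and `1` of natural numbers, the adjacency matrix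
of `E` in array `2`, and the costs of the edges in `E` in the array `0` of cost values; all other
entries are zero. -/
noncomputable def inputMem (n k : ℕ) (E : Finset (Fin n × Fin n)) (c : Fin n × Fin n → ℝ) :
    Mem where
  nat := fun a i j l =>
    if a = 0 ∧ i = 0 ∧ j = 0 ∧ l = 0 then n
    else if a = 1 ∧ i = 0 ∧ j = 0 ∧ l = 0 then k
    else if a = 2 ∧ l = 0 ∧ ∃ e ∈ E, e.1.val = i ∧ e.2.val = j then 1
    else 0
  val := fun a i j l =>
    if a = 0 ∧ l = 0 then
      ∑ e ∈ E with e.1.val = i ∧ e.2.val = j, c e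
    else 0

/-- The output: the edge set whose adjacency matrix is stored in the array `3`. -/
def output (n : ℕ) (m : Mem) : Finset (Fin n × Fin n) := m.edgeSet n 3

end BisetCover

open BisetCover

set_option linter.unusedSectionVars false

/-! The algorithm consists of `n + 1` primal-dual phases, each of cost at most `τ(F)`. In a phase,
bisets `S 0, S 1, …` are chosen greedily as extremal oracle answers; the dual variable of `S i` is
raised until some edge `e i` covering it becomes tight, and `e i` is added. Afterwards the edges are
examined in reverse order, and one is kept only if it covers no `S j` that a kept edge already
covers. Thus kept edges cover each `S j` at most once, and their cost is at most the value of the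
dual solution (`TwoPhase.cost_le`, `dual_le_lpValue`). This deletion rule does not protect
feasibility by itself. `TwoPhase.cover_subfamily` recovers it: if the chosen bisets of a class
increase whenever they meet, then the kept edges cover every subfamily that all the edges cover and
that is closed under union with the chosen bisets it meets in its class.

Call the inclusion-minimal members of a residual family its atoms. Each of the `n` main phases
covers the members containing only one atom (`halo`). The chosen bisets are as large as possible, so
that after passing to co-bisets the sequence is again increasing. What remains uncovered contains
two disjoint atoms of the previous residual family (`PhaseRun.two_atoms`). Inductively, a member
uncovered after `r` main phases contains `2 ^ r` pairwise disjoint atoms of the family left by the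
preliminary phase (`AlgRun.packing`). If `2 ^ r` can never exceed `B`, only `O(1 + log B)` phases
select any edge, and the cost is `O(1 + log B) τ(F)` (`AlgRun.cost_le_log`).

There are three choices of `B`. Disjoint atoms contain distinct cores of `F`, so `B = ν(F)` works. A
member with a boundary of size `k` has at most `n - k` inner nodes, so `B = n - k` works if all
boundaries have size `k`. For a `k`-regular family `B = 4n / (n - k)` works: disjoint atoms with
more than `(n - k) / 2` inner nodes are few by counting, and smaller ones are handled by the
preliminary phase. That phase need not cover every small member, but an uncovered small `D`,
enlarged by the maximal chosen bisets meeting it, has more than `(n - k) / 2` inner nodes, and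
disjoint such `D` have disjoint enlargements (`PhaseRun.attach_large`, `PhaseRun.attach_disjoint`).
The bound in (iii) is weaker than the one obtained from this `B`.

The rest implements the phases on the machine. `Runs` is a total-correctness judgement with a time
bound, and `Frame` records which arrays a program leaves alone. -/

namespace BisetCover

/-! ### Inclusion order, uncrossing, and uniqueness of the oracle's answers. -/

section Order

variable {V : Type*} [Fintype V] [DecidableEq V]

/-- Bisets are ordered by inclusion of both the inner and the outer parts. -/
instance : PartialOrder (Biset V) :=
  PartialOrder.lift (fun S : Biset V => (S.inner, S.outer)) fun X Y h => by
    simp only [Prod.mk.injEq] at h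
    exact Biset.ext h.1 h.2

instance : Finite (Biset V) :=
  Finite.of_injective (fun S : Biset V => (S.inner, S.outer)) fun X Y h => by
    simp only [Prod.mk.injEq] at h
    exact Biset.ext h.1 h.2

theorem Biset.le_def {X Y : Biset V} : X ≤ Y ↔ X.inner ⊆ Y.inner ∧ X.outer ⊆ Y.outer := Iff.rfl

@[simp] theorem Biset.inter_inner (X Y : Biset V) : (X.inter Y).inner = X.inner ∩ Y.inner := rfl
@[simp] theorem Biset.inter_outer (X Y : Biset V) : (X.inter Y).outer = X.outer ∩ Y.outer := rfl
@[simp] theorem Biset.union_inner (X Y : Biset V) : (X.union Y).inner = X.inner ∪ Y.inner := rfl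
@[simp] theorem Biset.union_outer (X Y : Biset V) : (X.union Y).outer = X.outer ∪ Y.outer := rfl
@[simp] theorem Biset.co_inner (X : Biset V) : X.co.inner = X.outerᶜ := rfl
@[simp] theorem Biset.co_outer (X : Biset V) : X.co.outer = X.innerᶜ := rfl

@[simp] theorem Biset.co_co (X : Biset V) : X.co.co = X := by
  ext <;> simp

theorem Biset.co_le_co {X Y : Biset V} : X.co ≤ Y.co ↔ Y ≤ X := by
  simp only [Biset.le_def, co_inner, co_outer, Finset.compl_subset_compl]
  exact and_comm

theorem Biset.inter_le_left (X Y : Biset V) : X.inter Y ≤ X :=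
  ⟨Finset.inter_subset_left, Finset.inter_subset_left⟩

theorem Biset.inter_le_right (X Y : Biset V) : X.inter Y ≤ Y :=
  ⟨Finset.inter_subset_right, Finset.inter_subset_right⟩

theorem Biset.le_union_left (X Y : Biset V) : X ≤ X.union Y :=
  ⟨Finset.subset_union_left, Finset.subset_union_left⟩

theorem Biset.le_union_right (X Y : Biset V) : Y ≤ X.union Y :=
  ⟨Finset.subset_union_right, Finset.subset_union_right⟩

theorem Biset.union_le {X Y Z : Biset V} (h : X ≤ Z) (h' : Y ≤ Z) : X.union Y ≤ Z :=
  ⟨Finset.union_subset h.1 h'.1, Finset.union_subset h.2 h'.2⟩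

theorem Biset.co_inter (X Y : Biset V) : (X.inter Y).co = X.co.union Y.co := by
  ext <;> simp

theorem Covers.of_inter {e : V × V} {X Y : Biset V} (h : Covers e (X.inter Y)) :
    Covers e X ∨ Covers e Y := by
  simp only [Covers, Biset.inter_inner, Biset.inter_outer, Finset.mem_inter] at *
  tauto

theorem Covers.of_union {e : V × V} {X Y : Biset V} (h : Covers e (X.union Y)) :
    Covers e X ∨ Covers e Y := by
  simp only [Covers, Biset.union_inner, Biset.union_outer, Finset.mem_union] at *
  tauto

theorem covers_co_iff {e : V × V} {X : Biset V} : Covers e.swap X.co ↔ Covers e X := by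
  simp only [Covers, Biset.co_inner, Biset.co_outer, Finset.mem_compl, Prod.fst_swap,
    Prod.snd_swap]
  tauto

theorem Covers.cross {e : V × V} {X Y : Biset V} (hX : Covers e X) (hY : Covers e Y) :
    Cross X Y := by
  refine ⟨⟨e.1, Finset.mem_inter.2 ⟨hX.1, hY.1⟩⟩, fun h => ?_⟩
  have := Finset.mem_univ e.2
  rw [← h, Finset.mem_union] at this
  exact this.elim hX.2 hY.2

theorem cross_of_mem {X Y : Biset V} {u v : V} (hu : u ∈ X.inner) (hu' : u ∈ Y.inner)
    (hv : v ∉ X.outer) (hv' : v ∉ Y.outer) : Cross X Y :=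
  Covers.cross (e := (u, v)) ⟨hu, hv⟩ ⟨hu', hv'⟩

theorem residual_residual (F : Set (Biset V)) (J J' : Finset (V × V)) :
    residual (residual F J) J' = residual F (J ∪ J') := by
  ext S
  simp only [residual, Set.mem_ofPred_eq, Finset.mem_union]
  constructor
  · rintro ⟨⟨h1, h2⟩, h3⟩
    exact ⟨h1, fun e he => he.elim (h2 e) (h3 e)⟩
  · rintro ⟨h1, h2⟩
    exact ⟨⟨h1, fun e he => h2 e (.inl he)⟩, fun e he => h2 e (.inr he)⟩

theorem IsCrossing.residual {F : Set (Biset V)} (hF : IsCrossing F) (J : Finset (V × V)) :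
    IsCrossing (residual F J) := by
  intro X hX Y hY hXY
  obtain ⟨h1, h2⟩ := hF X hX.1 Y hY.1 hXY
  exact ⟨⟨h1, fun e he h => h.of_inter.elim (hX.2 e he) (hY.2 e he)⟩,
    ⟨h2, fun e he h => h.of_union.elim (hX.2 e he) (hY.2 e he)⟩⟩

theorem properlyContained_of_lt {X Y : Biset V} (h : X < Y) : ProperlyContained X Y := by
  obtain ⟨⟨h1, h2⟩, h3⟩ := lt_iff_le_and_ne.1 h |>.imp_left Biset.le_def.1
  rcases h1.ssubset_or_eq with h4 | h4
  · exact .inl h4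
  · refine .inr ⟨h4, h2.ssubset_of_ne fun h5 => h3 (Biset.ext h4 h5)⟩

theorem eq_of_le_core {G : Set (Biset V)} {C X : Biset V} (hC : IsCore G C) (hX : X ∈ G)
    (h : X ≤ C) : X = C := by
  by_contra hne
  exact hC.2 X hX (properlyContained_of_lt (lt_of_le_of_ne h hne))

/-- Two members separating the same pair always cross, so their intersection is again such a member;
minimality of the core then makes it the least element. -/
theorem core_separating_le {G : Set (Biset V)} (hG : IsCrossing G) {u v : V} {C : Biset V}
    (hC : IsCore (separating G u v) C) {S : Biset V} (hS : S ∈ separating G u v) : C ≤ S := by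
  have hx : C.inter S ∈ separating G u v := by
    refine ⟨(hG C hC.1.1 S hS.1 (cross_of_mem hC.1.2.1 hS.2.1 hC.1.2.2 hS.2.2)).1, ?_, ?_⟩
    · exact Finset.mem_inter.2 ⟨hC.1.2.1, hS.2.1⟩
    · exact fun h => hS.2.2 (Finset.mem_inter.1 h).2
  rw [← eq_of_le_core hC hx (Biset.inter_le_left _ _)]
  exact Biset.inter_le_right _ _

theorem core_coFamily_separating {G : Set (Biset V)} (hG : IsCrossing G) {u v : V} {A : Biset V}
    (hA : IsCore (coFamily (separating G u v)) A) :
    A.co ∈ separating G u v ∧ ∀ S ∈ separating G u v, S ≤ A.co := by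
  obtain ⟨⟨T, hT, rfl⟩, h2⟩ := hA
  rw [Biset.co_co]
  refine ⟨hT, fun S hS => ?_⟩
  have hx : T.union S ∈ separating G u v := by
    refine ⟨(hG T hT.1 S hS.1 (cross_of_mem hT.2.1 hS.2.1 hT.2.2 hS.2.2)).2, ?_, ?_⟩
    · exact Finset.mem_union_left _ hT.2.1
    · exact fun h => (Finset.mem_union.1 h).elim hT.2.2 hS.2.2
  have := eq_of_le_core (G := coFamily (separating G u v)) (X := (T.union S).co)
    ⟨⟨T, hT, rfl⟩, h2⟩ ⟨_, hx, rfl⟩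
    (Biset.co_le_co.2 (Biset.le_union_left T S))
  have h3 : T.union S = T := by simpa using congrArg Biset.co this
  rw [← h3]
  exact Biset.le_union_right _ _

/-! ### Atoms -/

/-- The atoms of a family are its minimal members. -/
abbrev Atom (G : Set (Biset V)) (C : Biset V) : Prop := Minimal (· ∈ G) C

theorem exists_atom_le {G : Set (Biset V)} {S : Biset V} (hS : S ∈ G) : ∃ C ≤ S, Atom G C :=
  (Set.toFinite G).exists_le_minimal hS

/-- Uncrossing: the intersection with `S` is a member below the atom, hence equal to it. -/
theorem Atom.le_of_cross {G : Set (Biset V)} (hG : IsCrossing G) {C S : Biset V} (hC : Atom G C)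
    (hS : S ∈ G) (h : Cross C S) : C ≤ S :=
  (hC.2 (hG C hC.1 S hS h).1 (Biset.inter_le_left _ _)).trans (Biset.inter_le_right _ _)

theorem Atom.disjoint {G : Set (Biset V)} (hG : IsCrossing G) {C D S : Biset V} (hC : Atom G C)
    (hD : Atom G D) (hne : C ≠ D) (hCS : C ≤ S) (hDS : D ≤ S) (hS : S.outer ≠ Finset.univ) :
    Disjoint C.inner D.inner := by
  rw [Finset.disjoint_iff_inter_eq_empty]
  by_contra h
  have hx : Cross C D := ⟨Finset.nonempty_iff_ne_empty.2 h, fun h' => hS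
    (Finset.univ_subset_iff.1 (h' ▸ Finset.union_subset hCS.2 hDS.2))⟩
  exact hne (le_antisymm (hC.le_of_cross hG hD.1 hx)
    (hD.2 hC.1 (hC.le_of_cross hG hD.1 hx)))

/-- Every member contains, in the sense of inner parts, a core. -/
theorem exists_core_inner_subset {G : Set (Biset V)} {S : Biset V} (hS : S ∈ G) :
    ∃ C, IsCore G C ∧ C.inner ⊆ S.inner := by
  -- Proper containment is lexicographic: a smaller inner part may come with an incomparable outer
  -- part. A lexicographic minimum of the two cardinalities is therefore a core, whereas an atom
  -- need not be one.
  obtain ⟨C, ⟨hC1, hC2⟩, h3⟩ := Set.Finite.exists_minimalFor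
    (fun X : Biset V => toLex (X.inner.card, X.outer.card)) {X ∈ G | X.inner ⊆ S.inner}
    (Set.toFinite _) ⟨S, hS, subset_rfl⟩
  refine ⟨C, ⟨hC1, fun X hX h => ?_⟩, hC2⟩
  have hlt : toLex (X.inner.card, X.outer.card) < toLex (C.inner.card, C.outer.card) := by
    rw [Prod.Lex.toLex_lt_toLex]
    rcases h with h | ⟨h, h'⟩
    · exact .inl (Finset.card_lt_card h)
    · exact .inr ⟨by simp [h], Finset.card_lt_card h'⟩
  have hsub : X.inner ⊆ S.inner := by
    rcases h with h | ⟨h, -⟩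
    · exact h.subset.trans hC2
    · exact h ▸ hC2
  exact absurd (h3 ⟨hX, hsub⟩ hlt.le) (not_le.2 hlt)

end Order

/-! ### Greedy selection with reverse deletion. -/

section TwoPhase

variable {V : Type*} [Fintype V] [DecidableEq V]

/-- The data of a two-phase greedy algorithm: the bisets `S i` are covered one after the other by
the edges `e i`, then the edges are selected in the reverse order, such that no biset is covered
twice. -/
structure TwoPhase (N : ℕ) (S : ℕ → Biset V) (e : ℕ → V × V) (I : Finset ℕ) : Prop where
  covers : ∀ i < N, Covers (e i) (S i)
  uncovered : ∀ i < N, ∀ j < i, ¬ Covers (e j) (S i)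
  mem_iff : ∀ i, i ∈ I ↔
    i < N ∧ ∀ j < N, Covers (e i) (S j) → ∀ l ∈ I, i < l → ¬ Covers (e l) (S j)

variable {N : ℕ} {S : ℕ → Biset V} {e : ℕ → V × V} {I : Finset ℕ}

theorem TwoPhase.lt (h : TwoPhase N S e I) {i : ℕ} (hi : i ∈ I) : i < N := ((h.mem_iff i).1 hi).1

theorem TwoPhase.unique (h : TwoPhase N S e I) {i l j : ℕ} (hj : j < N) (hi : i ∈ I) (hl : l ∈ I)
    (h1 : Covers (e i) (S j)) (h2 : Covers (e l) (S j)) : i = l := by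
  rcases lt_trichotomy i l with hlt | heq | hlt
  · exact absurd h2 (((h.mem_iff i).1 hi).2 j hj h1 l hl hlt)
  · exact heq
  · exact absurd h1 (((h.mem_iff l).1 hl).2 j hj h2 i hi hlt)

/-- Reversing edges and passing to co-bisets turns decreasing sequences into increasing ones, so the
covering lemma below also serves phases that choose largest members. -/
theorem TwoPhase.co (h : TwoPhase N S e I) :
    TwoPhase N (fun i => (S i).co) (fun i => (e i).swap) I where
  covers i hi := covers_co_iff.2 (h.covers i hi)
  uncovered i hi j hj := fun h' => h.uncovered i hi j hj (covers_co_iff.1 h')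
  mem_iff i := by simpa only [covers_co_iff] using h.mem_iff i

/-- The cost of the selected edges is at most the value of a dual solution for which these edges
are tight. -/
theorem TwoPhase.cost_le (h : TwoPhase N S e I) {c : V × V → ℝ} {y : ℕ → ℝ}
    (hy : ∀ i < N, 0 ≤ y i) (hc : ∀ f ∈ I.image e, 0 ≤ c f)
    (tight : ∀ i < N, c (e i) = ∑ j ∈ Finset.range N with Covers (e i) (S j), y j) :
    ∑ f ∈ I.image e, c f ≤ ∑ j ∈ Finset.range N, y j := by
  calc ∑ f ∈ I.image e, c f ≤ ∑ i ∈ I, c (e i) := by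
        apply Finset.sum_image_le_of_nonneg
        intro i hi
        exact hc i hi
    _ = ∑ i ∈ I, ∑ j ∈ Finset.range N, if Covers (e i) (S j) then y j else 0 := by
        refine Finset.sum_congr rfl fun i hi => ?_
        rw [tight i (h.lt hi), Finset.sum_filter]
    _ = ∑ j ∈ Finset.range N, ∑ i ∈ I, if Covers (e i) (S j) then y j else 0 := Finset.sum_comm
    _ ≤ ∑ j ∈ Finset.range N, y j := by
        refine Finset.sum_le_sum fun j hj => ?_
        have hj' := Finset.mem_range.1 hj
        rw [← Finset.sum_filter, Finset.sum_const, nsmul_eq_mul]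
        -- Here the deletion rule pays off: complementary slackness holds with factor one.
        have : ({i ∈ I | Covers (e i) (S j)}).card ≤ 1 := by
          rw [Finset.card_le_one]
          intro a ha b hb
          rw [Finset.mem_filter] at ha hb
          exact h.unique hj' ha.1 hb.1 ha.2 hb.2
        have h1 : (({i ∈ I | Covers (e i) (S j)}).card : ℝ) ≤ 1 := by exact_mod_cast this
        nlinarith [hy j hj']

variable {α : Type*} {cl : Biset V → α} {G : Set (Biset V)}

/-- The selected edges cover every biset of the list, if for each class of bisets
the list is increasing. -/
theorem TwoPhase.exists_covers (h : TwoPhase N S e I) (hmem : ∀ i < N, S i ∈ G)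
    (hle : ∀ i < N, ∀ X ∈ G, (∀ j < i, ¬ Covers (e j) X) → cl X = cl (S i) →
      (X.inner ∩ (S i).inner).Nonempty → S i ≤ X)
    (hcl : ∀ i < N, ∀ X ∈ G, ∀ Y ∈ G, Covers (e i) X → Covers (e i) Y → cl X = cl Y)
    {i : ℕ} (hi : i < N) : ∃ l ∈ I, Covers (e l) (S i) := by
  by_contra! hno
  have hiI : i ∉ I := fun hiI => hno i hiI (h.covers i hi)
  rw [h.mem_iff] at hiI
  push Not at hiI
  obtain ⟨j, hj, hij, l, hlI, hil, hlj⟩ := hiI hi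
  have hl := h.lt hlI
  -- `S j` is the biset for which `i` was rejected in favour of `l`. The aim is the chain `S j ≤ S i
  -- ≤ S l`: since `e l` starts in `S j` and ends outside the outer part of `S l`, it then covers `S
  -- i`.
  have hji : j ≤ i := by
    by_contra! hlt
    exact h.uncovered j hj i hlt hij
  have hmono : ∀ a b, a ≤ b → b < N → cl (S b) = cl (S a) →
      ((S b).inner ∩ (S a).inner).Nonempty → S a ≤ S b := fun a b hab hb hc hn =>
    hle a (by omega) _ (hmem b hb) (fun t ht => h.uncovered b hb t (by omega)) hc hn
  have c1 : cl (S i) = cl (S j) := hcl i hi _ (hmem i hi) _ (hmem j hj) (h.covers i hi) hij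
  have c2 : cl (S l) = cl (S j) := hcl l hl _ (hmem l hl) _ (hmem j hj) (h.covers l hl) hlj
  have l1 : S j ≤ S i := hmono j i hji hi c1
    ⟨(e i).1, Finset.mem_inter.2 ⟨(h.covers i hi).1, hij.1⟩⟩
  have l2 : S i ≤ S l := hmono i l hil.le hl (c2.trans c1.symm)
    ⟨(e l).1, Finset.mem_inter.2 ⟨(h.covers l hl).1, l1.1 hlj.1⟩⟩
  exact hno l hlI ⟨l1.1 hlj.1, fun h' => (h.covers l hl).2 (l2.2 h')⟩

/-- The selected edges cover every subfamily that is covered by all edges and is closed under the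
union with the bisets of the list. -/
theorem TwoPhase.cover_subfamily (h : TwoPhase N S e I) (hmem : ∀ i < N, S i ∈ G)
    (hle : ∀ i < N, ∀ X ∈ G, (∀ j < i, ¬ Covers (e j) X) → cl X = cl (S i) →
      (X.inner ∩ (S i).inner).Nonempty → S i ≤ X)
    (hcl : ∀ i < N, ∀ X ∈ G, ∀ Y ∈ G, Covers (e i) X → Covers (e i) Y → cl X = cl Y)
    {T : Set (Biset V)} (hTG : T ⊆ G) (hall : ∀ X ∈ T, ∃ i < N, Covers (e i) X)
    (hT : ∀ X ∈ T, ∀ l < N, cl X = cl (S l) → (X.inner ∩ (S l).inner).Nonempty →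
      X.union (S l) ∈ T) :
    ∀ X ∈ T, ∃ i ∈ I, Covers (e i) X := by
  -- Backward induction on the index of the first edge covering `X`. If that edge `e i` is not kept,
  -- `X` is replaced by its union with a later `S l`, whose first covering edge comes after `i`.
  have key : ∀ d, ∀ X ∈ T, (∀ i, i + d < N → ¬ Covers (e i) X) → ∃ i ∈ I, Covers (e i) X := by
    intro d
    induction d with
    | zero =>
      intro X hX hno
      obtain ⟨i, hi, hc⟩ := hall X hX
      exact absurd hc (hno i (by omega))
    | succ d ih =>
      intro X hX hno
      by_cases hdN : d < N
      swap
      · exact ih X hX fun i hi => by omega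
      by_cases hc : Covers (e (N - 1 - d)) X
      swap
      · refine ih X hX fun i hi => ?_
        by_cases hid : i = N - 1 - d
        · exact hid ▸ hc
        · exact hno i (by omega)
      by_contra! hunc
      set i := N - 1 - d with hidef
      have hi : i < N := by omega
      have hXi : ∀ j < i, ¬ Covers (e j) X := fun j hj => hno j (by omega)
      obtain ⟨l, hlI, hli⟩ := h.exists_covers hmem hle hcl hi
      have hl := h.lt hlI
      have c1 : cl X = cl (S i) := hcl i hi _ (hTG hX) _ (hmem i hi) hc (h.covers i hi)
      have c2 : cl (S l) = cl (S i) := hcl l hl _ (hmem l hl) _ (hmem i hi) (h.covers l hl) hli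
      have l1 : S i ≤ X := hle i hi X (hTG hX) hXi c1
        ⟨(e i).1, Finset.mem_inter.2 ⟨hc.1, (h.covers i hi).1⟩⟩
      have hil : i ≤ l := by
        by_contra! hlt
        exact h.uncovered i hi l hlt hli
      have hil' : i < l := lt_of_le_of_ne hil fun h' => hunc i (h' ▸ hlI) hc
      have l2 : S i ≤ S l := hle i hi _ (hmem l hl)
        (fun t ht => h.uncovered l hl t (by omega)) c2
        ⟨(e l).1, Finset.mem_inter.2 ⟨(h.covers l hl).1, hli.1⟩⟩
      have hhead : (e l).2 ∈ X.outer := by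
        by_contra h'
        exact hunc l hlI ⟨l1.1 hli.1, h'⟩
      have hY := hT X hX l hl (c1.trans c2.symm)
        ⟨(e l).1, Finset.mem_inter.2 ⟨l1.1 hli.1, (h.covers l hl).1⟩⟩
      -- Earlier edges cover neither part of the union, and `e i` does not leave it because it runs
      -- inside `S l`. The kept edge found for the union must cover `X`: otherwise it covers `S l`,
      -- so by uniqueness it is `e l`, whose head lies in the outer part of `X`.
      obtain ⟨t, htI, ht⟩ := ih _ hY fun j hj hcj => by
        rcases Nat.lt_or_ge j i with hji | hji
        · exact hcj.of_union.elim (hXi j hji) (h.uncovered l hl j (by omega))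
        · have hji : j = i := by omega
          subst hji
          have hmi : (e i).1 ∈ (S l).inner := l2.1 (h.covers i hi).1
          have : (e i).2 ∈ (S l).outer := by
            by_contra h'
            exact h.uncovered l hl i hil' ⟨hmi, h'⟩
          exact hcj.2 (Finset.mem_union_right _ this)
      rcases ht.of_union with h' | h'
      · exact hunc t htI h'
      · rw [h.unique hl htI hlI h' (h.covers l hl)] at ht
        exact ht.2 (Finset.mem_union_left _ hhead)
  exact fun X hX => key N X hX fun i hi => by omega

end TwoPhase

/-! ### Weak linear programming duality. -/

section Duality

variable {V : Type*} [Fintype V] [DecidableEq V]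

/-- Weak duality for the covering linear program. -/
theorem dual_le_lpValue {E : Finset (V × V)} {c : V × V → ℝ} {F : Set (Biset V)}
    (hE : IsEdgeCover E F) {N : ℕ} {S : ℕ → Biset V} {y : ℕ → ℝ}
    (hS : ∀ i < N, S i ∈ F) (hy : ∀ i < N, 0 ≤ y i)
    (feas : ∀ f ∈ E, ∑ j ∈ Finset.range N with Covers f (S j), y j ≤ c f) :
    ∑ j ∈ Finset.range N, y j ≤ lpValue E c F := by
  apply le_csInf
  -- The all-ones vector is feasible because `E` covers `F`; without a feasible point the infimum
  -- would be a junk value.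
  · refine ⟨∑ e ∈ E, c e * 1, fun _ => 1, ⟨fun _ _ => zero_le_one, fun S hS => ?_⟩, rfl⟩
    obtain ⟨e, he, hcov⟩ := hE S hS
    rw [Finset.sum_const, nsmul_eq_mul, mul_one]
    exact_mod_cast Finset.card_pos.2 ⟨e, Finset.mem_filter.2 ⟨he, hcov⟩⟩
  · rintro z ⟨x, ⟨hx0, hx⟩, rfl⟩
    calc ∑ j ∈ Finset.range N, y j
        ≤ ∑ j ∈ Finset.range N, y j * ∑ e ∈ E with Covers e (S j), x e := by
          refine Finset.sum_le_sum fun j hj => ?_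
          have hj' := Finset.mem_range.1 hj
          exact le_mul_of_one_le_right (hy j hj') (hx _ (hS j hj'))
      _ = ∑ e ∈ E, (∑ j ∈ Finset.range N with Covers e (S j), y j) * x e := by
          simp_rw [Finset.sum_filter, Finset.mul_sum, Finset.sum_mul]
          rw [Finset.sum_comm]
          refine Finset.sum_congr rfl fun e _ => Finset.sum_congr rfl fun j _ => ?_
          split_ifs <;> simp
      _ ≤ ∑ e ∈ E, c e * x e := by
          refine Finset.sum_le_sum fun e he => ?_
          exact mul_le_mul_of_nonneg_right (feas e he) (hx0 e he)

end Duality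

/-! ### A primal-dual phase driven by the oracle, and the preliminary phase. -/

section Phase

variable {n : ℕ}

/-- The rule by which a phase of the algorithm chooses the bisets to be covered: the orientation,
the pairs of nodes for which the oracle is called, the nodes that are forbidden for such a pair,
and the bound on the size of an answer. -/
structure Rule (n : ℕ) where
  co : Bool
  admits : Fin n → Fin n → Prop
  forbids : Fin n → Fin n → Fin n → Prop
  lim : ℕ

/-- The biset given by an answer of the oracle. -/
def view (co : Bool) (A : Biset (Fin n)) : Biset (Fin n) := if co then A.co else A

open Classical in
/-- Artificial edges that cover the bisets containing a forbidden node. -/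
noncomputable def Rule.blockers (R : Rule n) (u v : Fin n) : Finset (Fin n × Fin n) :=
  Finset.univ.filter fun e => e.2 = v ∧ R.forbids u v e.1

theorem Rule.mem_blockers {R : Rule n} {u v : Fin n} {f : Fin n × Fin n} :
    f ∈ R.blockers u v ↔ f.2 = v ∧ R.forbids u v f.1 := by
  classical
  rw [Rule.blockers, Finset.mem_filter]
  exact and_iff_right (Finset.mem_univ f)

/-- `A` is an admissible answer of the oracle for the pair `u`, `v`. -/
def Rule.Eligible (R : Rule n) (O : Oracle n) (J : Finset (Fin n × Fin n)) (u v : Fin n)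
    (A : Biset (Fin n)) : Prop :=
  R.admits u v ∧ A.inner.card + A.inner.card ≤ R.lim ∧ O R.co (J ∪ R.blockers u v) u v = some A

/-- `S` comes from a smallest admissible answer of the oracle. -/
def Rule.Best (R : Rule n) (O : Oracle n) (J : Finset (Fin n × Fin n)) (S : Biset (Fin n)) :
    Prop :=
  ∃ u v A, R.Eligible O J u v A ∧ S = view R.co A ∧
    ∀ u' v' A', R.Eligible O J u' v' A' → A.inner.card ≤ A'.inner.card

/-- A primal-dual phase, by which the edges `e i` with `i ∈ I` are added to `J`. -/
structure PhaseRun (O : Oracle n) (R : Rule n) (E : Finset (Fin n × Fin n))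
    (c : Fin n × Fin n → ℝ) (J : Finset (Fin n × Fin n)) (N : ℕ) (S : ℕ → Biset (Fin n))
    (e : ℕ → Fin n × Fin n) (y : ℕ → ℝ) (I : Finset ℕ) : Prop where
  two : TwoPhase N S e I
  edge_mem : ∀ i < N, e i ∈ E
  best : ∀ i < N, R.Best O (J ∪ (Finset.range i).image e) (S i)
  nonneg : ∀ i < N, 0 ≤ y i
  feasible : ∀ f ∈ E, ∑ j ∈ Finset.range N with Covers f (S j), y j ≤ c f
  tight : ∀ i < N, c (e i) = ∑ j ∈ Finset.range N with Covers (e i) (S j), y j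
  not_eligible : ∀ u v A, ¬ R.Eligible O (J ∪ (Finset.range N).image e) u v A

variable {O : Oracle n} {F : Set (Biset (Fin n))} {R : Rule n} {E J : Finset (Fin n × Fin n)}
  {c : Fin n × Fin n → ℝ} {N : ℕ} {S : ℕ → Biset (Fin n)} {e : ℕ → Fin n × Fin n} {y : ℕ → ℝ}
  {I : Finset ℕ}

theorem view_mem_separating (hF : IsCrossing F) (hO : O.IsCoreOracle F) {co : Bool}
    {u v : Fin n} {A : Biset (Fin n)} (h : O co J u v = some A) :
    view co A ∈ separating (residual F J) u v := by
  cases co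
  · exact ((hO J u v).1 A h).1
  · exact (core_coFamily_separating (hF.residual J) ((hO J u v).2.2.1 A h)).1

theorem Rule.Eligible.view_mem (hF : IsCrossing F) (hO : O.IsCoreOracle F) {u v : Fin n}
    {A : Biset (Fin n)} (h : R.Eligible O J u v A) :
    view R.co A ∈ separating (residual F (J ∪ R.blockers u v)) u v :=
  view_mem_separating hF hO h.2.2

theorem Rule.Best.mem (hF : IsCrossing F) (hO : O.IsCoreOracle F) {X : Biset (Fin n)}
    (h : R.Best O J X) : X ∈ residual F J := by
  obtain ⟨u, v, A, hA, rfl, -⟩ := h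
  have := (hA.view_mem hF hO).1
  rw [← residual_residual] at this
  exact this.1

theorem PhaseRun.cost_le (hF : IsCrossing F) (hO : O.IsCoreOracle F) (hE : IsEdgeCover E F)
    (hc : ∀ e ∈ E, 0 ≤ c e) (h : PhaseRun O R E c J N S e y I) :
    ∑ f ∈ I.image e, c f ≤ lpValue E c F := by
  refine (h.two.cost_le h.nonneg (fun f hf => ?_) h.tight).trans
    (dual_le_lpValue hE (fun i hi => ((h.best i hi).mem hF hO).1) h.nonneg h.feasible)
  obtain ⟨i, hi, rfl⟩ := Finset.mem_image.1 hf
  exact hc _ (h.edge_mem i (h.two.lt hi))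

/-- The first chosen biset would be an uncovered member; so phases run after `F` is covered are
free. -/
theorem PhaseRun.selected_eq_empty (hF : IsCrossing F) (hO : O.IsCoreOracle F)
    (h : PhaseRun O R E c J N S e y I) (hJ : residual F J = ∅) : I = ∅ := by
  rw [Finset.eq_empty_iff_forall_notMem]
  intro i hi
  have h1 := (h.best 0 (by have := h.two.lt hi; omega)).mem hF hO
  rw [← residual_residual, hJ] at h1
  exact h1.1

theorem mem_residual_image {X : Biset (Fin n)} {s : Finset ℕ} :
    X ∈ residual F (J ∪ s.image e) ↔ X ∈ residual F J ∧ ∀ i ∈ s, ¬ Covers (e i) X := by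
  rw [← residual_residual]
  simp [residual]

/-! ### Covering small bisets of a regular family -/

/-- The rule for covering the members with `2 |S| ≤ n - k`. -/
def smallRule (n k : ℕ) : Rule n where
  co := false
  admits _ _ := True
  forbids _ _ _ := False
  lim := n - k

theorem smallRule_eligible {k : ℕ} {u v : Fin n} {A : Biset (Fin n)} :
    (smallRule n k).Eligible O J u v A ↔
      A.inner.card + A.inner.card ≤ n - k ∧ O false J u v = some A := by
  simp [Rule.Eligible, smallRule, Rule.blockers]

/-- The members with `2 |S| ≤ n - k`. -/
def smallMembers (k : ℕ) (F : Set (Biset (Fin n))) : Set (Biset (Fin n)) :=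
  {S ∈ F | S.inner.card + S.inner.card ≤ n - k}

/-- The common node makes the union have at most `n - k - 1` inner nodes, which is exactly the room
that regularity asks for. The union itself may fail to be small. -/
theorem IsRegular.small {k : ℕ} (hk : IsRegular k F) (hkn : k < n) {X Y : Biset (Fin n)}
    (hX : X ∈ smallMembers k F) (hY : Y ∈ smallMembers k F)
    (h : (X.inner ∩ Y.inner).Nonempty) : X.inter Y ∈ smallMembers k F ∧ X.union Y ∈ F := by
  have h1 := Finset.card_union_add_card_inter X.inner Y.inner
  have h2 := h.card_pos
  have h3 := hX.2
  have h4 := hY.2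
  have h5 := Finset.card_compl (X.inner ∪ Y.inner)
  rw [Fintype.card_fin] at h5
  obtain ⟨a, b⟩ := hk X hX.1 Y hY.1 h (by omega)
  refine ⟨⟨a, ?_⟩, b⟩
  have := Finset.card_le_card (Finset.inter_subset_left (s₁ := X.inner) (s₂ := Y.inner))
  simp only [Biset.inter_inner]
  omega

/-- Let `A = S i` be the answer for `u, v`, and let `w` be a common node of `A` and `X`. The
intersection of `A` and `X` separates `w` from `v`, so the core for `w, v` is a small answer inside
it. As `A` is a smallest answer, `A.inner ⊆ X.inner`. Then the intersection separates `u` from `v`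
as well, and `A` is the least member doing so. -/
theorem PhaseRun.small_le (hF : IsCrossing F) (hO : O.IsCoreOracle F) {k : ℕ}
    (hk : IsRegular k F) (hkn : k < n) (h : PhaseRun O (smallRule n k) E c ∅ N S e y I) {i : ℕ}
    (hi : i < N) {X : Biset (Fin n)} (hX : X ∈ smallMembers k F)
    (hun : ∀ j < i, ¬ Covers (e j) X) (hm : (X.inner ∩ (S i).inner).Nonempty) : S i ≤ X := by
  obtain ⟨u, v, A, hA, hSA, hmin⟩ := h.best i hi
  have hSA' : S i = A := hSA
  rw [hSA'] at hm ⊢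
  rw [smallRule_eligible] at hA
  set Ji := (∅ : Finset (Fin n × Fin n)) ∪ (Finset.range i).image e with hJi
  have hcore := (hO Ji u v).1 A hA.2
  have hAmem := hcore.1
  have hAs : A ∈ smallMembers k F := ⟨hAmem.1.1, hA.1⟩
  have hx := (hk.small hkn hAs hX (by rwa [Finset.inter_comm])).1
  have hXr : X ∈ residual F Ji := by
    rw [hJi, mem_residual_image]
    refine ⟨⟨hX.1, by simp⟩, fun j hj => hun j (Finset.mem_range.1 hj)⟩
  have hxr : A.inter X ∈ residual F Ji :=
    ⟨hx.1, fun f hf hc => hc.of_inter.elim (hAmem.1.2 f hf) (hXr.2 f hf)⟩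
  have hv : v ∉ (A.inter X).outer := fun h' => hAmem.2.2 (Finset.mem_inter.1 h').1
  obtain ⟨w, hw⟩ := hm
  rw [Finset.inter_comm] at hw
  have hwsep : A.inter X ∈ separating (residual F Ji) w v := ⟨hxr, hw, hv⟩
  have hsub : A.inner ⊆ X.inner := by
    rcases hq : O false Ji w v with _ | A'
    · rw [(hO Ji w v).2.1 hq] at hwsep
      exact hwsep.elim
    · have hle := core_separating_le (hF.residual Ji) ((hO Ji w v).1 A' hq) hwsep
      have hc1 := Finset.card_le_card (Biset.le_def.1 hle).1
      have hc2 := hmin w v A' (smallRule_eligible.2 ⟨by have := hx.2; omega, hq⟩)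
      have : A.inner ∩ X.inner = A.inner :=
        Finset.eq_of_subset_of_card_le Finset.inter_subset_left (hc2.trans hc1)
      exact Finset.inter_eq_left.1 this
  have hu : u ∈ (A.inter X).inner :=
    Finset.mem_inter.2 ⟨hAmem.2.1, hsub hAmem.2.1⟩
  exact (core_separating_le (hF.residual Ji) hcore ⟨hxr, hu, hv⟩).trans
    (Biset.inter_le_right _ _)

theorem PhaseRun.small_covered (hF : IsCrossing F) (hP : ∀ S ∈ F, S.Proper)
    (hO : O.IsCoreOracle F) {k : ℕ}
    (h : PhaseRun O (smallRule n k) E c ∅ N S e y I) {X : Biset (Fin n)}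
    (hX : X ∈ smallMembers k F) : ∃ i < N, Covers (e i) X := by
  by_contra! hno
  obtain ⟨⟨u, hu⟩, ⟨v, hv⟩⟩ := hP X hX.1
  set J' := (∅ : Finset (Fin n × Fin n)) ∪ (Finset.range N).image e with hJ'
  have hXr : X ∈ residual F J' := by
    rw [hJ', mem_residual_image]
    exact ⟨⟨hX.1, by simp⟩, fun j hj => hno j (Finset.mem_range.1 hj)⟩
  have hsep : X ∈ separating (residual F J') u v := ⟨hXr, hu, Finset.mem_compl.1 hv⟩
  rcases hq : O false J' u v with _ | A
  · rw [(hO J' u v).2.1 hq] at hsep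
    exact hsep.elim
  · have hle := core_separating_le (hF.residual J') ((hO J' u v).1 A hq) hsep
    have := Finset.card_le_card (Biset.le_def.1 hle).1
    have h2 := hX.2
    exact h.not_eligible u v A (smallRule_eligible.2 ⟨by omega, hq⟩)

/-- The bisets of the list that meet no later biset of the list. -/
def IsTop (N : ℕ) (S : ℕ → Biset (Fin n)) (p : ℕ) : Prop :=
  p < N ∧ ∀ g < N, p < g → ¬ ((S g).inner ∩ (S p).inner).Nonempty

theorem PhaseRun.small_mem (hF : IsCrossing F) (hO : O.IsCoreOracle F) {k : ℕ}
    (h : PhaseRun O (smallRule n k) E c ∅ N S e y I) {i : ℕ} (hi : i < N) :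
    S i ∈ smallMembers k F := by
  have h1 := ((h.best i hi).mem hF hO).1
  obtain ⟨u, v, A, hA, hSA, -⟩ := h.best i hi
  have hSA' : S i = A := hSA
  rw [smallRule_eligible] at hA
  exact ⟨h1, hSA' ▸ hA.1⟩

theorem PhaseRun.small_mono (hF : IsCrossing F) (hO : O.IsCoreOracle F) {k : ℕ}
    (hk : IsRegular k F) (hkn : k < n) (h : PhaseRun O (smallRule n k) E c ∅ N S e y I)
    {i j : ℕ} (hij : i ≤ j) (hj : j < N) (hm : ((S j).inner ∩ (S i).inner).Nonempty) :
    S i ≤ S j :=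
  h.small_le hF hO hk hkn (by omega) (h.small_mem hF hO hj)
    (fun t ht => h.two.uncovered j hj t (by omega)) hm

theorem PhaseRun.exists_top (hF : IsCrossing F) (hO : O.IsCoreOracle F) {k : ℕ}
    (hk : IsRegular k F) (hkn : k < n) (h : PhaseRun O (smallRule n k) E c ∅ N S e y I)
    {i : ℕ} (hi : i < N) {a : Fin n} (ha : a ∈ (S i).inner) :
    ∃ p, IsTop N S p ∧ a ∈ (S p).inner := by
  classical
  obtain ⟨p, hp, hmax⟩ := Finset.exists_max_image
    ((Finset.range N).filter fun j => a ∈ (S j).inner) id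
    ⟨i, Finset.mem_filter.2 ⟨Finset.mem_range.2 hi, ha⟩⟩
  rw [Finset.mem_filter, Finset.mem_range] at hp
  refine ⟨p, ⟨hp.1, fun g hg hpg hm => ?_⟩, hp.2⟩
  have := h.small_mono hF hO hk hkn hpg.le hg hm
  have := hmax g (Finset.mem_filter.2 ⟨Finset.mem_range.2 hg, this.1 hp.2⟩)
  simp only [id] at this
  omega

/-- If a small biset `D` is not covered by the selected edges, then the edge of every top biset
that meets `D` leaves the common part of both. -/
theorem PhaseRun.top_edge (hF : IsCrossing F) (hP : ∀ S ∈ F, S.Proper) (hO : O.IsCoreOracle F)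
    {k : ℕ} (hk : IsRegular k F) (hkn : k < n)
    (h : PhaseRun O (smallRule n k) E c ∅ N S e y I) {D : Biset (Fin n)}
    (hD : D ∈ smallMembers k F) (hDI : ∀ i ∈ I, ¬ Covers (e i) D) {p : ℕ} (hp : IsTop N S p)
    (hm : (D.inner ∩ (S p).inner).Nonempty) :
    (e p).1 ∈ D.inner ∧ (e p).2 ∈ D.outer := by
  have hSp := h.small_mem hF hO hp.1
  have hcov := h.two.cover_subfamily (G := smallMembers k F) (cl := fun _ => ())
    (fun i hi => h.small_mem hF hO hi)
    (fun i hi X hX hun _ hm => h.small_le hF hO hk hkn hi hX hun hm)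
    (fun _ _ _ _ _ _ _ _ => rfl) (T := {X ∈ smallMembers k F | X ≤ S p}) (fun X hX => hX.1)
    (fun X hX => h.small_covered hF hP hO hX.1)
    (fun X hX l hl _ hm => by
      have hlp : ((S l).inner ∩ (S p).inner).Nonempty := by
        obtain ⟨x, hx⟩ := hm
        rw [Finset.mem_inter] at hx
        exact ⟨x, Finset.mem_inter.2 ⟨hx.2, hX.2.1 hx.1⟩⟩
      have hlp' : l ≤ p := by
        by_contra! hlt
        exact hp.2 l hl hlt hlp
      have hle : X.union (S l) ≤ S p := Biset.union_le hX.2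
        (h.small_mono hF hO hk hkn hlp' hp.1 (by rwa [Finset.inter_comm]))
      refine ⟨⟨(hk.small hkn hX.1 (h.small_mem hF hO hl) hm).2, ?_⟩, hle⟩
      have := Finset.card_le_card (Biset.le_def.1 hle).1
      have := hSp.2
      omega)
  obtain ⟨l, hlI, hl⟩ := hcov (D.inter (S p))
    ⟨(hk.small hkn hD hSp hm).1, Biset.inter_le_right _ _⟩
  have hlN := h.two.lt hlI
  have hlp : Covers (e l) (S p) := hl.of_inter.resolve_left (hDI l hlI)
  have hpl : p ≤ l := by
    by_contra! hlt
    exact h.two.uncovered p hp.1 l hlt hlp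
  -- The kept edge leaves `S p`, so it is not earlier than `p`; a later `S l` would contain its tail
  -- and meet `S p`, against the choice of a top biset. Hence `e p` itself is kept.
  obtain rfl : p = l := by
    by_contra hne
    exact hp.2 l hlN (by omega)
      ⟨(e l).1, Finset.mem_inter.2 ⟨(h.two.covers l hlN).1, hlp.1⟩⟩
  have htail : (e p).1 ∈ D.inner := (Finset.mem_inter.1 hl.1).1
  refine ⟨htail, ?_⟩
  by_contra hout
  exact hDI p hlI ⟨htail, hout⟩

/-- The union of a biset `D` and the bisets `S p` with `p ∈ Q`. -/
def attach (S : ℕ → Biset (Fin n)) (D : Biset (Fin n)) (Q : Finset ℕ) : Biset (Fin n) where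
  inner := D.inner ∪ Q.biUnion fun p => (S p).inner
  outer := D.outer ∪ Q.biUnion fun p => (S p).outer
  subset := Finset.union_subset_union D.subset (Finset.biUnion_mono fun p _ => (S p).subset)

open Classical in
/-- The top bisets that meet `D`. -/
noncomputable def topsAt (N : ℕ) (S : ℕ → Biset (Fin n)) (D : Biset (Fin n)) : Finset ℕ :=
  (Finset.range N).filter fun p => IsTop N S p ∧ (D.inner ∩ (S p).inner).Nonempty

theorem mem_topsAt {D : Biset (Fin n)} {p : ℕ} :
    p ∈ topsAt N S D ↔ IsTop N S p ∧ (D.inner ∩ (S p).inner).Nonempty := by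
  classical
  rw [topsAt, Finset.mem_filter, Finset.mem_range]
  exact ⟨fun h => h.2, fun h => ⟨h.1.1, h⟩⟩

theorem IsTop.eq {p g : ℕ} (hp : IsTop N S p) (hg : IsTop N S g) {a : Fin n}
    (h : a ∈ (S p).inner) (h' : a ∈ (S g).inner) : p = g := by
  rcases lt_trichotomy p g with hlt | heq | hlt
  · exact absurd ⟨a, Finset.mem_inter.2 ⟨h', h⟩⟩ (hp.2 g hg.1 hlt)
  · exact heq
  · exact absurd ⟨a, Finset.mem_inter.2 ⟨h, h'⟩⟩ (hg.2 p hp.1 hlt)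

/-- If the enlargement were small, regularity would make it a member, covered by some `e g`. The
tail of `e g` lies in one of the attached top bisets, which `e g` then also leaves; this forces the
top index to be `g`. By `PhaseRun.top_edge` the head of `e g` lies in the outer part of `D`, a
contradiction. -/
theorem PhaseRun.attach_large (hF : IsCrossing F) (hP : ∀ S ∈ F, S.Proper)
    (hO : O.IsCoreOracle F) {k : ℕ} (hk : IsRegular k F) (hkn : k < n)
    (h : PhaseRun O (smallRule n k) E c ∅ N S e y I) {D : Biset (Fin n)}
    (hD : D ∈ smallMembers k F) (hDI : ∀ i ∈ I, ¬ Covers (e i) D) :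
    n - k + 1 ≤ 2 * (attach S D (topsAt N S D)).inner.card := by
  classical
  by_contra! hsmall
  have hmem : ∀ Q ⊆ topsAt N S D, attach S D Q ∈ smallMembers k F := by
    intro Q
    induction Q using Finset.induction_on with
    | empty =>
      intro _
      have : attach S D ∅ = D := by ext <;> simp [attach]
      rwa [this]
    | insert p Q _ ih =>
      intro hQ
      have hp := mem_topsAt.1 (hQ (Finset.mem_insert_self p Q))
      have hQ' := ih ((Finset.subset_insert p Q).trans hQ)
      have heq : attach S D (insert p Q) = (attach S D Q).union (S p) := by
        ext x <;> simp only [attach, Finset.biUnion_insert, Finset.mem_union,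
          Biset.union_inner, Biset.union_outer] <;> tauto
      have hsub : (attach S D (insert p Q)).inner ⊆ (attach S D (topsAt N S D)).inner :=
        Finset.union_subset_union_right (Finset.biUnion_subset_biUnion_of_subset_left _ hQ)
      have hcard := Finset.card_le_card hsub
      refine ⟨?_, by omega⟩
      rw [heq]
      obtain ⟨x, hx⟩ := hp.2
      rw [Finset.mem_inter] at hx
      exact (hk.small hkn hQ' (h.small_mem hF hO hp.1.1)
        ⟨x, Finset.mem_inter.2 ⟨Finset.mem_union_left _ hx.1, hx.2⟩⟩).2
  have hB := hmem _ subset_rfl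
  have hex := h.small_covered hF hP hO hB
  obtain ⟨hg, hcov⟩ := Nat.find_spec hex
  set g := Nat.find hex
  have htailS : (e g).1 ∈ (S g).inner := (h.two.covers g hg).1
  obtain ⟨p, hp, hap⟩ := h.exists_top hF hO hk hkn hg htailS
  have hpD : p ∈ topsAt N S D := by
    rcases Finset.mem_union.1 hcov.1 with h1 | h1
    · exact mem_topsAt.2 ⟨hp, ⟨_, Finset.mem_inter.2 ⟨h1, hap⟩⟩⟩
    · obtain ⟨p', hp', ha'⟩ := Finset.mem_biUnion.1 h1
      rw [hp.eq (mem_topsAt.1 hp').1 hap ha']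
      exact hp'
  have hgp : Covers (e g) (S p) := ⟨hap, fun h' => hcov.2
    (Finset.mem_union_right _ (Finset.mem_biUnion.2 ⟨p, hpD, h'⟩))⟩
  have hpg : p ≤ g := by
    by_contra! hlt
    exact h.two.uncovered p hp.1 g hlt hgp
  have hpg' : p = g := by
    by_contra hne
    exact hp.2 g hg (by omega) ⟨(e g).1, Finset.mem_inter.2 ⟨htailS, hap⟩⟩
  have hout := (h.top_edge hF hP hO hk hkn hD hDI hp (mem_topsAt.1 hpD).2).2
  rw [hpg'] at hout
  exact hcov.2 (Finset.mem_union_left _ hout)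

/-- The edge of an attached top biset has its tail in `D`, so a top biset is attached to at most one
of two disjoint `D`; and distinct top bisets are disjoint. -/
theorem PhaseRun.attach_disjoint (hF : IsCrossing F) (hP : ∀ S ∈ F, S.Proper)
    (hO : O.IsCoreOracle F) {k : ℕ} (hk : IsRegular k F) (hkn : k < n)
    (h : PhaseRun O (smallRule n k) E c ∅ N S e y I) {D D' : Biset (Fin n)}
    (hD : D ∈ smallMembers k F) (hDI : ∀ i ∈ I, ¬ Covers (e i) D)
    (hD' : D' ∈ smallMembers k F) (hDI' : ∀ i ∈ I, ¬ Covers (e i) D')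
    (hdis : Disjoint D.inner D'.inner) :
    Disjoint (attach S D (topsAt N S D)).inner (attach S D' (topsAt N S D')).inner := by
  classical
  have key : ∀ p, p ∈ topsAt N S D → p ∉ topsAt N S D' := fun p hp hp' => by
    rw [mem_topsAt] at hp hp'
    exact Finset.disjoint_left.1 hdis (h.top_edge hF hP hO hk hkn hD hDI hp.1 hp.2).1
      (h.top_edge hF hP hO hk hkn hD' hDI' hp'.1 hp'.2).1
  rw [Finset.disjoint_left]
  intro x hx hx'
  rcases Finset.mem_union.1 hx with h1 | h1 <;> rcases Finset.mem_union.1 hx' with h2 | h2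
  · exact Finset.disjoint_left.1 hdis h1 h2
  · obtain ⟨p, hp, ha⟩ := Finset.mem_biUnion.1 h2
    exact key p (mem_topsAt.2 ⟨(mem_topsAt.1 hp).1, ⟨x, Finset.mem_inter.2 ⟨h1, ha⟩⟩⟩) hp
  · obtain ⟨p, hp, ha⟩ := Finset.mem_biUnion.1 h1
    exact key p hp (mem_topsAt.2 ⟨(mem_topsAt.1 hp).1, ⟨x, Finset.mem_inter.2 ⟨h2, ha⟩⟩⟩)
  · obtain ⟨p, hp, ha⟩ := Finset.mem_biUnion.1 h1
    obtain ⟨p', hp', ha'⟩ := Finset.mem_biUnion.1 h2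
    rw [← (mem_topsAt.1 hp).1.eq (mem_topsAt.1 hp').1 ha ha'] at hp'
    exact key p hp hp'

/-- After the phase there are few disjoint small bisets that are not covered. -/
theorem PhaseRun.small_packing (hF : IsCrossing F) (hP : ∀ S ∈ F, S.Proper)
    (hO : O.IsCoreOracle F) {k : ℕ} (hk : IsRegular k F) (hkn : k < n)
    (h : PhaseRun O (smallRule n k) E c ∅ N S e y I) (𝒟 : Set (Biset (Fin n)))
    (h𝒟 : ∀ D ∈ 𝒟, D ∈ smallMembers k F ∧ ∀ i ∈ I, ¬ Covers (e i) D)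
    (hdis : 𝒟.PairwiseDisjoint Biset.inner) : 𝒟.ncard * (n - k + 1) ≤ 2 * n := by
  classical
  lift 𝒟 to Finset (Biset (Fin n)) using Set.toFinite _
  rw [Set.ncard_coe_finset]
  have hd : (𝒟 : Set (Biset (Fin n))).PairwiseDisjoint
      fun D => (attach S D (topsAt N S D)).inner := fun D hD D' hD' hne =>
    h.attach_disjoint hF hP hO hk hkn (h𝒟 D hD).1 (h𝒟 D hD).2 (h𝒟 D' hD').1 (h𝒟 D' hD').2
      (hdis hD hD' hne)
  have h1 := Finset.card_le_univ (𝒟.biUnion fun D => (attach S D (topsAt N S D)).inner)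
  rw [Finset.card_biUnion hd, Fintype.card_fin] at h1
  have h2 : 𝒟.card * (n - k + 1) ≤
      ∑ D ∈ 𝒟, 2 * (attach S D (topsAt N S D)).inner.card := by
    rw [← smul_eq_mul]
    exact Finset.card_nsmul_le_sum _ _ _ fun D hD =>
      h.attach_large hF hP hO hk hkn (h𝒟 D hD).1 (h𝒟 D hD).2
  rw [← Finset.mul_sum] at h2
  omega

end Phase

/-! ### The phase covering the members with a single atom. -/

section Halo

variable {n : ℕ} {O : Oracle n} {F : Set (Biset (Fin n))} {E J : Finset (Fin n × Fin n)}
  {c : Fin n × Fin n → ℝ} {N : ℕ} {S : ℕ → Biset (Fin n)} {e : ℕ → Fin n × Fin n} {y : ℕ → ℝ}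
  {I : Finset ℕ}

/-- The node `x` belongs to the core for the pair `w`, `v`. -/
def InCore (O : Oracle n) (J : Finset (Fin n × Fin n)) (w v x : Fin n) : Prop :=
  ∃ K, O false J w v = some K ∧ x ∈ K.inner

/-- The core for the pair `w`, `v` is an atom. -/
def InAtom (O : Oracle n) (J : Finset (Fin n × Fin n)) (w v : Fin n) : Prop :=
  InCore O J w v w ∧ ∀ x, InCore O J w v x → InCore O J x v w

/-- The rule for covering the members that contain a single atom of the residual family of `J`. -/
def haloRule (O : Oracle n) (J : Finset (Fin n × Fin n)) : Rule n where
  co := true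
  admits u v := InAtom O J u v
  forbids u v w := InAtom O J w v ∧ ¬ InCore O J u v w
  lim := n + n

/-- The members of `G` that contain a single atom. -/
def halo (G : Set (Biset (Fin n))) : Set (Biset (Fin n)) :=
  {X ∈ G | ∀ C D, Atom G C → Atom G D → C ≤ X → D ≤ X → C = D}

theorem exists_answer (hF : IsCrossing F) (hO : O.IsCoreOracle F) {u v : Fin n}
    {X : Biset (Fin n)} (hX : X ∈ separating (residual F J) u v) :
    ∃ K, O false J u v = some K ∧ K ∈ separating (residual F J) u v ∧ K ≤ X := by
  rcases hq : O false J u v with _ | K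
  · rw [(hO J u v).2.1 hq] at hX
    exact hX.elim
  · have hK := (hO J u v).1 K hq
    exact ⟨K, rfl, hK.1, core_separating_le (hF.residual J) hK hX⟩

/-- This makes atoms recognizable from oracle answers. A member `X` below the core `K` has a node
`x`, and the core for `x, v` lies in `X`. By the symmetry test it contains `u`, so `X` separates `u`
from `v` and `K ≤ X`. -/
theorem InAtom.exists_atom (hF : IsCrossing F) (hP : ∀ S ∈ F, S.Proper) (hO : O.IsCoreOracle F)
    {u v : Fin n} (h : InAtom O J u v) : ∃ K, O false J u v = some K ∧ u ∈ K.inner ∧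
      Atom (residual F J) K ∧ ∀ X ∈ separating (residual F J) u v, K ≤ X := by
  obtain ⟨⟨K, hK, hu⟩, hall⟩ := h
  have hcore := (hO J u v).1 K hK
  refine ⟨K, hK, hu, ⟨hcore.1.1, fun X hX hXK => ?_⟩,
    fun X hX => core_separating_le (hF.residual J) hcore hX⟩
  obtain ⟨x, hx⟩ := (hP X hX.1).1
  have hv : v ∉ X.outer := fun h' => hcore.1.2.2 ((Biset.le_def.1 hXK).2 h')
  obtain ⟨K', hK', -, hle⟩ := exists_answer hF hO (J := J) (u := x) (v := v) ⟨hX, hx, hv⟩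
  obtain ⟨K'', hK'', hu''⟩ := hall x ⟨K, hK, (Biset.le_def.1 hXK).1 hx⟩
  rw [hK'] at hK''
  obtain rfl := Option.some.inj hK''
  exact core_separating_le (hF.residual J) hcore ⟨hX, (Biset.le_def.1 hle).1 hu'', hv⟩

theorem Atom.answer (hF : IsCrossing F) (hO : O.IsCoreOracle F) {C : Biset (Fin n)}
    (hC : Atom (residual F J) C) {u v : Fin n} (hu : u ∈ C.inner) (hv : v ∉ C.outer) :
    O false J u v = some C := by
  obtain ⟨K, hK, hmem, hle⟩ := exists_answer hF hO (J := J) ⟨hC.1, hu, hv⟩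
  rw [hK, le_antisymm hle (hC.2 hmem.1 hle)]

theorem Atom.inAtom (hF : IsCrossing F) (hO : O.IsCoreOracle F) {C : Biset (Fin n)}
    (hC : Atom (residual F J) C) {u v : Fin n} (hu : u ∈ C.inner) (hv : v ∉ C.outer) :
    InAtom O J u v := by
  refine ⟨⟨C, hC.answer hF hO hu hv, hu⟩, ?_⟩
  rintro x ⟨K, hK, hx⟩
  rw [hC.answer hF hO hu hv] at hK
  obtain rfl := Option.some.inj hK
  exact ⟨_, hC.answer hF hO hx hv, hu⟩

theorem ne_univ_of_notMem {X : Finset (Fin n)} {v : Fin n} (h : v ∉ X) : X ≠ Finset.univ :=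
  fun h' => h (h' ▸ Finset.mem_univ v)

theorem Biset.Proper.outer_ne_univ {X : Biset (Fin n)} (h : X.Proper) :
    X.outer ≠ Finset.univ := by
  obtain ⟨v, hv⟩ := h.2
  exact ne_univ_of_notMem (Finset.mem_compl.1 hv)

/-- The blockers do not exclude members with a single atom: a blocker leaving `X` would start in an
atom below `X`, hence in `K`, whose nodes are not forbidden. -/
theorem halo_separating (hF : IsCrossing F) (hP : ∀ S ∈ F, S.Proper) (hO : O.IsCoreOracle F)
    {J' : Finset (Fin n × Fin n)} {X K : Biset (Fin n)} (hX : X ∈ halo (residual F J))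
    (hXJ : X ∈ residual F J') (hK : Atom (residual F J) K) (hKX : K ≤ X) {u v : Fin n}
    (hu : u ∈ K.inner) (hv : v ∉ X.outer) :
    X ∈ separating (residual F (J' ∪ (haloRule O J).blockers u v)) u v := by
  have hKX' := Biset.le_def.1 hKX
  rw [← residual_residual]
  refine ⟨⟨hXJ, ?_⟩, hKX'.1 hu, hv⟩
  rintro ⟨w, v'⟩ hf hcov
  obtain ⟨rfl, hat, hnot⟩ := Rule.mem_blockers.1 hf
  obtain ⟨C, -, hw, hC, hle⟩ := hat.exists_atom hF hP hO
  have hCX := hle X ⟨hX.1, hcov.1, hcov.2⟩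
  rw [hX.2 C K hC hK hCX hKX] at hw
  exact hnot ⟨K, hK.answer hF hO hu fun h' => hv (hKX'.2 h'), hw⟩

theorem halo_query (hF : IsCrossing F) (hP : ∀ S ∈ F, S.Proper) (hO : O.IsCoreOracle F)
    {J' : Finset (Fin n × Fin n)} {X K : Biset (Fin n)} (hX : X ∈ halo (residual F J))
    (hXJ : X ∈ residual F J') (hK : Atom (residual F J) K) (hKX : K ≤ X) {u v : Fin n}
    (hu : u ∈ K.inner) (hv : v ∉ X.outer) :
    ∃ A, (haloRule O J).Eligible O J' u v A ∧ X ≤ A.co := by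
  have hsep := halo_separating hF hP hO hX hXJ hK hKX hu hv
  rcases hq : O true (J' ∪ (haloRule O J).blockers u v) u v with _ | A
  · rw [(hO _ u v).2.2.2 hq] at hsep
    exact hsep.elim
  · have hcard := Finset.card_le_univ A.inner
    rw [Fintype.card_fin] at hcard
    refine ⟨A, ⟨hK.inAtom hF hO hu fun h' => hv ((Biset.le_def.1 hKX).2 h'), ?_, hq⟩,
      (core_coFamily_separating (hF.residual _) ((hO _ u v).2.2.1 A hq)).2 X hsep⟩
    simp only [haloRule]
    omega

/-- An atom below the union has a node in `X` or in `Y`, crosses that member and therefore lies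
below it; so it is the common atom. -/
theorem halo_union (hP : ∀ S ∈ F, S.Proper) {G : Set (Biset (Fin n))}
    (hG : IsCrossing G) (hGF : G ⊆ F) {X Y K : Biset (Fin n)} (hX : X ∈ halo G) (hY : Y ∈ halo G)
    (hK : Atom G K) (hKX : K ≤ X) (hKY : K ≤ Y) (hout : X.outer ∪ Y.outer ≠ Finset.univ) :
    Cross X Y ∧ X.union Y ∈ halo G ∧ X.inter Y ∈ halo G := by
  obtain ⟨u, hu⟩ := (hP K (hGF hK.1)).1
  have hcr : Cross X Y := ⟨⟨u, Finset.mem_inter.2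
    ⟨(Biset.le_def.1 hKX).1 hu, (Biset.le_def.1 hKY).1 hu⟩⟩, hout⟩
  obtain ⟨h1, h2⟩ := hG X hX.1 Y hY.1 hcr
  have key : ∀ C, Atom G C → C ≤ X.union Y → C = K := fun C hC hle => by
    have hle' := Biset.le_def.1 hle
    obtain ⟨x, hx⟩ := (hP C (hGF hC.1)).1
    have hne : ∀ Z : Biset (Fin n), Z ≤ X.union Y → C.outer ∪ Z.outer ≠ Finset.univ :=
      fun Z hZ h' => hout (Finset.univ_subset_iff.1
        (h' ▸ Finset.union_subset hle'.2 (Biset.le_def.1 hZ).2))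
    rcases Finset.mem_union.1 (hle'.1 hx) with hxX | hxY
    · exact hX.2 C K hC hK (hC.le_of_cross hG hX.1
        ⟨⟨x, Finset.mem_inter.2 ⟨hx, hxX⟩⟩, hne X (Biset.le_union_left _ _)⟩) hKX
    · exact hY.2 C K hC hK (hC.le_of_cross hG hY.1
        ⟨⟨x, Finset.mem_inter.2 ⟨hx, hxY⟩⟩, hne Y (Biset.le_union_right _ _)⟩) hKY
  exact ⟨hcr, ⟨h2, fun C D hC hD hCX hDX => (key C hC hCX).trans (key D hD hDX).symm⟩,
    ⟨h1, fun C D hC hD hCX hDX => hX.2 C D hC hD (hCX.trans (Biset.inter_le_left _ _))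
      (hDX.trans (Biset.inter_le_left _ _))⟩⟩

/-- A second atom below the answer would be disjoint from the first, so a blocker would start at
each of its nodes and cover the answer. -/
theorem PhaseRun.halo_mem (hF : IsCrossing F) (hP : ∀ S ∈ F, S.Proper) (hO : O.IsCoreOracle F)
    (h : PhaseRun O (haloRule O J) E c J N S e y I) {i : ℕ} (hi : i < N) :
    S i ∈ halo (residual F J) := by
  have hmem := (h.best i hi).mem hF hO
  obtain ⟨u, v, A, hA, hSA, -⟩ := h.best i hi
  have hsep := hA.view_mem hF hO
  rw [← hSA] at hsep
  have hSJ := (mem_residual_image.1 hmem).1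
  refine ⟨hSJ, ?_⟩
  obtain ⟨K, hKq, hu, hK, hKle⟩ := InAtom.exists_atom hF hP hO hA.1
  have hKS := hKle _ ⟨hSJ, hsep.2⟩
  have key : ∀ C, Atom (residual F J) C → C ≤ S i → C = K := fun C hC hCS => by
    by_contra hne
    obtain ⟨w, hw⟩ := (hP C hC.1.1).1
    have hwK := Finset.disjoint_left.1 (hC.disjoint (hF.residual J) hK hne hCS hKS
      (hP _ hSJ.1).outer_ne_univ) hw
    have hCS' := Biset.le_def.1 hCS
    refine hsep.1.2 (w, v) (Finset.mem_union_right _ ?_) ⟨hCS'.1 hw, hsep.2.2⟩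
    refine Rule.mem_blockers.2 ⟨rfl,
      hC.inAtom hF hO hw fun h' => hsep.2.2 (hCS'.2 h'), ?_⟩
    rintro ⟨K', hK', hw'⟩
    rw [hKq] at hK'
    obtain rfl := Option.some.inj hK'
    exact hwK hw'
  exact fun C D hC hD hCX hDX => (key C hC hCX).trans (key D hD hDX).symm

/-- The union of `X` and `S i` is an uncovered member of the halo, so some query returns a member
above it. A smallest co-answer means a largest outer part; hence the union has the same outer part
as `S i`. It therefore avoids the same `v`, competes in the query that produced `S i`, and lies
below its greatest answer. -/
theorem PhaseRun.halo_le (hF : IsCrossing F) (hP : ∀ S ∈ F, S.Proper) (hO : O.IsCoreOracle F)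
    (h : PhaseRun O (haloRule O J) E c J N S e y I) {i : ℕ} (hi : i < N) {X K : Biset (Fin n)}
    (hX : X ∈ halo (residual F J)) (hun : ∀ j < i, ¬ Covers (e j) X)
    (hK : Atom (residual F J) K) (hKX : K ≤ X) (hKS : K ≤ S i)
    (hout : X.outer ∪ (S i).outer ≠ Finset.univ) : X ≤ S i := by
  have hSh := h.halo_mem hF hP hO hi
  have hmem := (h.best i hi).mem hF hO
  obtain ⟨u, v, A, hA, hSA, hmin⟩ := h.best i hi
  have hSA' : S i = A.co := hSA
  have hsep := hA.view_mem hF hO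
  rw [← hSA] at hsep
  obtain ⟨-, hYh, -⟩ := halo_union hP (hF.residual J) (fun _ h => h.1) hX hSh hK hKX hKS hout
  have hYJ : X.union (S i) ∈ residual F (J ∪ (Finset.range i).image e) := by
    rw [mem_residual_image]
    refine ⟨hYh.1, fun j hj hc => hc.of_union.elim (hun j (Finset.mem_range.1 hj)) ?_⟩
    exact (mem_residual_image.1 hmem).2 j hj
  obtain ⟨u', hu'⟩ := (hP K hK.1.1).1
  obtain ⟨v', hv'⟩ := (hP _ hYh.1.1).2
  rw [Finset.mem_compl] at hv'
  obtain ⟨A', hA', hYA⟩ := halo_query hF hP hO hYh hYJ hK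
    (hKX.trans (Biset.le_union_left _ _)) hu' hv'
  have hcard := hmin u' v' A' hA'
  have h1 : A'.inner ⊆ (X.union (S i)).outerᶜ := by
    have := (Biset.le_def.1 hYA).2
    rw [Biset.co_outer] at this
    exact Finset.subset_compl_comm.1 this
  have h2 : (X.union (S i)).outerᶜ ⊆ A.inner := by
    have : (S i).outer ⊆ (X.union (S i)).outer := Finset.subset_union_right
    rw [hSA', Biset.co_outer] at this
    rw [hSA']
    intro x hx
    by_contra hxA
    exact Finset.mem_compl.1 hx (this (Finset.mem_compl.2 hxA))
  have h3 : (X.union (S i)).outerᶜ = A.inner :=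
    Finset.eq_of_subset_of_card_le h2 (hcard.trans (Finset.card_le_card h1))
  have hv : v ∉ (X.union (S i)).outer := by
    rw [← Finset.mem_compl, h3]
    have := hsep.2.2
    rw [hSA', Biset.co_outer, Finset.mem_compl, not_not] at this
    exact this
  obtain ⟨K', -, hu, hK', hKle⟩ := InAtom.exists_atom hF hP hO hA.1
  have hKK : K' = K := hSh.2 K' K hK' hK (hKle _ ⟨hSh.1, hsep.2⟩) hKS
  rw [hKK] at hu
  have hYsep := halo_separating hF hP hO hYh hYJ hK
    (hKX.trans (Biset.le_union_left _ _)) hu hv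
  have := (core_coFamily_separating (hF.residual _) ((hO _ u v).2.2.1 A hA.2.2)).2 _ hYsep
  rw [← hSA'] at this
  exact (Biset.le_union_left _ _).trans this

theorem PhaseRun.halo_covered_all (hF : IsCrossing F) (hP : ∀ S ∈ F, S.Proper)
    (hO : O.IsCoreOracle F)
    (h : PhaseRun O (haloRule O J) E c J N S e y I) {X : Biset (Fin n)}
    (hX : X ∈ halo (residual F J)) : ∃ i < N, Covers (e i) X := by
  by_contra! hno
  obtain ⟨K, hKX, hK⟩ := exists_atom_le hX.1
  obtain ⟨u, hu⟩ := (hP K hK.1.1).1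
  obtain ⟨v, hv⟩ := (hP X hX.1.1).2
  have hXr : X ∈ residual F (J ∪ (Finset.range N).image e) := by
    rw [mem_residual_image]
    exact ⟨hX.1, fun j hj => hno j (Finset.mem_range.1 hj)⟩
  obtain ⟨A, hA, -⟩ := halo_query hF hP hO hX hXr hK hKX hu (Finset.mem_compl.1 hv)
  exact h.not_eligible u v A hA

theorem co_inter_nonempty {X Y : Biset (Fin n)} :
    (X.co.inner ∩ Y.co.inner).Nonempty ↔ X.outer ∪ Y.outer ≠ Finset.univ := by
  rw [Biset.co_inner, Biset.co_inner, ← Finset.compl_union, Finset.nonempty_iff_ne_empty, ne_eq,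
    ne_eq, Finset.compl_eq_empty_iff]

/-- The covering lemma is applied to co-bisets, where the chosen maximal members form increasing
sequences and unions are intersections of the original members. -/
theorem PhaseRun.halo_covered (hF : IsCrossing F) (hP : ∀ S ∈ F, S.Proper)
    (hO : O.IsCoreOracle F)
    (h : PhaseRun O (haloRule O J) E c J N S e y I) {X : Biset (Fin n)}
    (hX : X ∈ halo (residual F J)) : ∃ i ∈ I, Covers (e i) X := by
  have hatoms : ∀ X Y : Biset (Fin n), X ∈ residual F J →
      {C | Atom (residual F J) C ∧ C ≤ X} = {C | Atom (residual F J) C ∧ C ≤ Y} →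
      ∃ K, Atom (residual F J) K ∧ K ≤ X ∧ K ≤ Y := fun X Y hX hXY => by
    obtain ⟨K, hKX, hK⟩ := exists_atom_le hX
    have : K ∈ {C | Atom (residual F J) C ∧ C ≤ Y} := hXY ▸ ⟨hK, hKX⟩
    exact ⟨K, hK, hKX, this.2⟩
  have hcov := h.two.co.cover_subfamily (G := coFamily (halo (residual F J)))
    -- Halo members of different atoms need not uncross within the halo, so they are classed by
    -- their atom. Two members covered by the same edge cross, and an atom below their intersection
    -- shows that their classes agree.
    (cl := fun X => {C | Atom (residual F J) C ∧ C ≤ X.co})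
    (fun i hi => ⟨_, h.halo_mem hF hP hO hi, rfl⟩)
    (by
      rintro i hi _ ⟨X, hX, rfl⟩ hun hcl hm
      simp only [Biset.co_co] at hcl
      obtain ⟨K, hK, h1, h2⟩ := hatoms _ _ hX.1 hcl
      exact Biset.co_le_co.2 (h.halo_le hF hP hO hi hX
        (fun j hj hc => hun j hj (covers_co_iff.2 hc)) hK h1 h2 (co_inter_nonempty.1 hm)))
    (by
      rintro i hi _ ⟨X, hX, rfl⟩ _ ⟨Y, hY, rfl⟩ hcX hcY
      rw [covers_co_iff] at hcX hcY
      obtain ⟨K, hKle, hK⟩ := exists_atom_le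
        ((hF.residual J) X hX.1 Y hY.1 (hcX.cross hcY)).1
      have hKX := hKle.trans (Biset.inter_le_left _ _)
      have hKY := hKle.trans (Biset.inter_le_right _ _)
      simp only [Biset.co_co]
      ext C
      constructor
      · rintro ⟨hC, hCX⟩
        exact ⟨hC, hX.2 K C hK hC hKX hCX ▸ hKY⟩
      · rintro ⟨hC, hCY⟩
        exact ⟨hC, hY.2 K C hK hC hKY hCY ▸ hKX⟩)
    (T := coFamily (halo (residual F J))) subset_rfl
    (by
      rintro _ ⟨X, hX, rfl⟩
      obtain ⟨i, hi, hc⟩ := h.halo_covered_all hF hP hO hX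
      exact ⟨i, hi, covers_co_iff.2 hc⟩)
    (by
      rintro _ ⟨X, hX, rfl⟩ l hl hcl hm
      simp only [Biset.co_co] at hcl
      obtain ⟨K, hK, h1, h2⟩ := hatoms _ _ hX.1 hcl
      rw [← Biset.co_inter]
      exact ⟨_, (halo_union hP (hF.residual J) (fun _ h => h.1) hX (h.halo_mem hF hP hO hl)
        hK h1 h2 (co_inter_nonempty.1 hm)).2.2, rfl⟩)
  obtain ⟨i, hi, hc⟩ := hcov _ ⟨X, hX, rfl⟩
  exact ⟨i, hi, covers_co_iff.1 hc⟩

/-- After the phase every uncovered member contains two atoms of the previous family. -/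
theorem PhaseRun.two_atoms (hF : IsCrossing F) (hP : ∀ S ∈ F, S.Proper)
    (hO : O.IsCoreOracle F)
    (h : PhaseRun O (haloRule O J) E c J N S e y I) {X : Biset (Fin n)}
    (hX : X ∈ residual F (J ∪ I.image e)) :
    ∃ C D, Atom (residual F J) C ∧ Atom (residual F J) D ∧ C ≤ X ∧ D ≤ X ∧
      Disjoint C.inner D.inner := by
  rw [mem_residual_image] at hX
  by_contra! hno
  have hXh : X ∈ halo (residual F J) := by
    refine ⟨hX.1, fun C D hC hD hCX hDX => ?_⟩
    by_contra hne
    exact hno C D hC hD hCX hDX (hC.disjoint (hF.residual J) hD hne hCX hDX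
      (hP X hX.1.1).outer_ne_univ)
  obtain ⟨i, hi, hc⟩ := h.halo_covered hF hP hO hXh
  exact hX.2 i hi hc

end Halo

/-! ### The number of effective phases and the approximation ratios. -/

section Algorithm

variable {n : ℕ}

/-- A run of the algorithm: a phase for the small members, and then `n` phases for the members that
contain a single atom; `Js r` is the set of edges before the `r`-th of the latter phases. -/
structure AlgRun (O : Oracle n) (k : ℕ) (E : Finset (Fin n × Fin n)) (c : Fin n × Fin n → ℝ)
    (Js : ℕ → Finset (Fin n × Fin n)) : Prop where
  start : ∃ N S e y I, PhaseRun O (smallRule n k) E c ∅ N S e y I ∧ Js 0 = I.image e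
  step : ∀ r < n, ∃ N S e y I, PhaseRun O (haloRule O (Js r)) E c (Js r) N S e y I ∧
    Js (r + 1) = Js r ∪ I.image e

variable {O : Oracle n} {F : Set (Biset (Fin n))} {E : Finset (Fin n × Fin n)} {k : ℕ}
  {c : Fin n × Fin n → ℝ} {Js : ℕ → Finset (Fin n × Fin n)}

theorem PhaseRun.image_subset {J : Finset (Fin n × Fin n)} {R : Rule n} {N : ℕ}
    {S : ℕ → Biset (Fin n)} {e : ℕ → Fin n × Fin n} {y : ℕ → ℝ} {I : Finset ℕ}
    (h : PhaseRun O R E c J N S e y I) : I.image e ⊆ E := by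
  intro f hf
  obtain ⟨i, hi, rfl⟩ := Finset.mem_image.1 hf
  exact h.edge_mem i (h.two.lt hi)

theorem AlgRun.subset (h : AlgRun O k E c Js) {r : ℕ} (hr : r ≤ n) : Js r ⊆ E := by
  induction r with
  | zero =>
    obtain ⟨N, S, e, y, I, hI, h0⟩ := h.start
    exact h0 ▸ hI.image_subset
  | succ r ih =>
    obtain ⟨N, S, e, y, I, hI, h0⟩ := h.step r hr
    exact h0 ▸ Finset.union_subset (ih (by omega)) hI.image_subset

/-- A member that is uncovered after `r` phases contains many disjoint atoms. -/
theorem AlgRun.packing (hF : IsCrossing F) (hP : ∀ S ∈ F, S.Proper) (hO : O.IsCoreOracle F)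
    (h : AlgRun O k E c Js) {r : ℕ} (hr : r ≤ n) {X : Biset (Fin n)}
    (hX : X ∈ residual F (Js r)) :
    ∃ 𝒟 : Finset (Biset (Fin n)), (∀ D ∈ 𝒟, Atom (residual F (Js 0)) D ∧ D ≤ X) ∧
      (𝒟 : Set (Biset (Fin n))).PairwiseDisjoint Biset.inner ∧ 2 ^ r ≤ 𝒟.card := by
  classical
  induction r generalizing X with
  | zero =>
    obtain ⟨C, hCX, hC⟩ := exists_atom_le hX
    exact ⟨{C}, by simpa using ⟨hC, hCX⟩, by simp, by simp⟩
  | succ r ih =>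
    obtain ⟨N, S, e, y, I, hI, h0⟩ := h.step r hr
    rw [h0] at hX
    obtain ⟨C, D, hC, hD, hCX, hDX, hdis⟩ := hI.two_atoms hF hP hO hX
    -- Both atoms were themselves uncovered after `r` phases, so each contains `2 ^ r` disjoint
    -- atoms; disjointness of `C` and `D` keeps the two collections apart.
    obtain ⟨𝒞, h1, h2, h3⟩ := ih (by omega) hC.1
    obtain ⟨𝒟, h1', h2', h3'⟩ := ih (by omega) hD.1
    have hd : ∀ A ∈ 𝒞, ∀ B ∈ 𝒟, Disjoint A.inner B.inner := fun A hA B hB =>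
      Finset.disjoint_of_subset_left (Biset.le_def.1 (h1 A hA).2).1
        (Finset.disjoint_of_subset_right (Biset.le_def.1 (h1' B hB).2).1 hdis)
    have hdd : Disjoint 𝒞 𝒟 := Finset.disjoint_left.2 fun A hA hA' => by
      have := hd A hA A hA'
      rw [Finset.disjoint_self_iff_empty] at this
      exact (hP A (h1 A hA).1.1.1).1.ne_empty this
    refine ⟨𝒞 ∪ 𝒟, fun A hA => ?_, ?_, ?_⟩
    · rcases Finset.mem_union.1 hA with hA | hA
      · exact ⟨(h1 A hA).1, (h1 A hA).2.trans hCX⟩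
      · exact ⟨(h1' A hA).1, (h1' A hA).2.trans hDX⟩
    · rw [Finset.coe_union, Set.pairwiseDisjoint_union]
      exact ⟨h2, h2', fun A hA B hB _ => hd A hA B hB⟩
    · rw [Finset.card_union_of_disjoint hdd, pow_succ]
      omega

theorem sum_card_le {𝒟 : Finset (Biset (Fin n))} {A : Finset (Fin n)}
    (hd : (𝒟 : Set (Biset (Fin n))).PairwiseDisjoint Biset.inner)
    (hA : ∀ D ∈ 𝒟, D.inner ⊆ A) : ∑ D ∈ 𝒟, D.inner.card ≤ A.card := by
  rw [← Finset.card_biUnion hd]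
  exact Finset.card_le_card (Finset.biUnion_subset.2 hA)

theorem card_le_of_disjoint {𝒟 : Finset (Biset (Fin n))} {A : Finset (Fin n)}
    (hd : (𝒟 : Set (Biset (Fin n))).PairwiseDisjoint Biset.inner)
    (hA : ∀ D ∈ 𝒟, D.inner ⊆ A) (hne : ∀ D ∈ 𝒟, D.inner.Nonempty) : 𝒟.card ≤ A.card := by
  refine le_trans ?_ (sum_card_le hd hA)
  have := Finset.card_nsmul_le_sum 𝒟 (fun D => D.inner.card) 1 fun D hD => (hne D hD).card_pos
  simpa using this

theorem AlgRun.two_pow_le (hF : IsCrossing F) (hP : ∀ S ∈ F, S.Proper) (hO : O.IsCoreOracle F)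
    (h : AlgRun O k E c Js) {r : ℕ} (hr : r ≤ n) {X : Biset (Fin n)}
    (hX : X ∈ residual F (Js r)) : 2 ^ r ≤ X.inner.card := by
  obtain ⟨𝒟, h1, h2, h3⟩ := h.packing hF hP hO hr hX
  exact h3.trans (card_le_of_disjoint h2 (fun D hD => (Biset.le_def.1 (h1 D hD).2).1)
    fun D hD => (hP D (h1 D hD).1.1.1).1)

/-- As `2 ^ n > n`, running exactly `n` main phases always suffices, without any test for
termination. -/
theorem AlgRun.residual_eq_empty (hF : IsCrossing F) (hP : ∀ S ∈ F, S.Proper)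
    (hO : O.IsCoreOracle F) (h : AlgRun O k E c Js) :
    residual F (Js n) = ∅ := by
  rw [Set.eq_empty_iff_forall_notMem]
  intro X hX
  have h1 := h.two_pow_le hF hP hO le_rfl hX
  have h2 := Finset.card_le_univ X.inner
  rw [Fintype.card_fin] at h2
  have := Nat.lt_two_pow_self (n := n)
  omega

theorem AlgRun.isEdgeCover (hF : IsCrossing F) (hP : ∀ S ∈ F, S.Proper)
    (hO : O.IsCoreOracle F) (h : AlgRun O k E c Js) :
    IsEdgeCover (Js n) F := by
  intro S hS
  by_contra! hno
  have : S ∈ residual F (Js n) := ⟨hS, hno⟩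
  rw [h.residual_eq_empty hF hP hO] at this
  exact this

/-- Atoms of a residual family need not be cores of `F`, but each inner part contains that of a
core, and disjointness makes the chosen cores distinct. -/
theorem AlgRun.two_pow_le_numCores (hF : IsCrossing F) (hP : ∀ S ∈ F, S.Proper)
    (hO : O.IsCoreOracle F) (h : AlgRun O k E c Js) {r : ℕ} (hr : r ≤ n)
    {X : Biset (Fin n)} (hX : X ∈ residual F (Js r)) : 2 ^ r ≤ numCores F := by
  obtain ⟨𝒟, h1, h2, h3⟩ := h.packing hF hP hO hr hX
  have hex : ∀ D : Biset (Fin n), ∃ C, D ∈ 𝒟 → IsCore F C ∧ C.inner ⊆ D.inner := fun D => by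
    by_cases hD : D ∈ 𝒟
    · obtain ⟨C, hC⟩ := exists_core_inner_subset (h1 D hD).1.1.1
      exact ⟨C, fun _ => hC⟩
    · exact ⟨D, fun h => absurd h hD⟩
  choose f hf using hex
  refine h3.trans ?_
  rw [← Set.ncard_coe_finset]
  refine Set.ncard_le_ncard_of_injOn f (fun D hD => (hf D hD).1) ?_ (Set.toFinite _)
  intro A hA B hB hAB
  by_contra hne
  obtain ⟨x, hx⟩ := (hP _ (hf A hA).1.1).1
  exact Finset.disjoint_left.1 (h2 hA hB hne) ((hf A hA).2 hx) ((hf B hB).2 (hAB ▸ hx))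

/-- Each core is the oracle's answer, with no edges given, for any pair that it separates. -/
theorem numCores_le (hF : IsCrossing F) (hP : ∀ S ∈ F, S.Proper) (hO : O.IsCoreOracle F) :
    numCores F ≤ n * n := by
  have hsub : some '' {C | IsCore F C} ⊆
      Set.range fun p : Fin n × Fin n => O false ∅ p.1 p.2 := by
    rintro _ ⟨C, hC, rfl⟩
    obtain ⟨⟨u, hu⟩, ⟨v, hv⟩⟩ := hP C hC.1
    obtain ⟨K, hK, hmem, hle⟩ := exists_answer hF hO (J := ∅) (u := u) (v := v) (X := C)
      ⟨⟨hC.1, by simp⟩, hu, Finset.mem_compl.1 hv⟩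
    exact ⟨(u, v), eq_of_le_core hC hmem.1.1 hle ▸ hK⟩
  have h1 := Set.ncard_le_ncard hsub (Set.finite_range _)
  rw [Set.ncard_image_of_injective _ (Option.some_injective _)] at h1
  refine h1.trans ?_
  rw [← Set.image_univ]
  refine (Set.ncard_image_le (Set.toFinite _)).trans ?_
  simp [Set.ncard_univ]

/-- The disjoint atoms are split by size. The preliminary phase bounds the number of small ones,
counting nodes bounds the number of large ones, and each part contributes `2 * n`. -/
theorem AlgRun.two_pow_mul_le (hF : IsCrossing F) (hP : ∀ S ∈ F, S.Proper)
    (hO : O.IsCoreOracle F) (hk : IsRegular k F) (hkn : k < n)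
    (h : AlgRun O k E c Js) {r : ℕ} (hr : r ≤ n) {X : Biset (Fin n)}
    (hX : X ∈ residual F (Js r)) : 2 ^ r * (n - k + 1) ≤ 4 * n := by
  classical
  obtain ⟨𝒟, h1, h2, h3⟩ := h.packing hF hP hO hr hX
  obtain ⟨N, S, e, y, I, hI, h0⟩ := h.start
  set p : Biset (Fin n) → Prop := fun D => D.inner.card + D.inner.card ≤ n - k
  have hsplit := Finset.card_filter_add_card_filter_not (s := 𝒟) p
  have hs := hI.small_packing hF hP hO hk hkn (𝒟.filter p : Finset (Biset (Fin n)))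
    (fun D hD => by
      rw [Finset.mem_coe, Finset.mem_filter] at hD
      have hm := (h1 D hD.1).1.1
      refine ⟨⟨hm.1, hD.2⟩, fun i hi => hm.2 _ ?_⟩
      rw [h0]
      exact Finset.mem_image_of_mem e hi)
    (h2.subset (Finset.coe_subset.2 (Finset.filter_subset _ _)))
  rw [Set.ncard_coe_finset] at hs
  have hb : (𝒟.filter fun D => ¬ p D).card * (n - k + 1) ≤
      ∑ D ∈ 𝒟.filter fun D => ¬ p D, 2 * D.inner.card := by
    rw [← smul_eq_mul]
    refine Finset.card_nsmul_le_sum _ _ _ fun D hD => ?_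
    have := (Finset.mem_filter.1 hD).2
    simp only [p] at this
    omega
  rw [← Finset.mul_sum] at hb
  have hu := sum_card_le (A := Finset.univ) (𝒟 := 𝒟.filter fun D => ¬ p D)
    (h2.subset (Finset.coe_subset.2 (Finset.filter_subset _ _))) (fun D _ => Finset.subset_univ _)
  rw [Finset.card_univ, Fintype.card_fin] at hu
  calc 2 ^ r * (n - k + 1) ≤ 𝒟.card * (n - k + 1) := Nat.mul_le_mul_right _ h3
    _ ≤ 4 * n := by rw [← hsplit, add_mul]; omega

theorem lpValue_nonneg (hE : IsEdgeCover E F) (hc : ∀ e ∈ E, 0 ≤ c e) : 0 ≤ lpValue E c F := by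
  have := dual_le_lpValue (c := c) (N := 0) (S := fun _ => ⟨∅, ∅, subset_rfl⟩) (y := fun _ => 0) hE
    (by simp) (by simp) (by simpa using hc)
  simpa using this

theorem sum_union_le {J J' : Finset (Fin n × Fin n)} (h : ∀ f ∈ J ∪ J', 0 ≤ c f) :
    ∑ f ∈ J ∪ J', c f ≤ ∑ f ∈ J, c f + ∑ f ∈ J', c f := by
  rw [← Finset.sum_union_inter]
  have : 0 ≤ ∑ f ∈ J ∩ J', c f := Finset.sum_nonneg fun f hf =>
    h f (Finset.mem_union_left _ (Finset.mem_inter.1 hf).1)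
  linarith

/-- Every phase costs at most `τ`, and nothing once the family is covered. -/
theorem AlgRun.cost_le (hF : IsCrossing F) (hO : O.IsCoreOracle F) (hE : IsEdgeCover E F)
    (hc : ∀ e ∈ E, 0 ≤ c e) (h : AlgRun O k E c Js) {R : ℕ} (hR : residual F (Js R) = ∅)
    (hRn : R ≤ n) : ∑ f ∈ Js n, c f ≤ (1 + R) * lpValue E c F := by
  have hτ := lpValue_nonneg hE hc
  have h1 : ∀ r ≤ n, ∑ f ∈ Js r, c f ≤ (1 + r) * lpValue E c F := by
    intro r
    induction r with
    | zero =>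
      intro _
      obtain ⟨N, S, e, y, I, hI, h0⟩ := h.start
      simpa [h0] using hI.cost_le hF hO hE hc
    | succ r ih =>
      intro hr
      obtain ⟨N, S, e, y, I, hI, h0⟩ := h.step r hr
      have h2 := sum_union_le (c := c) (J := Js r) (J' := I.image e) fun f hf =>
        hc f (h.subset hr (h0 ▸ hf))
      have h3 := hI.cost_le hF hO hE hc
      have h4 := ih (by omega)
      rw [h0]
      push_cast
      linarith
  have h2 : ∀ d, R + d ≤ n → Js (R + d) = Js R := by
    intro d
    induction d with
    | zero => simp
    | succ d ih =>
      intro hd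
      obtain ⟨N, S, e, y, I, hI, h0⟩ := h.step (R + d) (by omega)
      rw [← add_assoc, h0, hI.selected_eq_empty hF hO (by rw [ih (by omega), hR]),
        ih (by omega)]
      simp
  have h3 := h2 (n - R) (by omega)
  rw [Nat.add_sub_cancel' hRn] at h3
  rw [h3]
  exact h1 R hRn

theorem AlgRun.cost_le_log (hF : IsCrossing F) (hP : ∀ S ∈ F, S.Proper) (hO : O.IsCoreOracle F)
    (hE : IsEdgeCover E F) (hc : ∀ e ∈ E, 0 ≤ c e) (h : AlgRun O k E c Js) {B : ℝ} (hB : 1 ≤ B)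
    (hr : ∀ r ≤ n, ∀ X ∈ residual F (Js r), (2 : ℝ) ^ r ≤ B) :
    ∑ f ∈ Js n, c f ≤ 2 * (1 + Real.log B) * lpValue E c F := by
  classical
  have hex : ∃ R, R ≤ n ∧ residual F (Js R) = ∅ :=
    ⟨n, le_rfl, h.residual_eq_empty hF hP hO⟩
  obtain ⟨hRn, hR⟩ := Nat.find_spec hex
  have hmin := fun m => Nat.find_min hex (m := m)
  set R := Nat.find hex
  refine (h.cost_le hF hO hE hc hR hRn).trans ?_
  refine mul_le_mul_of_nonneg_right ?_ (lpValue_nonneg hE hc)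
  have hlog := Real.log_nonneg hB
  rcases Nat.eq_zero_or_pos R with h0 | h0
  · rw [h0]
    push_cast
    linarith
  -- Phase `R - 1` still left a member, so `2 ^ (R - 1) ≤ B`; as `log 2 > 1/2`, this gives `R - 1 ≤
  -- 2 log B`.
  · have h1 := hmin (R - 1) (by omega)
    simp only [not_and] at h1
    obtain ⟨X, hX⟩ := Set.nonempty_iff_ne_empty.2 (h1 (by omega))
    have h2 := Real.log_le_log (by positivity) (hr (R - 1) (by omega) X hX)
    rw [Real.log_pow, Nat.cast_sub h0] at h2
    push_cast at h2
    have h3 : (1 : ℝ) ≤ R := by exact_mod_cast h0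
    have := Real.log_two_gt_d9
    nlinarith

theorem AlgRun.cost_le_numCores (hF : IsCrossing F) (hP : ∀ S ∈ F, S.Proper)
    (hO : O.IsCoreOracle F) (hE : IsEdgeCover E F) (hc : ∀ e ∈ E, 0 ≤ c e)
    (h : AlgRun O k E c Js) :
    ∑ f ∈ Js n, c f ≤ 6 * (1 + Real.log (numCores F)) * lpValue E c F := by
  have hτ := lpValue_nonneg hE hc
  have hlog : 0 ≤ Real.log (numCores F) := Real.log_natCast_nonneg _
  rcases Nat.eq_zero_or_pos (numCores F) with h0 | h0
  · have := h.cost_le_log hF hP hO hE hc le_rfl fun r hr X hX => by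
      have := h.two_pow_le_numCores hF hP hO hr hX
      have := Nat.one_le_two_pow (n := r)
      omega
    rw [Real.log_one] at this
    refine this.trans (mul_le_mul_of_nonneg_right ?_ hτ)
    linarith
  · refine (h.cost_le_log hF hP hO hE hc (B := numCores F) (by exact_mod_cast h0)
      fun r hr X hX => ?_).trans (mul_le_mul_of_nonneg_right ?_ hτ)
    · exact_mod_cast h.two_pow_le_numCores hF hP hO hr hX
    · linarith

theorem one_add_log_numCores_le (hF : IsCrossing F) (hP : ∀ S ∈ F, S.Proper)
    (hO : O.IsCoreOracle F) (hn : 2 ≤ n) :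
    1 + Real.log (numCores F) ≤ 6 * Real.log n := by
  have h2 : Real.log 2 ≤ Real.log n := Real.log_le_log (by norm_num) (by exact_mod_cast hn)
  have h3 := Real.log_two_gt_d9
  rcases Nat.eq_zero_or_pos (numCores F) with h0 | h0
  · rw [h0, Nat.cast_zero, Real.log_zero]
    linarith
  · have h4 : Real.log (numCores F) ≤ Real.log ((n : ℝ) * n) :=
      Real.log_le_log (by exact_mod_cast h0) (by exact_mod_cast numCores_le hF hP hO)
    have hn0 : (n : ℝ) ≠ 0 := by positivity
    rw [Real.log_mul hn0 hn0] at h4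
    linarith

theorem one_le_div_sub (hkn : k < n) : 1 ≤ (n : ℝ) / ((n : ℝ) - k) := by
  have h1 : (k : ℝ) < n := by exact_mod_cast hkn
  rw [one_le_div (by linarith)]
  have : (0 : ℝ) ≤ k := Nat.cast_nonneg k
  linarith

theorem AlgRun.cost_le_div (hF : IsCrossing F) (hP : ∀ S ∈ F, S.Proper)
    (hO : O.IsCoreOracle F) (hE : IsEdgeCover E F) (hc : ∀ e ∈ E, 0 ≤ c e)
    (hk : IsRegular k F) (hkn : k < n) (h : AlgRun O k E c Js) :
    ∑ f ∈ Js n, c f ≤ 6 * (1 + Real.log ((n : ℝ) / ((n : ℝ) - k))) * lpValue E c F := by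
  have h1 : (k : ℝ) < n := by exact_mod_cast hkn
  have hd := one_le_div_sub hkn
  have hlog := Real.log_nonneg hd
  refine (h.cost_le_log hF hP hO hE hc (B := 4 * ((n : ℝ) / ((n : ℝ) - k))) (by linarith)
    fun r hr X hX => ?_).trans (mul_le_mul_of_nonneg_right ?_ (lpValue_nonneg hE hc))
  · have h2 := h.two_pow_mul_le hF hP hO hk hkn hr hX
    have h3 : (2 : ℝ) ^ r * ((n : ℝ) - k + 1) ≤ 4 * n := by
      rw [← Nat.cast_sub hkn.le]
      exact_mod_cast h2
    rw [← mul_div_assoc, le_div_iff₀ (by linarith)]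
    have : (0 : ℝ) < 2 ^ r := by positivity
    nlinarith
  -- The constant `6` comes from here: `2 (1 + log 4) < 6`.
  · rw [Real.log_mul (by norm_num) (by linarith)]
    have h4 : Real.log 4 = 2 * Real.log 2 := by
      rw [show (4 : ℝ) = 2 ^ 2 by norm_num, Real.log_pow]
      norm_num
    have := Real.log_two_lt_d9
    linarith

theorem AlgRun.cost_le_sub (hF : IsCrossing F) (hP : ∀ S ∈ F, S.Proper)
    (hO : O.IsCoreOracle F) (hE : IsEdgeCover E F) (hc : ∀ e ∈ E, 0 ≤ c e)
    (hkn : k < n) (hΓ : ∀ S ∈ F, S.boundary.card = k) (h : AlgRun O k E c Js) :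
    ∑ f ∈ Js n, c f ≤ 6 * (1 + Real.log ((n : ℝ) - k)) * lpValue E c F := by
  have h1 : (1 : ℝ) ≤ (n : ℝ) - k := by
    rw [← Nat.cast_sub hkn.le]
    exact_mod_cast Nat.sub_pos_of_lt hkn
  have hlog := Real.log_nonneg h1
  refine (h.cost_le_log hF hP hO hE hc h1 fun r hr X hX => ?_).trans
    (mul_le_mul_of_nonneg_right (by linarith) (lpValue_nonneg hE hc))
  have h2 := h.two_pow_le hF hP hO hr hX
  have h3 := hΓ X hX.1
  rw [Biset.boundary, Finset.card_sdiff_of_subset X.subset] at h3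
  have h4 := Finset.card_le_univ X.outer
  rw [Fintype.card_fin] at h4
  have h5 := Finset.card_le_card X.subset
  have h6 : 2 ^ r ≤ n - k := by omega
  rw [← Nat.cast_sub hkn.le]
  exact_mod_cast h6

theorem AlgRun.cost_le_min (hF : IsCrossing F) (hP : ∀ S ∈ F, S.Proper)
    (hO : O.IsCoreOracle F) (hE : IsEdgeCover E F) (hc : ∀ e ∈ E, 0 ≤ c e)
    (hk : IsRegular k F) (hkn : k < n) (hΓ : ∀ S ∈ F, S.boundary.card = k)
    (h : AlgRun O k E c Js) :
    ∑ f ∈ Js n, c f ≤ 6 * (1 + Real.log (min ((n : ℝ) / ((n : ℝ) - k)) ((n : ℝ) - k)))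
      * lpValue E c F := by
  rcases min_choice ((n : ℝ) / ((n : ℝ) - k)) ((n : ℝ) - k) with h' | h' <;> rw [h']
  · exact h.cost_le_div hF hP hO hE hc hk hkn
  · exact h.cost_le_sub hF hP hO hE hc hkn hΓ

/-- The extra factor is at least one, so `AlgRun.cost_le_div` is already stronger. -/
theorem AlgRun.cost_le_mul (hF : IsCrossing F) (hP : ∀ S ∈ F, S.Proper)
    (hO : O.IsCoreOracle F) (hE : IsEdgeCover E F) (hc : ∀ e ∈ E, 0 ≤ c e)
    (hk : IsRegular k F) (hkn : k < n) (h : AlgRun O k E c Js) :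
    ∑ f ∈ Js n, c f ≤
      6 * ((n : ℝ) / ((n : ℝ) - k) * (1 + Real.log ((n : ℝ) / ((n : ℝ) - k))))
        * lpValue E c F := by
  have hd := one_le_div_sub hkn
  have hlog := Real.log_nonneg hd
  refine (h.cost_le_div hF hP hO hE hc hk hkn).trans
    (mul_le_mul_of_nonneg_right ?_ (lpValue_nonneg hE hc))
  have := le_mul_of_one_le_left (by linarith : 0 ≤ 1 + Real.log ((n : ℝ) / ((n : ℝ) - k))) hd
  linarith

end Algorithm

/-! ### Reasoning about programs -/

section Runs

/-- The arrays of natural numbers that a program may change. -/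
def Prog.changesNat : Prog → ℕ → Bool
  | .skip, _ => false
  | .setN a _ _ _ _, b => Nat.beq a b
  | .setV _ _ _ _ _, _ => false
  | .seq p q, b => p.changesNat b || q.changesNat b
  | .ite _ p q, b => p.changesNat b || q.changesNat b
  | .while _ p, b => p.changesNat b
  | .query _ _ _ _ d, b => Nat.beq d b

/-- The arrays of cost values that a program may change. -/
def Prog.changesVal : Prog → ℕ → Bool
  | .skip, _ => false
  | .setN _ _ _ _ _, _ => false
  | .setV a _ _ _ _, b => Nat.beq a b
  | .seq p q, b => p.changesVal b || q.changesVal b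
  | .ite _ p q, b => p.changesVal b || q.changesVal b
  | .while _ p, b => p.changesVal b
  | .query _ _ _ _ _, _ => false

/-- The memories `m` and `m'` differ only in arrays that `P` may change. -/
structure Frame (P : Prog) (m m' : Mem) : Prop where
  nat : ∀ b, P.changesNat b = false → m'.nat b = m.nat b
  val : ∀ b, P.changesVal b = false → m'.val b = m.val b

theorem Frame.refl (P : Prog) (m : Mem) : Frame P m m := ⟨fun _ _ => rfl, fun _ _ => rfl⟩

theorem Frame.trans {P : Prog} {m m' m'' : Mem} (h : Frame P m m') (h' : Frame P m' m'') :
    Frame P m m'' :=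
  ⟨fun b hb => (h'.nat b hb).trans (h.nat b hb), fun b hb => (h'.val b hb).trans (h.val b hb)⟩

theorem Frame.mono {P Q : Prog} {m m' : Mem} (h : Frame P m m')
    (h1 : ∀ b, Q.changesNat b = false → P.changesNat b = false)
    (h2 : ∀ b, Q.changesVal b = false → P.changesVal b = false) : Frame Q m m' :=
  ⟨fun b hb => h.nat b (h1 b hb), fun b hb => h.val b (h2 b hb)⟩

variable {n : ℕ} {O : Oracle n}

/-- The change predicates use `Nat.beq`, so that for concrete programs and array names the frame
conditions hold by `rfl`. -/
theorem ne_of_beq {a b : ℕ} (h : Nat.beq a b = false) : b ≠ a := by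
  rintro rfl
  simp at h

theorem Exec.frame {P : Prog} {m m' : Mem} {t : ℕ} (h : Exec O P m t m') : Frame P m m' := by
  induction h with
  | skip m => exact Frame.refl _ _
  | setN m a i j l e =>
    refine ⟨fun b hb => ?_, fun _ _ => rfl⟩
    have := ne_of_beq hb
    funext i' j' l'
    simp [Mem.setN, this]
  | setV m a i j l e =>
    refine ⟨fun _ _ => rfl, fun b hb => ?_⟩
    have := ne_of_beq hb
    funext i' j' l'
    simp [Mem.setV, this]
  | seq _ _ ih ih' =>
    refine (ih.mono ?_ ?_).trans (ih'.mono ?_ ?_) <;> intro b hb <;>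
      simp_all [Prog.changesNat, Prog.changesVal]
  | iteTrue _ _ ih =>
    refine ih.mono ?_ ?_ <;> intro b hb <;> simp_all [Prog.changesNat, Prog.changesVal]
  | iteFalse _ _ ih =>
    refine ih.mono ?_ ?_ <;> intro b hb <;> simp_all [Prog.changesNat, Prog.changesVal]
  | whileTrue _ _ _ ih ih' =>
    exact Frame.trans (Frame.mono ih (fun _ h => h) fun _ h => h) ih'
  | whileFalse _ => exact Frame.refl _ _
  | query m co a u v d hu hv =>
    refine ⟨fun b hb => ?_, fun _ _ => rfl⟩
    have := ne_of_beq hb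
    simp [Mem.putAnswer, this]

/-- Started in `m`, the program `P` halts after at most `T` steps in a memory with the
property `Q`. -/
def Runs (O : Oracle n) (P : Prog) (m : Mem) (T : ℕ) (Q : Mem → Prop) : Prop :=
  ∃ t m', Exec O P m t m' ∧ t ≤ T ∧ Q m'

variable {P P' : Prog} {m : Mem} {T T' : ℕ} {Q Q' : Mem → Prop}

theorem Runs.mono (h : Runs O P m T Q) (hT : T ≤ T')
    (hQ : ∀ m', Frame P m m' → Q m' → Q' m') : Runs O P m T' Q' := by
  obtain ⟨t, m', h1, h2, h3⟩ := h
  exact ⟨t, m', h1, h2.trans hT, hQ m' h1.frame h3⟩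

theorem Runs.skip (h : Q m) (hT : 1 ≤ T) : Runs O .skip m T Q := ⟨1, m, .skip m, hT, h⟩

theorem Runs.setN {a : ℕ} {i j l e : NExp}
    (h : Q (m.setN a (i.eval m) (j.eval m) (l.eval m) (e.eval m))) (hT : 1 ≤ T) :
    Runs O (.setN a i j l e) m T Q := ⟨1, _, .setN m a i j l e, hT, h⟩

theorem Runs.setV {a : ℕ} {i j l : NExp} {e : VExp}
    (h : Q (m.setV a (i.eval m) (j.eval m) (l.eval m) (e.eval m))) (hT : 1 ≤ T) :
    Runs O (.setV a i j l e) m T Q := ⟨1, _, .setV m a i j l e, hT, h⟩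

theorem Runs.query {co : Bool} {a d : ℕ} {u v : NExp} {x y : Fin n} (hx : u.eval m = x)
    (hy : v.eval m = y) (h : Q (m.putAnswer d (O co (m.edgeSet n a) x y))) (hT : 1 ≤ T) :
    Runs O (.query co a u v d) m T Q := by
  have hu : u.eval m < n := hx ▸ x.2
  have hv : v.eval m < n := hy ▸ y.2
  refine ⟨1, _, .query m co a u v d hu hv, hT, ?_⟩
  have h1 : (⟨u.eval m, hu⟩ : Fin n) = x := Fin.ext hx
  have h2 : (⟨v.eval m, hv⟩ : Fin n) = y := Fin.ext hy
  rw [h1, h2]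
  exact h

/-- The second program receives the frame of the first, so specifications need to mention only the
arrays that are computed. -/
theorem Runs.seq (h : Runs O P m T (fun m' => Frame P m m' → Runs O P' m' T' Q)) :
    Runs O (.seq P P') m (T + T') Q := by
  obtain ⟨t, m', h1, h2, h3⟩ := h
  obtain ⟨t', m'', h1', h2', h3'⟩ := h3 h1.frame
  exact ⟨t + t', m'', .seq h1 h1', Nat.add_le_add h2 h2', h3'⟩

theorem Runs.ite {b : BExp} (h : b.holds m → Runs O P m T Q)
    (h' : ¬ b.holds m → Runs O P' m T Q) : Runs O (.ite b P P') m (T + 1) Q := by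
  by_cases hb : b.holds m
  · obtain ⟨t, m', h1, h2, h3⟩ := h hb
    exact ⟨t + 1, m', .iteTrue hb h1, by omega, h3⟩
  · obtain ⟨t, m', h1, h2, h3⟩ := h' hb
    exact ⟨t + 1, m', .iteFalse hb h1, by omega, h3⟩

/-- The expression for the number variable `a`. -/
def sc (a : ℕ) : NExp := .read a (.const 0) (.const 0) (.const 0)

/-- The instruction `a := e` for a number variable `a`. -/
def assign (a : ℕ) (e : NExp) : Prog := .setN a (.const 0) (.const 0) (.const 0) e

/-- `for a = 0, ..., e - 1 do body`. -/
def repeatFor (a : ℕ) (e : NExp) (body : Prog) : Prog :=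
  .seq (assign a (.const 0))
    (.while (.not (.leN e (sc a))) (.seq body (assign a (.add (sc a) (.const 1)))))

/-- The running time of a loop. -/
def loopTime (N T : ℕ) : ℕ := N * (T + 2) + 2

@[simp] theorem sc_eval (a : ℕ) (m : Mem) : (sc a).eval m = m.nat a 0 0 0 := rfl

theorem setN_frame {a i j l r : ℕ} {e : NExp} {body : Prog} :
    Frame (repeatFor a e body) m (m.setN a i j l r) := by
  refine ⟨fun b hb => ?_, fun _ _ => rfl⟩
  have hb' : Nat.beq a b = false := by
    simp only [repeatFor, assign, Prog.changesNat, Bool.or_eq_false_iff] at hb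
    exact hb.1
  have := ne_of_beq hb'
  funext i' j' l'
  simp [Mem.setN, this]

theorem frame_body {a : ℕ} {e : NExp} {body : Prog} {m m' : Mem} (h : Frame body m m') :
    Frame (repeatFor a e body) m m' := by
  refine h.mono ?_ ?_ <;> intro b hb <;>
    simp_all [repeatFor, assign, Prog.changesNat, Prog.changesVal]

/-- The bound `B` is separate from the number `N` of iterations because loops over the list of
chosen bisets have a data-dependent length; only `N ≤ n * n` is known there. By `hinv` the invariant
may not depend on the loop counter. -/
theorem Runs.forLoop {a : ℕ} {e : NExp} {body : Prog} {m₀ : Mem} {N B : ℕ}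
    (Inv : ℕ → Mem → Prop) (ha : body.changesNat a = false)
    (he : ∀ m, Frame (repeatFor a e body) m₀ m → e.eval m = N) (hB : N ≤ B)
    (hinv : ∀ i m r, Inv i m → Inv i (m.setN a 0 0 0 r)) (h0 : Inv 0 m₀)
    (step : ∀ i < N, ∀ m, Frame (repeatFor a e body) m₀ m → m.nat a 0 0 0 = i →
      Inv i m → Runs O body m T (Inv (i + 1))) :
    Runs O (repeatFor a e body) m₀ (loopTime B T) (Inv N) := by
  -- Each iteration costs `T + 2` (test, body, increment) and the last, failing test costs one; the
  -- initial assignment accounts for the other unit in `loopTime`.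
  have key : ∀ d i m, i + d = N → Frame (repeatFor a e body) m₀ m →
      m.nat a 0 0 0 = i → Inv i m →
      Runs O (.while (.not (.leN e (sc a))) (.seq body (assign a (.add (sc a) (.const 1))))) m
        (d * (T + 2) + 1) (Inv N) := by
    intro d
    induction d with
    | zero =>
      intro i m hi hf hc hI
      obtain rfl : i = N := by omega
      refine ⟨1, m, .whileFalse ?_, by omega, hI⟩
      simp [BExp.holds, he m hf, hc]
    | succ d ih =>
      intro i m hi hf hc hI
      obtain ⟨t, m1, h1, h2, h3⟩ := step i (by omega) m hf hc hI
      have hc1 : m1.nat a 0 0 0 = i := by rw [h1.frame.nat a ha, hc]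
      have hx : Exec O (assign a (.add (sc a) (.const 1))) m1 1 (m1.setN a 0 0 0 (i + 1)) := by
        have := Exec.setN (O := O) m1 a (.const 0) (.const 0) (.const 0)
          (.add (sc a) (.const 1))
        simpa [NExp.eval, hc1, assign] using this
      obtain ⟨t', m2, h4, h5, h6⟩ := ih (i + 1) (m1.setN a 0 0 0 (i + 1)) (by omega)
        ((hf.trans (frame_body h1.frame)).trans setN_frame) (by simp [Mem.setN])
        (hinv _ _ _ h3)
      refine ⟨(t + 1) + t' + 1, m2, .whileTrue ?_ (.seq h1 hx) h4, ?_, h6⟩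
      · simp [BExp.holds, he m hf, hc]
        omega
      · rw [Nat.add_mul]
        omega
  have hx : Exec O (assign a (.const 0)) m₀ 1 (m₀.setN a 0 0 0 0) :=
    Exec.setN (O := O) m₀ a (.const 0) (.const 0) (.const 0) (.const 0)
  obtain ⟨t, m', h1, h2, h3⟩ := key N 0 (m₀.setN a 0 0 0 0) (by omega) setN_frame
    (by simp [Mem.setN]) (hinv _ _ _ h0)
  refine ⟨1 + t, m', .seq hx h1, ?_, h3⟩
  have : N * (T + 2) ≤ B * (T + 2) := Nat.mul_le_mul_right _ hB
  unfold loopTime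
  omega

/-- Two nested loops over all pairs; `V` is the set of the pairs that have been treated. -/
theorem Runs.forLoop₂ {a b : ℕ} {e : NExp} {body : Prog} {m₀ : Mem} {N B : ℕ}
    (Inv : Set (ℕ × ℕ) → Mem → Prop) (ha : (repeatFor b e body).changesNat a = false)
    (hb : body.changesNat b = false)
    (he : ∀ m, Frame (repeatFor a e (repeatFor b e body)) m₀ m → e.eval m = N)
    (hB : N ≤ B)
    (hinva : ∀ V m r, Inv V m → Inv V (m.setN a 0 0 0 r))
    (hinvb : ∀ V m r, Inv V m → Inv V (m.setN b 0 0 0 r)) (h0 : Inv ∅ m₀)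
    (step : ∀ V m, ∀ x < N, ∀ y < N,
      Frame (repeatFor a e (repeatFor b e body)) m₀ m →
      m.nat a 0 0 0 = x → m.nat b 0 0 0 = y → Inv V m →
      Runs O body m T (Inv (insert (x, y) V))) :
    Runs O (repeatFor a e (repeatFor b e body)) m₀
      (loopTime B (loopTime B T)) (Inv {p | p.1 < N ∧ p.2 < N}) := by
  refine Runs.forLoop (fun i => Inv {p | p.1 < i ∧ p.2 < N}) ha he hB (fun i => hinva _) ?_ ?_
  · convert h0
    ext p
    simp
  · intro i hi m hf hc hI
    have hfi : ∀ m', Frame (repeatFor b e body) m m' →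
        Frame (repeatFor a e (repeatFor b e body)) m₀ m' :=
      fun m' hm' => hf.trans (frame_body hm')
    refine (Runs.forLoop
      (fun j => Inv {p | (p.1 < i ∧ p.2 < N) ∨ (p.1 = i ∧ p.2 < j)}) hb
      (fun m' hm' => he m' (hfi m' hm')) hB (fun j => hinvb _) ?_ ?_).mono le_rfl ?_
    · convert hI
      simp
    · intro j hj m' hf' hc' hI'
      have := step _ m' i hi j hj (hfi m' hf') ((hf'.nat a ha ▸ hc)) hc' hI'
      refine this.mono le_rfl fun m'' _ h => ?_
      convert h using 1
      ext ⟨x, y⟩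
      simp only [Set.mem_insert_iff, Prod.mk.injEq, Set.mem_ofPred_eq]
      omega
    · intro m' _ h
      convert h using 1
      ext ⟨x, y⟩
      simp only [Set.mem_ofPred_eq]
      omega

end Runs

/-! ### Programs that search for a smallest admissible oracle answer. -/

section Search

variable {n : ℕ} {O : Oracle n}

theorem Runs.loop {a r : ℕ} {body : Prog} {m₀ : Mem} {N B T : ℕ}
    (Inv : ℕ → Mem → Prop) (ha : body.changesNat a = false)
    (hr : (repeatFor a (sc r) body).changesNat r = false) (hN : m₀.nat r 0 0 0 = N) (hB : N ≤ B)
    (hinv : ∀ i m r, Inv i m → Inv i (m.setN a 0 0 0 r)) (h0 : Inv 0 m₀)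
    (step : ∀ i < N, ∀ m, Frame (repeatFor a (sc r) body) m₀ m → m.nat a 0 0 0 = i →
      Inv i m → Runs O body m T (Inv (i + 1))) :
    Runs O (repeatFor a (sc r) body) m₀ (loopTime B T) (Inv N) :=
  Runs.forLoop Inv ha (fun m hf => by rw [sc_eval, hf.nat r hr, hN]) hB hinv h0 step

theorem Runs.loop₂ {a b r : ℕ} {body : Prog} {m₀ : Mem} {N T : ℕ}
    (Inv : Set (ℕ × ℕ) → Mem → Prop) (ha : (repeatFor b (sc r) body).changesNat a = false)
    (hb : body.changesNat b = false)
    (hr : (repeatFor a (sc r) (repeatFor b (sc r) body)).changesNat r = false)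
    (hN : m₀.nat r 0 0 0 = N)
    (hinva : ∀ V m r, Inv V m → Inv V (m.setN a 0 0 0 r))
    (hinvb : ∀ V m r, Inv V m → Inv V (m.setN b 0 0 0 r)) (h0 : Inv ∅ m₀)
    (step : ∀ V m, ∀ x < N, ∀ y < N, Frame (repeatFor a (sc r) (repeatFor b (sc r) body)) m₀ m →
      m.nat a 0 0 0 = x → m.nat b 0 0 0 = y → Inv V m →
      Runs O body m T (Inv (insert (x, y) V))) :
    Runs O (repeatFor a (sc r) (repeatFor b (sc r) body)) m₀
      (loopTime N (loopTime N T)) (Inv {p | p.1 < N ∧ p.2 < N}) :=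
  Runs.forLoop₂ Inv ha hb (fun m hf => by rw [sc_eval, hf.nat r hr, hN]) le_rfl hinva hinvb h0
    step

/-- A loop that computes the entries of an array. -/
theorem Runs.fill {α : Type*} {a r : ℕ} {body : Prog} {m₀ : Mem} {N T : ℕ} (acc : Mem → ℕ → α)
    (f : ℕ → α) (ha : body.changesNat a = false)
    (hr : (repeatFor a (sc r) body).changesNat r = false) (hN : m₀.nat r 0 0 0 = N)
    (hinv : ∀ m r, acc (m.setN a 0 0 0 r) = acc m)
    (step : ∀ m, ∀ x < N, Frame (repeatFor a (sc r) body) m₀ m → m.nat a 0 0 0 = x →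
      Runs O body m T fun m' => ∀ x', acc m' x' = if x' = x then f x else acc m x') :
    Runs O (repeatFor a (sc r) body) m₀ (loopTime N T) fun m => ∀ x < N, acc m x = f x := by
  refine Runs.loop (fun i m => ∀ x < i, acc m x = f x) ha hr hN le_rfl
    (fun i m r h => by simpa only [hinv] using h) (by simp) ?_
  intro i hi m hf hc hI
  refine (step m i hi hf hc).mono le_rfl fun m' _ h x hx => ?_
  rw [h x]
  split_ifs with h1
  · rw [h1]
  · exact hI x (by omega)

/-- Two nested loops that compute the entries of an array. -/
theorem Runs.fill₂ {α : Type*} {a b r : ℕ} {body : Prog} {m₀ : Mem} {N T : ℕ}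
    (acc : Mem → ℕ → ℕ → α) (f : ℕ → ℕ → α)
    (ha : (repeatFor b (sc r) body).changesNat a = false) (hb : body.changesNat b = false)
    (hr : (repeatFor a (sc r) (repeatFor b (sc r) body)).changesNat r = false)
    (hN : m₀.nat r 0 0 0 = N) (hinva : ∀ m r, acc (m.setN a 0 0 0 r) = acc m)
    (hinvb : ∀ m r, acc (m.setN b 0 0 0 r) = acc m)
    (step : ∀ m, ∀ x < N, ∀ y < N, Frame (repeatFor a (sc r) (repeatFor b (sc r) body)) m₀ m →
      m.nat a 0 0 0 = x → m.nat b 0 0 0 = y → Runs O body m T fun m' =>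
        ∀ x' y', acc m' x' y' = if x' = x ∧ y' = y then f x y else acc m x' y') :
    Runs O (repeatFor a (sc r) (repeatFor b (sc r) body)) m₀ (loopTime N (loopTime N T))
      fun m => ∀ x < N, ∀ y < N, acc m x y = f x y := by
  refine (Runs.loop₂ (fun V m => ∀ x y, (x, y) ∈ V → acc m x y = f x y) ha hb hr hN
    (fun V m r h => by simpa only [hinva] using h) (fun V m r h => by simpa only [hinvb] using h)
    (by simp) ?_).mono le_rfl fun m _ h x hx y hy => h x y ⟨hx, hy⟩
  intro V m x hx y hy hf hcx hcy hI
  refine (step m x hx y hy hf hcx hcy).mono le_rfl fun m' _ h x' y' hxy => ?_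
  rw [h x' y']
  split_ifs with h1
  · rw [h1.1, h1.2]
  · exact hI x' y' (hxy.resolve_left fun h' => h1 (Prod.mk.inj h'))

/-- The entry `a[i, j, 0]`. -/
abbrev rd₂ (a : ℕ) (i j : NExp) : NExp := .read a i j (.const 0)

/-- The condition that a number is not zero. -/
def truthy (e : NExp) : BExp := .leN (.const 1) e

@[simp] theorem truthy_holds {e : NExp} {m : Mem} : (truthy e).holds m ↔ e.eval m ≠ 0 := by
  simp [truthy, BExp.holds, NExp.eval, Nat.one_le_iff_ne_zero]

@[simp] theorem not_holds {b : BExp} {m : Mem} : (BExp.not b).holds m ↔ ¬ b.holds m := Iff.rfl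

@[simp] theorem and_holds {b b' : BExp} {m : Mem} :
    (BExp.and b b').holds m ↔ b.holds m ∧ b'.holds m := Iff.rfl

@[simp] theorem leN_holds {e f : NExp} {m : Mem} :
    (BExp.leN e f).holds m ↔ e.eval m ≤ f.eval m := Iff.rfl

@[simp] theorem leV_holds {e f : VExp} {m : Mem} :
    (BExp.leV e f).holds m ↔ e.eval m ≤ f.eval m := Iff.rfl

theorem mem_edgeSet {m : Mem} {a : ℕ} {f : Fin n × Fin n} :
    f ∈ m.edgeSet n a ↔ m.nat a f.1 f.2 0 ≠ 0 := by
  simp [Mem.edgeSet]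

/-- The rule `R` is stored in the memory. -/
structure Rule.Stored (R : Rule n) (m : Mem) : Prop where
  admits : ∀ u v : Fin n, R.admits u v ↔ m.nat 8 u v 0 ≠ 0
  forbids : ∀ u v w : Fin n, R.forbids u v w ↔ m.nat 9 u v w ≠ 0
  lim : m.nat 28 0 0 0 = R.lim

theorem Rule.Stored.of_frame {R : Rule n} {P : Prog} {m m' : Mem} (h : R.Stored m)
    (hf : Frame P m m') (h8 : P.changesNat 8 = false) (h9 : P.changesNat 9 = false)
    (h28 : P.changesNat 28 = false) : R.Stored m' := by
  refine ⟨?_, ?_, ?_⟩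
  · rw [hf.nat 8 h8]; exact h.admits
  · rw [hf.nat 9 h9]; exact h.forbids
  · rw [hf.nat 28 h28]; exact h.lim

/-- Array 5 becomes the edge set of array 4 together with the blockers for the pair of nodes in
the variables 30, 31. -/
def buildQuery : Prog :=
  repeatFor 32 (sc 0) (repeatFor 33 (sc 0)
    (.ite (.and (.leN (sc 33) (sc 31)) (.leN (sc 31) (sc 33)))
      (.setN 5 (sc 32) (sc 33) (.const 0)
        (.add (rd₂ 4 (sc 32) (sc 33)) (.read 9 (sc 30) (sc 31) (sc 32))))
      (.setN 5 (sc 32) (sc 33) (.const 0) (rd₂ 4 (sc 32) (sc 33)))))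

theorem runs_buildQuery {R : Rule n} {m : Mem} (hn : m.nat 0 0 0 0 = n) (hR : R.Stored m)
    {u v : Fin n} (hu : m.nat 30 0 0 0 = u) (hv : m.nat 31 0 0 0 = v) :
    Runs O buildQuery m (loopTime n (loopTime n 2)) fun m' =>
      m'.edgeSet n 5 = m.edgeSet n 4 ∪ R.blockers u v := by
  refine (Runs.fill₂ (fun m' x y => m'.nat 5 x y 0)
    (fun x y => m.nat 4 x y 0 + if y = v then m.nat 9 u v x else 0)
    rfl rfl rfl hn (fun _ _ => rfl) (fun _ _ => rfl) ?_).mono le_rfl ?_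
  · intro m' x hx y hy hf hcx hcy
    have h4 := hf.nat 4 rfl
    have h9 := hf.nat 9 rfl
    have h30 := hf.nat 30 rfl
    have h31 := hf.nat 31 rfl
    refine Runs.ite (fun hb => Runs.setN ?_ le_rfl) (fun hb => Runs.setN ?_ le_rfl)
    all_goals
      simp only [and_holds, leN_holds, sc_eval, hcy, h31, hv] at hb
      intro x' y'
      simp only [NExp.eval, Mem.setN, sc_eval, hcx, hcy, h4, h9, h30, h31, hu, hv, true_and,
        and_true]
    · rw [if_pos (show y = (v : ℕ) by omega)]
    · rw [if_neg (show ¬ y = (v : ℕ) by omega), add_zero]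
  · intro m' _ h
    ext ⟨x, y⟩
    rw [Finset.mem_union, mem_edgeSet, mem_edgeSet, R.mem_blockers, h x x.2 y y.2, hR.forbids]
    simp only [Fin.val_inj]
    split_ifs with h1 <;> simp [h1]
    omega

/-- The number variable 23 becomes the number of nodes of the inner part of the answer. -/
def countInner : Prog :=
  .seq (assign 23 (.const 0))
    (repeatFor 32 (sc 0) (assign 23 (.add (sc 23) (rd₂ 6 (.const 1) (sc 32)))))

theorem runs_countInner {m : Mem} (hn : m.nat 0 0 0 0 = n) {K : Finset (Fin n)}
    (hK : ∀ x : Fin n, m.nat 6 1 x 0 = if x ∈ K then 1 else 0) :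
    Runs O countInner m (1 + loopTime n 1) fun m' => m'.nat 23 0 0 0 = K.card := by
  refine Runs.seq (Runs.setN (fun _ => ?_) le_rfl)
  refine (Runs.loop (fun i m' => m'.nat 23 0 0 0 = ∑ j ∈ Finset.range i, m.nat 6 1 j 0)
    rfl rfl (by simpa [Mem.setN] using hn) le_rfl
    (fun i m' r h => by simpa [Mem.setN] using h) (by simp [Mem.setN, NExp.eval]) ?_).mono
    le_rfl ?_
  · intro i hi m' hf hc hI
    have h6 := hf.nat 6 rfl
    refine Runs.setN ?_ le_rfl
    rw [Finset.sum_range_succ]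
    simp [Mem.setN, NExp.eval, hI, hc, h6]
  · intro m' _ h
    rw [h, Finset.sum_range]
    simp [hK]

theorem encodeAnswer_inner (S : Biset (Fin n)) (x : Fin n) :
    encodeAnswer (some S) 1 x 0 = if x ∈ S.inner then 1 else 0 := by
  simp [encodeAnswer, Fin.val_inj]

theorem encodeAnswer_outer (S : Biset (Fin n)) (x : Fin n) :
    encodeAnswer (some S) 2 x 0 = if x ∈ S.outer then 1 else 0 := by
  simp [encodeAnswer, Fin.val_inj]

/-- The functions `f`, `g` are the indicator functions of the two parts of `S`. -/
def Indicates (f g : ℕ → ℕ) (S : Biset (Fin n)) : Prop :=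
  ∀ x : Fin n, (f x ≠ 0 ↔ x ∈ S.inner) ∧ (g x ≠ 0 ↔ x ∈ S.outer)

/-- The biset given by the answer of the oracle is stored in array 10, its size in the variable 22,
and the variable 21 tells that it has been found. -/
def recordAnswer (co : Bool) : Prog :=
  .seq
    (repeatFor 32 (sc 0) (.seq
      (.setN 10 (.const 0) (sc 32) (.const 0)
        (cond co (.sub (.const 1) (rd₂ 6 (.const 2) (sc 32))) (rd₂ 6 (.const 1) (sc 32))))
      (.setN 10 (.const 1) (sc 32) (.const 0)
        (cond co (.sub (.const 1) (rd₂ 6 (.const 1) (sc 32))) (rd₂ 6 (.const 2) (sc 32))))))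
    (.seq (assign 21 (.const 1)) (assign 22 (sc 23)))

theorem runs_recordAnswer {m : Mem} (hn : m.nat 0 0 0 0 = n) {co : Bool} {A : Biset (Fin n)}
    (hA : m.nat 6 = encodeAnswer (some A)) :
    Runs O (recordAnswer co) m (loopTime n 2 + 2) fun m' =>
      m'.nat 21 0 0 0 ≠ 0 ∧ m'.nat 22 0 0 0 = m.nat 23 0 0 0 ∧
        Indicates (fun x => m'.nat 10 0 x 0) (fun x => m'.nat 10 1 x 0) (view co A) := by
  refine Runs.seq ((Runs.fill (fun m' x => (m'.nat 10 0 x 0, m'.nat 10 1 x 0))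
    (fun x => (cond co (1 - m.nat 6 2 x 0) (m.nat 6 1 x 0),
      cond co (1 - m.nat 6 1 x 0) (m.nat 6 2 x 0))) rfl rfl hn (fun _ _ => rfl) ?_).mono le_rfl ?_)
  · intro m' x hx hf hc
    have h6 := hf.nat 6 rfl
    refine Runs.seq (Runs.setN (fun _ => Runs.setN ?_ le_rfl) le_rfl)
    intro x'
    cases co <;> simp only [NExp.eval, Mem.setN, sc_eval, hc, h6, cond_true, cond_false] <;>
      by_cases h1 : x' = x <;> simp [h1]
  · intro m' hf h _
    have h23 := hf.nat 23 rfl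
    refine Runs.seq (Runs.setN (fun _ => Runs.setN ?_ le_rfl) le_rfl)
    refine ⟨by simp [Mem.setN, NExp.eval], by simp [Mem.setN, NExp.eval, h23], fun x => ?_⟩
    have hx := h x x.2
    rw [Prod.mk.injEq] at hx
    simp only [Mem.setN, hx.1, hx.2, hA, encodeAnswer_inner, encodeAnswer_outer]
    cases co
    · simp [view]
    · by_cases h1 : x ∈ A.outer <;> by_cases h2 : x ∈ A.inner <;> simp [view, Biset.co, h1, h2]

/-- The state of the search for a smallest admissible answer, after the pairs of nodes in `V`. -/
def FindInv (O : Oracle n) (R : Rule n) (J : Finset (Fin n × Fin n)) (V : Set (ℕ × ℕ)) (m : Mem) :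
    Prop :=
  (m.nat 21 0 0 0 = 0 ∧ ∀ u v : Fin n, ∀ A, ((u : ℕ), (v : ℕ)) ∈ V → ¬ R.Eligible O J u v A) ∨
  (m.nat 21 0 0 0 ≠ 0 ∧ ∃ u v A, R.Eligible O J u v A ∧ m.nat 22 0 0 0 = A.inner.card ∧
    Indicates (fun x => m.nat 10 0 x 0) (fun x => m.nat 10 1 x 0) (view R.co A) ∧
    ∀ u' v' : Fin n, ∀ A', ((u' : ℕ), (v' : ℕ)) ∈ V → R.Eligible O J u' v' A' →
      A.inner.card ≤ A'.inner.card)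

/-- The oracle is called for the pair of nodes in the variables 30, 31. -/
def tryPair (co : Bool) : Prog :=
  .seq buildQuery (.seq (.query co 5 (sc 30) (sc 31) 6) (.seq countInner
    (.ite
      (.and (.and (truthy (rd₂ 8 (sc 30) (sc 31)))
          (truthy (rd₂ 6 (.const 0) (.const 0))))
        (.and (.leN (.add (sc 23) (sc 23)) (sc 28))
          (.not (.and (truthy (sc 21)) (.leN (sc 22) (sc 23))))))
      (recordAnswer co) .skip)))

def tryTime (n : ℕ) : ℕ :=
  loopTime n (loopTime n 2) + (1 + (1 + loopTime n 1 + (loopTime n 2 + 2 + 1)))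

theorem runs_tryPair {R : Rule n} {m : Mem} (hn : m.nat 0 0 0 0 = n) (hR : R.Stored m)
    {u v : Fin n} (hu : m.nat 30 0 0 0 = u) (hv : m.nat 31 0 0 0 = v)
    {J : Finset (Fin n × Fin n)} (hJ : m.edgeSet n 4 = J) {V : Set (ℕ × ℕ)}
    (hI : FindInv O R J V m) :
    Runs O (tryPair R.co) m (tryTime n) (FindInv O R J (insert ((u : ℕ), (v : ℕ)) V)) := by
  refine Runs.seq ((runs_buildQuery hn hR hu hv).mono le_rfl fun m₁ hf₁ h₁ _ => ?_)
  refine Runs.seq (Runs.query (x := u) (y := v) (by simp [hf₁.nat 30 rfl, hu])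
    (by simp [hf₁.nat 31 rfl, hv]) (fun hf₂ => ?_) le_rfl)
  rw [h₁, hJ] at hf₂ ⊢
  set ans := O R.co (J ∪ R.blockers u v) u v with hans
  set m₂ := m₁.putAnswer 6 ans with hm₂
  have h6 : m₂.nat 6 = encodeAnswer ans := by simp [hm₂, Mem.putAnswer]
  have hn₂ : m₂.nat 0 0 0 0 = n := by rw [hf₂.nat 0 rfl, hf₁.nat 0 rfl, hn]
  have e21 : m₂.nat 21 = m.nat 21 := by rw [hf₂.nat 21 rfl, hf₁.nat 21 rfl]
  have e22 : m₂.nat 22 = m.nat 22 := by rw [hf₂.nat 22 rfl, hf₁.nat 22 rfl]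
  have e10 : m₂.nat 10 = m.nat 10 := by rw [hf₂.nat 10 rfl, hf₁.nat 10 rfl]
  have e8 : m₂.nat 8 = m.nat 8 := by rw [hf₂.nat 8 rfl, hf₁.nat 8 rfl]
  have e28 : m₂.nat 28 = m.nat 28 := by rw [hf₂.nat 28 rfl, hf₁.nat 28 rfl]
  have e30 : m₂.nat 30 = m.nat 30 := by rw [hf₂.nat 30 rfl, hf₁.nat 30 rfl]
  have e31 : m₂.nat 31 = m.nat 31 := by rw [hf₂.nat 31 rfl, hf₁.nat 31 rfl]
  -- All cases in which the record is left alone: either the pair has no admissible answer, or the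
  -- recorded one is no larger.
  have keep : ∀ m' : Mem, m'.nat 21 = m.nat 21 → m'.nat 22 = m.nat 22 → m'.nat 10 = m.nat 10 →
      (∀ A, R.Eligible O J u v A → m.nat 21 0 0 0 ≠ 0 ∧ m.nat 22 0 0 0 ≤ A.inner.card) →
      FindInv O R J (insert ((u : ℕ), (v : ℕ)) V) m' := by
    intro m' k21 k22 k10 hk
    rcases hI with ⟨h0, hno⟩ | ⟨h0, u₀, v₀, A₀, a1, a2, a3, a4⟩
    · refine .inl ⟨by rw [k21, h0], fun u' v' A' hmem hel => ?_⟩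
      rcases hmem with h | h
      · rw [Prod.mk.injEq, Fin.val_inj, Fin.val_inj] at h
        rw [h.1, h.2] at hel
        exact (hk A' hel).1 h0
      · exact hno u' v' A' h hel
    · refine .inr ⟨by rwa [k21], u₀, v₀, A₀, a1, by rw [k22, a2], by rwa [k10],
        fun u' v' A' hmem hel => ?_⟩
      rcases hmem with h | h
      · rw [Prod.mk.injEq, Fin.val_inj, Fin.val_inj] at h
        rw [h.1, h.2] at hel
        rw [← a2]
        exact (hk A' hel).2
      · exact a4 u' v' A' h hel
  rcases hA : ans with _ | A
  · rw [hA] at h6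
    refine Runs.seq ((runs_countInner (K := ∅) hn₂ (by simp [h6, encodeAnswer])).mono le_rfl
      fun m₃ hf₃ h₃ _ => ?_)
    have g6 := hf₃.nat 6 rfl
    refine Runs.ite (fun hb => ?_) fun hb => Runs.skip ?_ (by omega)
    · simp [NExp.eval, g6, h6, encodeAnswer] at hb
    · refine keep m₃ (by rw [hf₃.nat 21 rfl, e21]) (by rw [hf₃.nat 22 rfl, e22])
        (by rw [hf₃.nat 10 rfl, e10]) fun A hel => ?_
      have := hel.2.2
      rw [← hans, hA] at this
      simp at this
  · rw [hA] at h6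
    refine Runs.seq ((runs_countInner (K := A.inner) hn₂ (by simp [h6, encodeAnswer_inner])).mono
      le_rfl fun m₃ hf₃ h₃ _ => ?_)
    have g6 : m₃.nat 6 = encodeAnswer (some A) := by rw [hf₃.nat 6 rfl, h6]
    have g8 : m₃.nat 8 = m.nat 8 := by rw [hf₃.nat 8 rfl, e8]
    have g28 : m₃.nat 28 = m.nat 28 := by rw [hf₃.nat 28 rfl, e28]
    have g30 : m₃.nat 30 = m.nat 30 := by rw [hf₃.nat 30 rfl, e30]
    have g31 : m₃.nat 31 = m.nat 31 := by rw [hf₃.nat 31 rfl, e31]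
    have g21 : m₃.nat 21 = m.nat 21 := by rw [hf₃.nat 21 rfl, e21]
    have g22 : m₃.nat 22 = m.nat 22 := by rw [hf₃.nat 22 rfl, e22]
    have g10 : m₃.nat 10 = m.nat 10 := by rw [hf₃.nat 10 rfl, e10]
    have hans0 : encodeAnswer (some A) 0 0 0 = 1 := by simp [encodeAnswer]
    have hel_iff : ∀ A', R.Eligible O J u v A' ↔
        A' = A ∧ R.admits u v ∧ A.inner.card + A.inner.card ≤ R.lim := fun A' => by
      rw [Rule.Eligible, ← hans, hA, Option.some.injEq]
      constructor
      · rintro ⟨a, b, rfl⟩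
        exact ⟨rfl, a, b⟩
      · rintro ⟨rfl, a, b⟩
        exact ⟨a, b, rfl⟩
    refine Runs.ite (fun hb => ?_) fun hb => Runs.skip ?_ (by omega)
    · simp only [and_holds, truthy_holds, leN_holds, not_holds, NExp.eval, sc_eval, g8, g30, g31,
        g28, g6, h₃, hu, hv, hR.lim, g21, g22, ← hR.admits] at hb
      refine (runs_recordAnswer (by rw [hf₃.nat 0 rfl, hn₂]) g6).mono le_rfl
        fun m₄ hf₄ h₄ => .inr ⟨h₄.1, u, v, A, (hel_iff A).2 ⟨rfl, hb.1.1, hb.2.1⟩,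
          by rw [h₄.2.1, h₃], h₄.2.2, fun u' v' A' hmem hel => ?_⟩
      rcases hmem with h | h
      · rw [Prod.mk.injEq, Fin.val_inj, Fin.val_inj] at h
        rw [h.1, h.2] at hel
        rw [((hel_iff A').1 hel).1]
      · rcases hI with ⟨h0, hno⟩ | ⟨h0, u₀, v₀, A₀, a1, a2, a3, a4⟩
        · exact absurd hel (hno u' v' A' h)
        · have := a4 u' v' A' h hel
          have h7 := hb.2.2
          rw [a2] at h7
          have : ¬ A₀.inner.card ≤ A.inner.card := fun h8 => h7 ⟨h0, h8⟩
          omega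
    · simp only [and_holds, truthy_holds, leN_holds, not_holds, NExp.eval, sc_eval, g8, g30, g31,
        g28, g6, h₃, hu, hv, hR.lim, g21, g22, ← hR.admits, hans0] at hb
      refine keep m₃ g21 g22 g10 fun A' hel => ?_
      obtain ⟨rfl, h5, h6⟩ := (hel_iff A').1 hel
      by_contra hcon
      exact hb ⟨⟨h5, one_ne_zero⟩, h6, hcon⟩

/-- The search for a smallest admissible answer. -/
def findBest (co : Bool) : Prog :=
  .seq (assign 21 (.const 0)) (repeatFor 30 (sc 0) (repeatFor 31 (sc 0) (tryPair co)))

def findTime (n : ℕ) : ℕ := 1 + loopTime n (loopTime n (tryTime n))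

theorem runs_findBest {R : Rule n} {m : Mem} (hn : m.nat 0 0 0 0 = n) (hR : R.Stored m)
    {J : Finset (Fin n × Fin n)} (hJ : m.edgeSet n 4 = J) :
    Runs O (findBest R.co) m (findTime n) fun m' =>
      (m'.nat 21 0 0 0 = 0 ∧ ∀ u v A, ¬ R.Eligible O J u v A) ∨
      (m'.nat 21 0 0 0 ≠ 0 ∧ ∃ S, R.Best O J S ∧
        Indicates (fun x => m'.nat 10 0 x 0) (fun x => m'.nat 10 1 x 0) S) := by
  refine Runs.seq (Runs.setN (fun hf₁ => ?_) le_rfl)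
  refine (Runs.loop₂ (FindInv O R J) rfl rfl rfl (by rw [hf₁.nat 0 rfl, hn])
    (fun V m' r h => by simpa [FindInv, Mem.setN] using h)
    (fun V m' r h => by simpa [FindInv, Mem.setN] using h)
    (.inl ⟨by simp [Mem.setN, NExp.eval], by simp⟩) ?_).mono le_rfl ?_
  · intro V m' x hx y hy hf hcx hcy hI
    refine runs_tryPair (u := ⟨x, hx⟩) (v := ⟨y, hy⟩)
      (by rw [hf.nat 0 rfl, hf₁.nat 0 rfl, hn])
      ((hR.of_frame hf₁ rfl rfl rfl).of_frame hf rfl rfl rfl) hcx hcy ?_ hI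
    rw [Mem.edgeSet, hf.nat 4 rfl, hf₁.nat 4 rfl]
    exact hJ
  · rintro m' - (⟨h0, h⟩ | ⟨h0, u, v, A, h1, h2, h3, h4⟩)
    · exact .inl ⟨h0, fun u v A => h u v A ⟨u.2, v.2⟩⟩
    · exact .inr ⟨h0, _, ⟨u, v, A, h1, rfl, fun u' v' A' => h4 u' v' A' ⟨u'.2, v'.2⟩⟩, h3⟩

end Search

/-! ### Programs for the dual ascent: reduced costs and the choice of tight edges. -/

section Growth

variable {n : ℕ} {O : Oracle n}

/-- The condition that the edge `xy` covers the biset in array 10. -/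
def coversHere (x y : NExp) : BExp :=
  .and (truthy (rd₂ 10 (.const 0) x)) (.not (truthy (rd₂ 10 (.const 1) y)))

theorem coversHere_holds {m : Mem} {S : Biset (Fin n)}
    (hS : Indicates (fun x => m.nat 10 0 x 0) (fun x => m.nat 10 1 x 0) S) {x y : NExp}
    {f : Fin n × Fin n} (hx : x.eval m = f.1) (hy : y.eval m = f.2) :
    (coversHere x y).holds m ↔ Covers f S := by
  simp only [coversHere, and_holds, truthy_holds, not_holds, NExp.eval, hx, hy]
  exact and_congr (hS f.1).1 (not_congr (hS f.2).2)

/-- The entry `a[i, j, 0]` of an array of cost values. -/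
abbrev rdV (a : ℕ) (i j : NExp) : VExp := .read a i j (.const 0)

/-- The variable `a` for cost values. -/
abbrev scV (a : ℕ) : VExp := rdV a (.const 0) (.const 0)

/-- A cheapest edge, with respect to the reduced costs in array 1, that covers the biset in
array 10 is stored in the variables 25, 26, and its reduced cost in the variable 2; the variable 24
tells whether there is one. -/
def minEdge : Prog :=
  .seq (assign 24 (.const 0))
    (repeatFor 32 (sc 0) (repeatFor 33 (sc 0)
      (.ite (.and (.and (truthy (rd₂ 2 (sc 32) (sc 33))) (coversHere (sc 32) (sc 33)))
          (.not (.and (truthy (sc 24)) (.leV (scV 2) (rdV 1 (sc 32) (sc 33))))))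
        (.seq (assign 24 (.const 1)) (.seq (assign 25 (sc 32)) (.seq (assign 26 (sc 33))
          (.setV 2 (.const 0) (.const 0) (.const 0) (rdV 1 (sc 32) (sc 33))))))
        .skip)))

/-- The state of the search for a cheapest edge of `E` that covers `S`, after the pairs of nodes
in `V`. -/
def MinInv (E : Finset (Fin n × Fin n)) (S : Biset (Fin n)) (w : ℕ → ℕ → ℝ) (V : Set (ℕ × ℕ))
    (m : Mem) : Prop :=
  (m.nat 24 0 0 0 = 0 ∧ ∀ f ∈ E, ((f.1 : ℕ), (f.2 : ℕ)) ∈ V → ¬ Covers f S) ∨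
  (m.nat 24 0 0 0 ≠ 0 ∧ ∃ f ∈ E, Covers f S ∧ m.nat 25 0 0 0 = f.1 ∧ m.nat 26 0 0 0 = f.2 ∧
    m.val 2 0 0 0 = w f.1 f.2 ∧
    ∀ f' ∈ E, ((f'.1 : ℕ), (f'.2 : ℕ)) ∈ V → Covers f' S → w f.1 f.2 ≤ w f'.1 f'.2)

theorem runs_minEdge {m : Mem} (hn : m.nat 0 0 0 0 = n) {E : Finset (Fin n × Fin n)}
    (hE : m.edgeSet n 2 = E) {S : Biset (Fin n)}
    (hS : Indicates (fun x => m.nat 10 0 x 0) (fun x => m.nat 10 1 x 0) S) :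
    Runs O minEdge m (1 + loopTime n (loopTime n 5)) fun m' =>
      (m'.nat 24 0 0 0 = 0 ∧ ∀ f ∈ E, ¬ Covers f S) ∨
      (m'.nat 24 0 0 0 ≠ 0 ∧ ∃ f ∈ E, Covers f S ∧ m'.nat 25 0 0 0 = f.1 ∧
        m'.nat 26 0 0 0 = f.2 ∧ m'.val 2 0 0 0 = m.val 1 f.1 f.2 0 ∧
        ∀ f' ∈ E, Covers f' S → m.val 1 f.1 f.2 0 ≤ m.val 1 f'.1 f'.2 0) := by
  refine Runs.seq (Runs.setN (fun hf₁ => ?_) le_rfl)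
  refine (Runs.loop₂ (MinInv E S fun x y => m.val 1 x y 0) rfl rfl rfl
    (by rw [hf₁.nat 0 rfl, hn]) (by exact fun _ _ _ h => h) (by exact fun _ _ _ h => h)
    (.inl ⟨by simp [Mem.setN, NExp.eval], by simp⟩) ?_).mono le_rfl ?_
  · intro V m' x hx y hy hf hcx hcy hI
    have h10 : m'.nat 10 = m.nat 10 := by rw [hf.nat 10 rfl, hf₁.nat 10 rfl]
    have h2 : m'.nat 2 = m.nat 2 := by rw [hf.nat 2 rfl, hf₁.nat 2 rfl]
    have w1 : m'.val 1 = m.val 1 := by rw [hf.val 1 rfl, hf₁.val 1 rfl]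
    have hcov := coversHere_holds (m := m') (f := (⟨x, hx⟩, ⟨y, hy⟩)) (x := sc 32) (y := sc 33)
      (by rw [h10]; exact hS) hcx hcy
    have hmem : ((⟨x, hx⟩, ⟨y, hy⟩) : Fin n × Fin n) ∈ E ↔ m.nat 2 x y 0 ≠ 0 := by
      rw [← hE, mem_edgeSet]
    have heq : ∀ f : Fin n × Fin n, ((f.1 : ℕ), (f.2 : ℕ)) = (x, y) →
        f = (⟨x, hx⟩, ⟨y, hy⟩) := fun f h => by
      rw [Prod.mk.injEq] at h
      exact Prod.ext (Fin.ext h.1) (Fin.ext h.2)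
    refine Runs.ite (fun hb => ?_) fun hb => Runs.skip ?_ (by omega)
    · rw [and_holds, and_holds, hcov] at hb
      simp only [truthy_holds, NExp.eval, not_holds, and_holds, leV_holds, VExp.eval,
        sc_eval, hcx, hcy, h2, w1, ← hmem] at hb
      refine (Runs.seq (Runs.setN (fun _ => Runs.seq (Runs.setN (fun _ => Runs.seq (Runs.setN
        (fun _ => Runs.setV ?_ le_rfl) le_rfl)) le_rfl)) le_rfl)).mono (T := 1 + (1 + (1 + 1)))
          (Q := MinInv E S (fun x y => m.val 1 x y 0) (insert (x, y) V)) le_rfl fun _ _ h => h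
      refine .inr ⟨by simp [Mem.setN, Mem.setV, NExp.eval], _, hb.1.1, hb.1.2,
        by simp [Mem.setN, Mem.setV, NExp.eval, hcx],
        by simp [Mem.setN, Mem.setV, NExp.eval, hcy],
        by simp [Mem.setN, Mem.setV, NExp.eval, VExp.eval, hcx, hcy, w1], fun f' hf' hv hc' => ?_⟩
      rcases hv with hv | hv
      · rw [heq f' hv]
      · rcases hI with ⟨i1, i2⟩ | ⟨i1, f₀, i2, i3, i4, i5, i6, i7⟩
        · exact absurd hc' (i2 f' hf' hv)
        · refine le_trans ?_ (i7 f' hf' hv hc')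
          have := hb.2
          rw [i6] at this
          exact (lt_of_not_ge fun h => this ⟨i1, h⟩).le
    · rw [and_holds, and_holds, hcov] at hb
      simp only [truthy_holds, NExp.eval, not_holds, and_holds, leV_holds, VExp.eval,
        sc_eval, hcx, hcy, h2, w1, ← hmem] at hb
      rcases hI with ⟨i1, i2⟩ | ⟨i1, f₀, i2, i3, i4, i5, i6, i7⟩
      · refine .inl ⟨i1, fun f hfE hv hcf => ?_⟩
        rcases hv with hv | hv
        · rw [heq f hv] at hfE hcf
          exact hb ⟨⟨hfE, hcf⟩, fun h => h.1 i1⟩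
        · exact i2 f hfE hv hcf
      · refine .inr ⟨i1, f₀, i2, i3, i4, i5, i6, fun f hfE hv hcf => ?_⟩
        rcases hv with hv | hv
        · rw [heq f hv] at hfE hcf ⊢
          by_contra hcon
          refine hb ⟨⟨hfE, hcf⟩, fun h => hcon ?_⟩
          rw [← i6]
          exact h.2
        · exact i7 f hfE hv hcf
  · rintro m' - (⟨h0, h⟩ | ⟨h0, f, h1, h2, h3, h4, h5, h6⟩)
    · exact .inl ⟨h0, fun f hf => h f hf ⟨f.1.2, f.2.2⟩⟩
    · exact .inr ⟨h0, f, h1, h2, h3, h4, h5, fun f' hf' => h6 f' hf' ⟨f'.1.2, f'.2.2⟩⟩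

/-- Array `a` of cost values becomes array `b`. -/
def copyVal (a b : ℕ) : Prog :=
  repeatFor 32 (sc 0) (repeatFor 33 (sc 0)
    (.setV a (sc 32) (sc 33) (.const 0) (rdV b (sc 32) (sc 33))))

theorem runs_copyVal {a b : ℕ} (hab : Nat.beq a b = false) {m : Mem} (hn : m.nat 0 0 0 0 = n) :
    Runs O (copyVal a b) m (loopTime n (loopTime n 1)) fun m' =>
      ∀ x < n, ∀ y < n, m'.val a x y 0 = m.val b x y 0 := by
  refine Runs.fill₂ (fun m' x y => m'.val a x y 0) (fun x y => m.val b x y 0) rfl rfl rfl hn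
    (fun _ _ => rfl) (fun _ _ => rfl) ?_
  intro m' x hx y hy hf hcx hcy
  have h1 : m'.val b = m.val b :=
    hf.val b (by simp [repeatFor, assign, Prog.changesVal] at hab ⊢; exact hab)
  refine Runs.setV ?_ le_rfl
  intro x' y'
  simp [Mem.setV, NExp.eval, VExp.eval, hcx, hcy, h1]

/-- The reduced costs of the edges that cover the biset in array 10 decrease by the value of the
variable 2. -/
def reduceCosts : Prog :=
  .seq
    (repeatFor 32 (sc 0) (repeatFor 33 (sc 0)
      (.ite (coversHere (sc 32) (sc 33))
        (.setV 3 (sc 32) (sc 33) (.const 0) (.sub (rdV 1 (sc 32) (sc 33)) (scV 2)))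
        (.setV 3 (sc 32) (sc 33) (.const 0) (rdV 1 (sc 32) (sc 33))))))
    (copyVal 1 3)

theorem runs_reduceCosts {m : Mem} (hn : m.nat 0 0 0 0 = n) {S : Biset (Fin n)}
    (hS : Indicates (fun x => m.nat 10 0 x 0) (fun x => m.nat 10 1 x 0) S) :
    Runs O reduceCosts m (loopTime n (loopTime n 2) + loopTime n (loopTime n 1)) fun m' =>
      ∀ f : Fin n × Fin n, m'.val 1 f.1 f.2 0 =
        m.val 1 f.1 f.2 0 - if Covers f S then m.val 2 0 0 0 else 0 := by
  classical
  -- The new costs pass through a buffer array, so array 1 keeps its old entries throughout the loop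
  -- and can be read off by the frame.
  refine Runs.seq ((Runs.fill₂ (fun m' x y => m'.val 3 x y 0)
    (fun x y => m.val 1 x y 0 -
      if m.nat 10 0 x 0 ≠ 0 ∧ ¬ m.nat 10 1 y 0 ≠ 0 then m.val 2 0 0 0 else 0)
    rfl rfl rfl hn (fun _ _ => rfl) (fun _ _ => rfl) ?_).mono le_rfl ?_)
  · intro m' x hx y hy hf hcx hcy
    have h10 := hf.nat 10 rfl
    have w1 := hf.val 1 rfl
    have w2 := hf.val 2 rfl
    refine Runs.ite (fun hb => Runs.setV ?_ le_rfl) (fun hb => Runs.setV ?_ le_rfl)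
    all_goals
      simp only [coversHere, and_holds, truthy_holds, not_holds, NExp.eval, sc_eval, hcx, hcy,
        h10] at hb
      intro x' y'
      simp only [Mem.setV, NExp.eval, VExp.eval, sc_eval, hcx, hcy, w1, w2, true_and, and_true]
    · rw [if_pos hb]
    · rw [if_neg hb, sub_zero]
  · intro m' hf h _
    refine (runs_copyVal rfl (by rw [hf.nat 0 rfl, hn])).mono le_rfl fun m'' _ h' f => ?_
    rw [h' _ f.1.2 _ f.2.2, h _ f.1.2 _ f.2.2]
    congr 1
    refine if_congr ?_ rfl rfl
    exact and_congr (hS f.1).1 (not_congr (hS f.2).2)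

/-- The bisets `S i` and the edges `e i` with `i < N` are stored in the arrays 11, 12, 13. -/
structure Logged (N : ℕ) (S : ℕ → Biset (Fin n)) (e : ℕ → Fin n × Fin n) (m : Mem) : Prop where
  count : m.nat 20 0 0 0 = N
  bisets : ∀ i < N, Indicates (fun x => m.nat 11 i x 0) (fun x => m.nat 12 i x 0) (S i)
  edges : ∀ i < N, m.nat 13 i 0 0 = (e i).1 ∧ m.nat 13 i 1 0 = (e i).2

theorem Logged.of_frame {N : ℕ} {S : ℕ → Biset (Fin n)} {e : ℕ → Fin n × Fin n} {P : Prog}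
    {m m' : Mem} (h : Logged N S e m) (hf : Frame P m m') (h11 : P.changesNat 11 = false)
    (h12 : P.changesNat 12 = false) (h13 : P.changesNat 13 = false)
    (h20 : P.changesNat 20 = false) : Logged N S e m' := by
  refine ⟨?_, ?_, ?_⟩
  · rw [hf.nat 20 h20]; exact h.count
  · rw [hf.nat 11 h11, hf.nat 12 h12]; exact h.bisets
  · rw [hf.nat 13 h13]; exact h.edges

/-- The biset in array 10 and the edge in the variables 25, 26 are appended to the lists. -/
def appendEdge : Prog :=
  .seq
    (repeatFor 32 (sc 0) (.seq
      (.setN 11 (sc 20) (sc 32) (.const 0) (rd₂ 10 (.const 0) (sc 32)))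
      (.setN 12 (sc 20) (sc 32) (.const 0) (rd₂ 10 (.const 1) (sc 32)))))
    (.seq (.setN 13 (sc 20) (.const 0) (.const 0) (sc 25))
      (.seq (.setN 13 (sc 20) (.const 1) (.const 0) (sc 26))
        (.seq (.setN 4 (sc 25) (sc 26) (.const 0) (.const 1))
          (assign 20 (.add (sc 20) (.const 1))))))

theorem runs_appendEdge {m : Mem} (hn : m.nat 0 0 0 0 = n) {N : ℕ} {S : ℕ → Biset (Fin n)}
    {e : ℕ → Fin n × Fin n} (hL : Logged N S e m) {X : Biset (Fin n)} {f : Fin n × Fin n}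
    (hX : Indicates (fun x => m.nat 10 0 x 0) (fun x => m.nat 10 1 x 0) X)
    (h25 : m.nat 25 0 0 0 = f.1) (h26 : m.nat 26 0 0 0 = f.2) :
    Runs O appendEdge m (loopTime n 2 + 4) fun m' =>
      Logged (N + 1) (Function.update S N X) (Function.update e N f) m' ∧
        m'.edgeSet n 4 = insert f (m.edgeSet n 4) := by
  refine Runs.seq ((Runs.loop (fun t m' => ∀ i x,
      (m'.nat 11 i x 0 = if i = N ∧ x < t then m.nat 10 0 x 0 else m.nat 11 i x 0) ∧
      (m'.nat 12 i x 0 = if i = N ∧ x < t then m.nat 10 1 x 0 else m.nat 12 i x 0))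
    rfl rfl hn le_rfl (by exact fun _ _ _ h => h) (by simp) ?_).mono le_rfl ?_)
  · intro t ht m' hf hc hI
    have h10 := hf.nat 10 rfl
    have h20 : m'.nat 20 0 0 0 = N := by rw [hf.nat 20 rfl, hL.count]
    refine Runs.seq (Runs.setN (fun _ => Runs.setN ?_ le_rfl) le_rfl)
    intro i x
    have h1 : x < t + 1 ↔ x = t ∨ x < t := by omega
    simp only [Mem.setN, NExp.eval, sc_eval, hc, h20, h10, hI i x, h1]
    by_cases h2 : i = N <;> by_cases h3 : x = t <;> simp [h2, h3]
  · intro m₁ hf h _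
    have h20 : m₁.nat 20 0 0 0 = N := by rw [hf.nat 20 rfl, hL.count]
    have g25 : m₁.nat 25 0 0 0 = f.1 := by rw [hf.nat 25 rfl, h25]
    have g26 : m₁.nat 26 0 0 0 = f.2 := by rw [hf.nat 26 rfl, h26]
    have g13 := hf.nat 13 rfl
    have g4 := hf.nat 4 rfl
    refine (Runs.seq (Runs.setN (fun _ => Runs.seq (Runs.setN (fun _ => Runs.seq (Runs.setN
      (fun _ => Runs.setN ?_ le_rfl) le_rfl)) le_rfl)) le_rfl)).mono (T := 1 + (1 + (1 + 1)))
      le_rfl fun _ _ h => h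
    refine ⟨⟨by simp [Mem.setN, NExp.eval, h20], fun i hi x => ?_, fun i hi => ?_⟩, ?_⟩
    · have hx := h i x
      rcases Nat.lt_succ_iff_lt_or_eq.1 hi with hi | rfl
      · rw [if_neg (by omega), if_neg (by omega)] at hx
        have := hL.bisets i hi x
        simpa [Mem.setN, hx.1, hx.2, Function.update_of_ne hi.ne] using this
      · rw [if_pos ⟨rfl, x.2⟩, if_pos ⟨rfl, x.2⟩] at hx
        have := hX x
        simpa [Mem.setN, hx.1, hx.2] using this
    · rcases Nat.lt_succ_iff_lt_or_eq.1 hi with hi | rfl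
      · have := hL.edges i hi
        simpa [Mem.setN, NExp.eval, h20, g13, Function.update_of_ne hi.ne, hi.ne] using this
      · simp [Mem.setN, NExp.eval, h20, g25, g26]
    · ext ⟨x, y⟩
      rw [Finset.mem_insert, mem_edgeSet, mem_edgeSet]
      simp only [Mem.setN, NExp.eval, sc_eval, g25, g26, g4, Prod.ext_iff, Fin.ext_iff]
      by_cases h1 : (x : ℕ) = f.1 ∧ (y : ℕ) = f.2 <;> simp [h1]

/-- The first part of a primal-dual phase: the choice of the edges `e i` with `i < N`. -/
structure Trace (O : Oracle n) (R : Rule n) (E : Finset (Fin n × Fin n)) (c : Fin n × Fin n → ℝ)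
    (J : Finset (Fin n × Fin n)) (N : ℕ) (S : ℕ → Biset (Fin n)) (e : ℕ → Fin n × Fin n)
    (y : ℕ → ℝ) : Prop where
  covers : ∀ i < N, Covers (e i) (S i)
  uncovered : ∀ i < N, ∀ j < i, ¬ Covers (e j) (S i)
  edge_mem : ∀ i < N, e i ∈ E
  best : ∀ i < N, R.Best O (J ∪ (Finset.range i).image e) (S i)
  nonneg : ∀ i < N, 0 ≤ y i
  feasible : ∀ f ∈ E, ∑ j ∈ Finset.range N with Covers f (S j), y j ≤ c f
  tight : ∀ i < N, c (e i) = ∑ j ∈ Finset.range N with Covers (e i) (S j), y j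

variable {F : Set (Biset (Fin n))} {R : Rule n} {E J : Finset (Fin n × Fin n)}
  {c : Fin n × Fin n → ℝ} {N : ℕ} {S : ℕ → Biset (Fin n)} {e : ℕ → Fin n × Fin n} {y : ℕ → ℝ}

theorem sum_filter_update {X : Biset (Fin n)} {d : ℝ} (f : Fin n × Fin n) :
    ∑ j ∈ Finset.range (N + 1) with Covers f (Function.update S N X j), Function.update y N d j =
      (∑ j ∈ Finset.range N with Covers f (S j), y j) + if Covers f X then d else 0 := by
  rw [Finset.sum_filter, Finset.sum_filter, Finset.sum_range_succ, Function.update_self,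
    Function.update_self]
  congr 1
  refine Finset.sum_congr rfl fun j hj => ?_
  rw [Function.update_of_ne (Finset.mem_range.1 hj).ne,
    Function.update_of_ne (Finset.mem_range.1 hj).ne]

theorem image_range_update {i : ℕ} (hi : i ≤ N) (f : Fin n × Fin n) :
    (Finset.range i).image (Function.update e N f) = (Finset.range i).image e :=
  Finset.image_congr fun _ hj =>
    Function.update_of_ne ((Finset.mem_range.1 hj).trans_le hi).ne _ _

theorem image_range_succ_update (f : Fin n × Fin n) :
    (Finset.range (N + 1)).image (Function.update e N f) = insert f ((Finset.range N).image e) := by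
  rw [Finset.range_add_one, Finset.image_insert, Function.update_self, image_range_update le_rfl]

/-- The new dual variable is the least reduced cost among edges covering `X`: this keeps the dual
feasible and makes `f` tight. Earlier edges stay tight since none of them covers `X`. -/
theorem Trace.extend (hF : IsCrossing F) (hO : O.IsCoreOracle F) (h : Trace O R E c J N S e y)
    {X : Biset (Fin n)} {f : Fin n × Fin n}
    (hX : R.Best O (J ∪ (Finset.range N).image e) X) (hf : f ∈ E) (hfX : Covers f X)
    (hmin : ∀ f' ∈ E, Covers f' X → c f - ∑ j ∈ Finset.range N with Covers f (S j), y j ≤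
      c f' - ∑ j ∈ Finset.range N with Covers f' (S j), y j) :
    Trace O R E c J (N + 1) (Function.update S N X) (Function.update e N f)
      (Function.update y N (c f - ∑ j ∈ Finset.range N with Covers f (S j), y j)) := by
  have hunc := (mem_residual_image.1 (hX.mem hF hO)).2
  refine ⟨fun i hi => ?_, fun i hi j hj => ?_, fun i hi => ?_, fun i hi => ?_, fun i hi => ?_,
    fun f' hf' => ?_, fun i hi => ?_⟩
  all_goals try rcases Nat.lt_succ_iff_lt_or_eq.1 hi with hi | rfl
  · rw [Function.update_of_ne hi.ne, Function.update_of_ne hi.ne]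
    exact h.covers i hi
  · rwa [Function.update_self, Function.update_self]
  · rw [Function.update_of_ne (hj.trans hi).ne, Function.update_of_ne hi.ne]
    exact h.uncovered i hi j hj
  · rw [Function.update_of_ne hj.ne, Function.update_self]
    exact hunc j (Finset.mem_range.2 hj)
  · rw [Function.update_of_ne hi.ne]
    exact h.edge_mem i hi
  · rwa [Function.update_self]
  · rw [image_range_update hi.le, Function.update_of_ne hi.ne]
    exact h.best i hi
  · rwa [image_range_update le_rfl, Function.update_self]
  · rw [Function.update_of_ne hi.ne]
    exact h.nonneg i hi
  · rw [Function.update_self]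
    exact sub_nonneg.2 (h.feasible f hf)
  · rw [sum_filter_update]
    split_ifs with h1
    · have := hmin f' hf' h1
      linarith
    · rw [add_zero]
      exact h.feasible f' hf'
  · rw [sum_filter_update, Function.update_of_ne hi.ne, if_neg (hunc i (Finset.mem_range.2 hi)),
      add_zero]
    exact h.tight i hi
  · rw [sum_filter_update, Function.update_self, if_pos hfX]
    ring

/-- The chosen edges are distinct, as `e j` covers `S j` while earlier edges do not. After `n * n`
choices every pair has been used, so nothing is left uncovered and a fixed number of iterations
suffices. -/
theorem Trace.not_eligible (hF : IsCrossing F) (hO : O.IsCoreOracle F)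
    (h : Trace O R E c J N S e y) (hN : N = n * n) (u v : Fin n) (A : Biset (Fin n)) :
    ¬ R.Eligible O (J ∪ (Finset.range N).image e) u v A := by
  have hinj : Set.InjOn e (Finset.range N) := by
    intro i hi j hj hij
    rw [Finset.mem_coe, Finset.mem_range] at hi hj
    rcases lt_trichotomy i j with hlt | rfl | hlt
    · exact absurd (hij ▸ h.covers j hj) (h.uncovered j hj i hlt)
    · rfl
    · exact absurd (hij ▸ h.covers i hi) (h.uncovered i hi j hlt)
  have huniv : (Finset.range N).image e = Finset.univ := by
    rw [← Finset.card_eq_iff_eq_univ, Finset.card_image_of_injOn hinj, Finset.card_range, hN]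
    simp
  intro hA
  have h1 := hA.view_mem hF hO
  refine h1.1.2 (u, v) ?_ h1.2
  rw [huniv]
  simp

/-- Array 4 becomes array 3. -/
def copyEdges : Prog :=
  repeatFor 32 (sc 0) (repeatFor 33 (sc 0)
    (.setN 4 (sc 32) (sc 33) (.const 0) (rd₂ 3 (sc 32) (sc 33))))

theorem runs_copyEdges {m : Mem} (hn : m.nat 0 0 0 0 = n) :
    Runs O copyEdges m (loopTime n (loopTime n 1)) fun m' => m'.edgeSet n 4 = m.edgeSet n 3 := by
  refine (Runs.fill₂ (fun m' x y => m'.nat 4 x y 0) (fun x y => m.nat 3 x y 0) rfl rfl rfl hn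
    (fun _ _ => rfl) (fun _ _ => rfl) ?_).mono le_rfl ?_
  · intro m' x hx y hy hf hcx hcy
    have h1 := hf.nat 3 rfl
    refine Runs.setN ?_ le_rfl
    intro x' y'
    simp [Mem.setN, NExp.eval, hcx, hcy, h1]
  · intro m' _ h
    ext f
    rw [mem_edgeSet, mem_edgeSet, h _ f.1.2 _ f.2.2]

/-- The number variable 29 becomes `n * n`. -/
def square : Prog :=
  .seq (assign 29 (.const 0)) (repeatFor 32 (sc 0) (assign 29 (.add (sc 29) (sc 0))))

theorem runs_square {m : Mem} (hn : m.nat 0 0 0 0 = n) :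
    Runs O square m (1 + loopTime n 1) fun m' => m'.nat 29 0 0 0 = n * n := by
  refine Runs.seq (Runs.setN (fun hf₁ => ?_) le_rfl)
  refine Runs.loop (fun i m' => m'.nat 29 0 0 0 = i * n) rfl rfl (by rw [hf₁.nat 0 rfl, hn]) le_rfl
    (by exact fun _ _ _ h => h) (by simp [Mem.setN, NExp.eval]) ?_
  intro i hi m' hf hc hI
  have h0 : m'.nat 0 0 0 0 = n := by rw [hf.nat 0 rfl, hf₁.nat 0 rfl, hn]
  refine Runs.setN ?_ le_rfl
  simp [Mem.setN, NExp.eval, hI, h0, Nat.succ_mul]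

/-- The choice of the next edge. -/
def growStep (co : Bool) : Prog :=
  .seq (findBest co)
    (.ite (truthy (sc 21))
      (.seq minEdge (.ite (truthy (sc 24)) (.seq reduceCosts appendEdge) .skip)) .skip)

def growStepTime (n : ℕ) : ℕ :=
  findTime n + (1 + loopTime n (loopTime n 5) +
    (loopTime n (loopTime n 2) + loopTime n (loopTime n 1) + (loopTime n 2 + 4) + 1) + 1)

/-- The state of the first part of a primal-dual phase after `t` steps. -/
def GrowInv (O : Oracle n) (F : Set (Biset (Fin n))) (R : Rule n) (E : Finset (Fin n × Fin n))
    (c : Fin n × Fin n → ℝ) (J : Finset (Fin n × Fin n)) (t : ℕ) (m : Mem) : Prop :=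
  ∃ N S e y, Trace O R E c J N S e y ∧ Logged N S e m ∧
    m.edgeSet n 4 = J ∪ (Finset.range N).image e ∧
    (∀ f ∈ E, m.val 1 f.1 f.2 0 = c f - ∑ j ∈ Finset.range N with Covers f (S j), y j) ∧
    N ≤ t ∧ (IsEdgeCover E F →
      N = t ∨ ∀ u v A, ¬ R.Eligible O (J ∪ (Finset.range N).image e) u v A)

theorem runs_growStep (hF : IsCrossing F) (hO : O.IsCoreOracle F) {m : Mem}
    (hn : m.nat 0 0 0 0 = n) (hR : R.Stored m) (hE : m.edgeSet n 2 = E) {t : ℕ}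
    (hI : GrowInv O F R E c J t m) :
    Runs O (growStep R.co) m (growStepTime n) (GrowInv O F R E c J (t + 1)) := by
  obtain ⟨N, S, e, y, hT, hL, h4, hw, hNt, hdone⟩ := hI
  have keep : ∀ m' : Mem, Logged N S e m' → m'.nat 4 = m.nat 4 → m'.val 1 = m.val 1 →
      (IsEdgeCover E F → ∀ u v A, ¬ R.Eligible O (J ∪ (Finset.range N).image e) u v A) →
      GrowInv O F R E c J (t + 1) m' := by
    intro m' k1 k2 k3 k4
    refine ⟨N, S, e, y, hT, k1, ?_, ?_, by omega, fun h => .inr (k4 h)⟩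
    · rw [Mem.edgeSet, k2]
      exact h4
    · rwa [k3]
  refine Runs.seq ((runs_findBest hn hR h4).mono le_rfl fun m₁ hf₁ h₁ _ => ?_)
  have hL₁ : Logged N S e m₁ := by
    cases hco : R.co <;> rw [hco] at hf₁ <;> exact hL.of_frame hf₁ rfl rfl rfl rfl
  have hn₁ : m₁.nat 0 = m.nat 0 := by
    cases hco : R.co <;> rw [hco] at hf₁ <;> exact hf₁.nat 0 rfl
  have a2 : m₁.nat 2 = m.nat 2 := by
    cases hco : R.co <;> rw [hco] at hf₁ <;> exact hf₁.nat 2 rfl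
  have a4 : m₁.nat 4 = m.nat 4 := by
    cases hco : R.co <;> rw [hco] at hf₁ <;> exact hf₁.nat 4 rfl
  have w1 : m₁.val 1 = m.val 1 := by
    cases hco : R.co <;> rw [hco] at hf₁ <;> exact hf₁.val 1 rfl
  rcases h₁ with ⟨h0, hno⟩ | ⟨h0, X, hX, hind⟩
  · refine Runs.ite (fun hb => ?_) fun _ => Runs.skip ?_ (by omega)
    · exact absurd h0 (by simpa using hb)
    · exact keep m₁ hL₁ a4 w1 fun _ => hno
  · refine Runs.ite (fun _ => ?_) fun hb => absurd h0 (by simpa using hb)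
    refine Runs.seq ((runs_minEdge (by rw [hn₁, hn]) (E := E) ?_ hind).mono le_rfl
      fun m₂ hf₂ h₂ _ => ?_)
    · rw [Mem.edgeSet, a2]
      exact hE
    have hL₂ := hL₁.of_frame hf₂ rfl rfl rfl rfl
    have hind₂ : Indicates (fun x => m₂.nat 10 0 x 0) (fun x => m₂.nat 10 1 x 0) X := by
      rw [hf₂.nat 10 rfl]
      exact hind
    have b4 : m₂.nat 4 = m.nat 4 := by rw [hf₂.nat 4 rfl, a4]
    have v1 : m₂.val 1 = m.val 1 := by rw [hf₂.val 1 rfl, w1]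
    have hn₂ : m₂.nat 0 0 0 0 = n := by rw [hf₂.nat 0 rfl, hn₁, hn]
    rcases h₂ with ⟨g0, hnone⟩ | ⟨g0, f, hfE, hfX, g25, g26, g2, hmin⟩
    · refine Runs.ite (fun hb => absurd g0 (by simpa using hb)) fun _ => Runs.skip ?_ (by omega)
      -- No edge of `E` covers the member `X`, which is impossible if `E` covers `F`. Otherwise the
      -- program must still halt, but nothing is claimed about its choices being complete.
      refine keep m₂ hL₂ b4 v1 fun hcov => ?_
      obtain ⟨f, hfE, hfX⟩ := hcov X (hX.mem hF hO).1
      exact absurd hfX (hnone f hfE)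
    · refine Runs.ite (fun _ => ?_) fun hb => absurd g0 (by simpa using hb)
      refine Runs.seq ((runs_reduceCosts hn₂ hind₂).mono le_rfl fun m₃ hf₃ h₃ _ => ?_)
      have hn₃ : m₃.nat 0 0 0 0 = n := by rw [hf₃.nat 0 rfl, hn₂]
      refine (runs_appendEdge hn₃ (hL₂.of_frame hf₃ rfl rfl rfl rfl) (X := X) (f := f)
        (by rw [hf₃.nat 10 rfl]; exact hind₂) (by rw [hf₃.nat 25 rfl, g25])
        (by rw [hf₃.nat 26 rfl, g26])).mono le_rfl fun m₄ hf₄ h₄ => ?_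
      rw [w1] at g2 hmin
      refine ⟨N + 1, _, _, _, hT.extend hF hO hX hfE hfX ?_, h₄.1, ?_, ?_, by omega,
        fun hcov => ?_⟩
      · intro f' hf' hc'
        rw [← hw f hfE, ← hw f' hf']
        exact hmin f' hf' hc'
      · rw [h₄.2, image_range_succ_update, Finset.union_insert, ← h4, Mem.edgeSet, Mem.edgeSet,
          hf₃.nat 4 rfl, b4]
      · intro f' hf'
        rw [hf₄.val 1 rfl, h₃ f', v1, g2, hw f' hf', hw f hfE, sum_filter_update]
        ring
      · refine (hdone hcov).imp (congrArg (· + 1)) fun h => ?_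
        obtain ⟨u, v, A, hA, -⟩ := hX
        exact absurd hA (h u v A)

/-- The first part of a primal-dual phase. -/
def grow (co : Bool) : Prog :=
  .seq copyEdges (.seq (copyVal 1 0) (.seq (assign 20 (.const 0)) (.seq square
    (repeatFor 35 (sc 29) (growStep co)))))

def growTime (n : ℕ) : ℕ :=
  loopTime n (loopTime n 1) + (loopTime n (loopTime n 1) + (1 + (1 + loopTime n 1 +
    loopTime (n * n) (growStepTime n))))

theorem runs_grow (hF : IsCrossing F) (hO : O.IsCoreOracle F) (hc : ∀ f ∈ E, 0 ≤ c f) (hn0 : 0 < n)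
    {m : Mem} (hn : m.nat 0 0 0 0 = n) (hR : R.Stored m) (hE : m.edgeSet n 2 = E) (hJ : m.edgeSet n 3 = J)
    (hcost : ∀ f ∈ E, m.val 0 f.1 f.2 0 = c f) :
    Runs O (grow R.co) m (growTime n) fun m' => ∃ N S e y, Trace O R E c J N S e y ∧
      Logged N S e m' ∧ N ≤ n * n ∧
      (IsEdgeCover E F → ∀ u v A, ¬ R.Eligible O (J ∪ (Finset.range N).image e) u v A) := by
  refine Runs.seq ((runs_copyEdges hn).mono le_rfl fun m₁ hf₁ h₁ _ => ?_)
  refine Runs.seq ((runs_copyVal rfl (by rw [hf₁.nat 0 rfl, hn])).mono le_rfl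
    fun m₂ hf₂ h₂ _ => ?_)
  refine Runs.seq (Runs.setN (fun hf₃ => ?_) le_rfl)
  refine Runs.seq ((runs_square (by rw [hf₃.nat 0 rfl, hf₂.nat 0 rfl, hf₁.nat 0 rfl, hn])).mono
    le_rfl fun m₄ hf₄ h₄ _ => ?_)
  have hR₄ : R.Stored m₄ := (((hR.of_frame hf₁ rfl rfl rfl).of_frame hf₂ rfl rfl rfl).of_frame
    hf₃ rfl rfl rfl).of_frame hf₄ rfl rfl rfl
  have hn₄ : m₄.nat 0 0 0 0 = n := by
    rw [hf₄.nat 0 rfl, hf₃.nat 0 rfl, hf₂.nat 0 rfl, hf₁.nat 0 rfl, hn]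
  have e2 : m₄.nat 2 = m.nat 2 := by
    rw [hf₄.nat 2 rfl, hf₃.nat 2 rfl, hf₂.nat 2 rfl, hf₁.nat 2 rfl]
  have e4 : m₄.nat 4 = m₁.nat 4 := by rw [hf₄.nat 4 rfl, hf₃.nat 4 rfl, hf₂.nat 4 rfl]
  have v1 : m₄.val 1 = m₂.val 1 := by rw [hf₄.val 1 rfl, hf₃.val 1 rfl]
  have e20 : m₄.nat 20 0 0 0 = 0 := by
    rw [hf₄.nat 20 rfl]
    simp [Mem.setN, NExp.eval]
  have h29 : (repeatFor 35 (sc 29) (growStep R.co)).changesNat 29 = false := by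
    cases R.co <;> rfl
  refine (Runs.loop (GrowInv O F R E c J) (by cases R.co <;> rfl) h29 h₄ le_rfl
    (fun _ _ _ ⟨N, S, e, y, hT, hL, h⟩ => ⟨N, S, e, y, hT, ⟨hL.1, hL.2, hL.3⟩, h⟩) ?_ ?_).mono le_rfl ?_
  -- The lists are empty and their entries are fillers; a filler edge needs a node, hence `0 < n`.
  · refine ⟨0, fun _ => ⟨∅, ∅, subset_rfl⟩, fun _ => (⟨0, hn0⟩, ⟨0, hn0⟩), fun _ => 0,
      ⟨by simp, by simp, by simp, by simp, by simp, by simpa using hc, by simp⟩,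
      ⟨e20, by simp, by simp⟩, ?_, ?_, le_rfl, fun _ => .inl rfl⟩
    · rw [show m₄.edgeSet n 4 = m₁.edgeSet n 4 by rw [Mem.edgeSet, Mem.edgeSet, e4], h₁, hJ]
      simp
    · intro f hf
      rw [v1, h₂ _ f.1.2 _ f.2.2, hf₁.val 0 rfl, hcost f hf]
      simp
  · intro t ht m' hf htc hI
    refine runs_growStep hF hO ?_ ?_ ?_ hI
    all_goals cases hco : R.co <;> rw [hco] at hf
    · rw [hf.nat 0 rfl, hn₄]
    · rw [hf.nat 0 rfl, hn₄]
    · exact hR₄.of_frame hf rfl rfl rfl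
    · exact hR₄.of_frame hf rfl rfl rfl
    · rw [Mem.edgeSet, hf.nat 2 rfl, e2]
      exact hE
    · rw [Mem.edgeSet, hf.nat 2 rfl, e2]
      exact hE
  · rintro m' hf ⟨N, S, e, y, hT, hL, -, -, hN, hdone⟩
    refine ⟨N, S, e, y, hT, hL, hN, fun hcov => ?_⟩
    rcases hdone hcov with h | h
    · exact hT.not_eligible hF hO h
    · exact h

end Growth

/-! ### Programs for the reverse deletion, and the complete phase. -/

section Phase

variable {n : ℕ} {O : Oracle n} {F : Set (Biset (Fin n))} {R : Rule n}
  {E J : Finset (Fin n × Fin n)} {c : Fin n × Fin n → ℝ} {N : ℕ} {S : ℕ → Biset (Fin n)}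
  {e : ℕ → Fin n × Fin n} {y : ℕ → ℝ} {I : Finset ℕ}

/-- The set `I` of the indices that have been selected among the `t` last ones. -/
def Selected (N : ℕ) (S : ℕ → Biset (Fin n)) (e : ℕ → Fin n × Fin n) (t : ℕ) (I : Finset ℕ) :
    Prop :=
  ∀ i, i ∈ I ↔ i < N ∧ N ≤ i + t ∧ ∀ j < N, Covers (e i) (S j) → ∀ l ∈ I, i < l →
    ¬ Covers (e l) (S j)

/-- The rule for an index refers only to larger selected indices, so deciding `N - 1 - t` leaves all
earlier decisions valid. -/
theorem Selected.step {t : ℕ} (h : Selected N S e t I) (ht : t < N) {I' : Finset ℕ}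
    (hI' : ∀ i, i ∈ I' ↔ i ∈ I ∨ (i = N - 1 - t ∧
      ∀ j < N, Covers (e (N - 1 - t)) (S j) → ¬ ∃ l ∈ I, Covers (e l) (S j))) :
    Selected N S e (t + 1) I' := by
  have hgt : ∀ {i l}, N - 1 - t ≤ i → i < l → (l ∈ I' ↔ l ∈ I) := fun {i l} h1 h2 => by
    rw [hI', or_iff_left]
    omega
  intro i
  rcases lt_trichotomy i (N - 1 - t) with hi | rfl | hi
  · refine iff_of_false (fun h1 => ?_) fun h1 => by omega
    rcases (hI' i).1 h1 with h2 | h2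
    · have := ((h i).1 h2).2.1
      omega
    · omega
  · have hnot : N - 1 - t ∉ I := fun h1 => by
      have := ((h _).1 h1).2.1
      omega
    rw [hI', or_iff_right hnot, and_iff_right rfl]
    constructor
    · intro h1
      exact ⟨by omega, by omega, fun j hj hc l hl hlt hl' =>
        h1 j hj hc ⟨l, (hgt le_rfl hlt).1 hl, hl'⟩⟩
    · rintro ⟨-, -, h1⟩ j hj hc ⟨l, hl, hl'⟩
      have hlt : N - 1 - t < l := by
        have := ((h l).1 hl).2.1
        omega
      exact h1 j hj hc l ((hgt le_rfl hlt).2 hl) hlt hl'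
  · rw [hI', or_iff_left (by omega), h i]
    refine and_congr_right fun h1 => and_congr (by omega) (forall₃_congr fun j hj hc =>
      forall_congr' fun l => ?_)
    constructor
    · exact fun h2 hl hlt => h2 ((hgt hi.le hlt).1 hl) hlt
    · exact fun h2 hl hlt => h2 ((hgt hi.le hlt).2 hl) hlt

theorem Trace.phaseRun (h : Trace O R E c J N S e y) (hI : Selected N S e N I)
    (hne : ∀ u v A, ¬ R.Eligible O (J ∪ (Finset.range N).image e) u v A) :
    PhaseRun O R E c J N S e y I where
  two := ⟨h.covers, h.uncovered, fun i => by
    rw [hI i, and_iff_right (Nat.le_add_left N i)]⟩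
  edge_mem := h.edge_mem
  best := h.best
  nonneg := h.nonneg
  feasible := h.feasible
  tight := h.tight
  not_eligible := hne

/-- The condition that the edge with the index in the variable 38 covers the biset with the index
in the variable 34. -/
def coversLogged : BExp :=
  .and (truthy (rd₂ 11 (sc 34) (rd₂ 13 (sc 38) (.const 0))))
    (.not (truthy (rd₂ 12 (sc 34) (rd₂ 13 (sc 38) (.const 1)))))

theorem coversLogged_holds {m : Mem} (hL : Logged N S e m) {i j : ℕ} (hi : i < N) (hj : j < N)
    (h38 : m.nat 38 0 0 0 = i) (h34 : m.nat 34 0 0 0 = j) :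
    coversLogged.holds m ↔ Covers (e i) (S j) := by
  simp only [coversLogged, and_holds, truthy_holds, not_holds, NExp.eval, sc_eval, h38, h34,
    (hL.edges i hi).1, (hL.edges i hi).2]
  exact and_congr (hL.bisets j hj _).1 (not_congr (hL.bisets j hj _).2)

/-- The variable 27 tells whether no marked biset is covered by the edge with the index in the
variable 38. -/
def checkEdge : Prog :=
  .seq (assign 27 (.const 1))
    (repeatFor 34 (sc 20) (.ite (.and coversLogged (truthy (rd₂ 14 (sc 34) (.const 0))))
      (assign 27 (.const 0)) .skip))

theorem runs_checkEdge {m : Mem} (hL : Logged N S e m) {B : ℕ} (hB : N ≤ B) {i : ℕ} (hi : i < N)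
    (h38 : m.nat 38 0 0 0 = i) :
    Runs O checkEdge m (1 + loopTime B 2) fun m' =>
      m'.nat 27 0 0 0 ≠ 0 ↔ ∀ j < N, Covers (e i) (S j) → m.nat 14 j 0 0 = 0 := by
  refine Runs.seq (Runs.setN (fun hf₁ => ?_) le_rfl)
  refine Runs.loop (fun t m' => m'.nat 27 0 0 0 ≠ 0 ↔
      ∀ j < t, Covers (e i) (S j) → m.nat 14 j 0 0 = 0) rfl rfl
    (by rw [hf₁.nat 20 rfl, hL.count]) hB (by exact fun _ _ _ h => h)
    (by simp [Mem.setN, NExp.eval]) ?_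
  intro j hj m' hf hc hI
  have hL' := (hL.of_frame hf₁ rfl rfl rfl rfl).of_frame hf rfl rfl rfl rfl
  have h14 : m'.nat 14 = m.nat 14 := by rw [hf.nat 14 rfl, hf₁.nat 14 rfl]
  have hcov := coversLogged_holds hL' hi hj (by rw [hf.nat 38 rfl, hf₁.nat 38 rfl, h38]) hc
  have hsucc : (∀ j' < j + 1, Covers (e i) (S j') → m.nat 14 j' 0 0 = 0) ↔
      (∀ j' < j, Covers (e i) (S j') → m.nat 14 j' 0 0 = 0) ∧
        (Covers (e i) (S j) → m.nat 14 j 0 0 = 0) := by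
    simp only [Nat.lt_succ_iff_lt_or_eq]
    constructor
    · exact fun h => ⟨fun j' hj' => h j' (.inl hj'), h j (.inr rfl)⟩
    · rintro ⟨h1, h2⟩ j' (h | rfl)
      · exact h1 j' h
      · exact h2
  refine Runs.ite (fun hb => Runs.setN ?_ le_rfl) fun hb => Runs.skip ?_ le_rfl
  all_goals
    rw [and_holds, hcov] at hb
    simp only [truthy_holds, NExp.eval, sc_eval, hc, h14] at hb
    rw [hsucc]
  · refine iff_of_false (by simp [Mem.setN, NExp.eval]) fun h => hb.2 (h.2 hb.1)
  · rw [hI, and_iff_left]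
    intro h1
    by_contra h2
    exact hb ⟨h1, h2⟩

/-- The bisets covered by the edge with the index in the variable 38 are marked. -/
def markCovered : Prog :=
  repeatFor 34 (sc 20) (.ite coversLogged
    (.setN 14 (sc 34) (.const 0) (.const 0) (.const 1)) .skip)

theorem runs_markCovered {m : Mem} (hL : Logged N S e m) {B : ℕ} (hB : N ≤ B) {i : ℕ} (hi : i < N)
    (h38 : m.nat 38 0 0 0 = i) :
    Runs O markCovered m (loopTime B 2) fun m' =>
      ∀ j < N, m'.nat 14 j 0 0 ≠ 0 ↔ Covers (e i) (S j) ∨ m.nat 14 j 0 0 ≠ 0 := by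
  refine (Runs.loop (fun t m' => ∀ j < N, m'.nat 14 j 0 0 ≠ 0 ↔
      (j < t ∧ Covers (e i) (S j)) ∨ m.nat 14 j 0 0 ≠ 0) rfl rfl hL.count hB
    (by exact fun _ _ _ h => h) (by simp) ?_).mono le_rfl fun m' _ h j hj => ?_
  · intro t ht m' hf hc hI
    have hL' := hL.of_frame hf rfl rfl rfl rfl
    have hcov := coversLogged_holds hL' hi ht (by rw [hf.nat 38 rfl, h38]) hc
    refine Runs.ite (fun hb => Runs.setN ?_ le_rfl) fun hb => Runs.skip ?_ le_rfl
    all_goals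
      rw [hcov] at hb
      intro j hj
      have h2 := hI j hj
      by_cases h1 : j = t
    · simp [Mem.setN, NExp.eval, hc, h1, hb]
    · have h3 : j < t + 1 ↔ j < t := by omega
      simpa [Mem.setN, NExp.eval, hc, h1, h3] using h2
    · subst h1
      simpa [hb] using h2
    · have h3 : j < t + 1 ↔ j < t := by omega
      rw [h2, h3]
  · rw [h j hj, and_iff_right hj]

/-- The decision about the next edge, in the reverse order. -/
def pruneStep : Prog :=
  .seq (assign 38 (.sub (.sub (sc 20) (.const 1)) (sc 36)))
    (.seq checkEdge
      (.ite (truthy (sc 27))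
        (.seq (.setN 3 (rd₂ 13 (sc 38) (.const 0)) (rd₂ 13 (sc 38) (.const 1)) (.const 0)
          (.const 1)) markCovered)
        .skip))

/-- The state of the reverse deletion after `t` steps. -/
def PruneInv (N : ℕ) (S : ℕ → Biset (Fin n)) (e : ℕ → Fin n × Fin n) (J : Finset (Fin n × Fin n))
    (t : ℕ) (m : Mem) : Prop :=
  ∃ I, Selected N S e t I ∧ m.edgeSet n 3 = J ∪ I.image e ∧
    ∀ j < N, m.nat 14 j 0 0 ≠ 0 ↔ ∃ l ∈ I, Covers (e l) (S j)

theorem edgeSet_setN {m : Mem} {a : ℕ} (f : Fin n × Fin n) :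
    (m.setN a f.1 f.2 0 1).edgeSet n a = insert f (m.edgeSet n a) := by
  ext ⟨x, y⟩
  rw [Finset.mem_insert, mem_edgeSet, mem_edgeSet]
  simp only [Mem.setN, Prod.ext_iff, Fin.ext_iff]
  by_cases h1 : (x : ℕ) = f.1 ∧ (y : ℕ) = f.2 <;> simp [h1]

/-- Array 14 marks the bisets already covered by selected edges. This reduces the selection rule to
a single pass over the list, and a second pass updates the marks. -/
theorem runs_pruneStep {m : Mem} (hL : Logged N S e m) {B : ℕ} (hB : N ≤ B) {t : ℕ} (ht : t < N)
    (h36 : m.nat 36 0 0 0 = t) (hI : PruneInv N S e J t m) :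
    Runs O pruneStep m (1 + (1 + loopTime B 2 + (1 + loopTime B 2 + 1)))
      (PruneInv N S e J (t + 1)) := by
  obtain ⟨I, hsel, h3, h14⟩ := hI
  set i := N - 1 - t with hi
  have hiN : i < N := by omega
  refine Runs.seq (Runs.setN (fun hf₁ => ?_) le_rfl)
  have k38 : (m.setN 38 0 0 0 i).nat 38 0 0 0 = i := by simp [Mem.setN]
  simp only [NExp.eval, sc_eval, hL.count, h36, ← hi] at hf₁ ⊢
  have hL₁ := hL.of_frame hf₁ rfl rfl rfl rfl
  refine Runs.seq ((runs_checkEdge hL₁ hB hiN k38).mono le_rfl fun m₂ hf₂ h₂ _ => ?_)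
  have hL₂ := hL₁.of_frame hf₂ rfl rfl rfl rfl
  have k3 : m₂.nat 3 = m.nat 3 := by rw [hf₂.nat 3 rfl, hf₁.nat 3 rfl]
  have k14 : m₂.nat 14 = m.nat 14 := by rw [hf₂.nat 14 rfl, hf₁.nat 14 rfl]
  have g38 : m₂.nat 38 0 0 0 = i := by rw [hf₂.nat 38 rfl, k38]
  have h3' : m₂.edgeSet n 3 = J ∪ I.image e := by rw [← h3, Mem.edgeSet, Mem.edgeSet, k3]
  rw [hf₁.nat 14 rfl] at h₂
  have hok : m₂.nat 27 0 0 0 ≠ 0 ↔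
      ∀ j < N, Covers (e i) (S j) → ¬ ∃ l ∈ I, Covers (e l) (S j) := by
    rw [h₂]
    refine forall₃_congr fun j hj _ => ?_
    rw [← h14 j hj, not_not]
  refine Runs.ite (fun hb => ?_) fun hb => Runs.skip ?_ (by omega)
  all_goals rw [truthy_holds, sc_eval, hok] at hb
  · refine Runs.seq (Runs.setN (fun hf₃ => ?_) le_rfl)
    have hv1 := (hL₂.edges i hiN).1
    have hv2 := (hL₂.edges i hiN).2
    simp only [NExp.eval, sc_eval, g38, hv1, hv2] at hf₃ ⊢
    have hL₃ := hL₂.of_frame hf₃ rfl rfl rfl rfl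
    refine (runs_markCovered hL₃ hB hiN (by rw [hf₃.nat 38 rfl, g38])).mono le_rfl
      fun m₄ hf₄ h₄ => ⟨insert i I, hsel.step ht fun l => ?_, ?_, fun j hj => ?_⟩
    · rw [Finset.mem_insert, or_comm, and_iff_left hb]
    · rw [Mem.edgeSet, hf₄.nat 3 rfl, ← Mem.edgeSet, edgeSet_setN, h3', Finset.image_insert,
        Finset.union_insert]
    · rw [h₄ j hj, hf₃.nat 14 rfl, k14, h14 j hj]
      simp
  · refine ⟨I, hsel.step ht fun l => ?_, h3', ?_⟩
    · rw [or_iff_left]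
      exact fun h => hb h.2
    · rw [k14]
      exact h14

/-- The reverse deletion. -/
def prune : Prog :=
  .seq (repeatFor 34 (sc 20) (.setN 14 (sc 34) (.const 0) (.const 0) (.const 0)))
    (repeatFor 36 (sc 20) pruneStep)

theorem runs_prune {m : Mem} (hL : Logged N S e m) {B : ℕ} (hB : N ≤ B)
    (hJ : m.edgeSet n 3 = J) :
    Runs O prune m (loopTime B 1 + loopTime B (1 + (1 + loopTime B 2 + (1 + loopTime B 2 + 1))))
      fun m' => ∃ I, Selected N S e N I ∧ m'.edgeSet n 3 = J ∪ I.image e := by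
  refine Runs.seq ((Runs.loop (fun t m' => ∀ j < t, m'.nat 14 j 0 0 = 0) rfl rfl hL.count hB
    (by exact fun _ _ _ h => h) (by simp) ?_).mono le_rfl fun m₁ hf₁ h₁ _ => ?_)
  · intro t ht m' hf hc hI
    refine Runs.setN (fun j hj => ?_) le_rfl
    by_cases h1 : j = t
    · simp [Mem.setN, NExp.eval, hc, h1]
    · simpa [Mem.setN, NExp.eval, hc, h1] using hI j (by omega)
  · have hL₁ := hL.of_frame hf₁ rfl rfl rfl rfl
    refine (Runs.loop (PruneInv N S e J) rfl rfl hL₁.count hB (by exact fun _ _ _ h => h)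
      ⟨∅, fun i => ?_, ?_, fun j hj => ?_⟩ ?_).mono le_rfl ?_
    · simp
    · rw [Mem.edgeSet, hf₁.nat 3 rfl, ← Mem.edgeSet, hJ]
      simp
    · simp [h₁ j hj]
    · intro t ht m' hf hc hI
      exact runs_pruneStep (hL₁.of_frame hf rfl rfl rfl rfl) hB ht hc hI
    · rintro m' - ⟨I, h1, h2, -⟩
      exact ⟨I, h1, h2⟩

/-- A primal-dual phase. -/
def phase (co : Bool) : Prog := .seq (grow co) prune

def phaseTime (n : ℕ) : ℕ :=
  growTime n + (loopTime (n * n) 1 +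
    loopTime (n * n) (1 + (1 + loopTime (n * n) 2 + (1 + loopTime (n * n) 2 + 1))))

/-- Halting in time is unconditional; only the claim that the outcome is a genuine phase assumes
that `E` covers `F`. -/
theorem runs_phase (hF : IsCrossing F) (hO : O.IsCoreOracle F) (hc : ∀ f ∈ E, 0 ≤ c f)
    (hn0 : 0 < n) {m : Mem} (hn : m.nat 0 0 0 0 = n) (hR : R.Stored m) (hE : m.edgeSet n 2 = E)
    (hJ : m.edgeSet n 3 = J) (hcost : ∀ f ∈ E, m.val 0 f.1 f.2 0 = c f) :
    Runs O (phase R.co) m (phaseTime n) fun m' => ∃ N S e y I,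
      (IsEdgeCover E F → PhaseRun O R E c J N S e y I) ∧ m'.edgeSet n 3 = J ∪ I.image e := by
  refine Runs.seq ((runs_grow hF hO hc hn0 hn hR hE hJ hcost).mono le_rfl ?_)
  rintro m₁ hf₁ ⟨N, S, e, y, hT, hL, hN, hne⟩ -
  have h3 : m₁.edgeSet n 3 = J := by
    have : m₁.nat 3 = m.nat 3 := by
      cases hco : R.co <;> rw [hco] at hf₁ <;> exact hf₁.nat 3 rfl
    rw [Mem.edgeSet, this]
    exact hJ
  refine (runs_prune hL hN h3).mono le_rfl ?_
  rintro m₂ - ⟨I, hI, h4⟩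
  exact ⟨N, S, e, y, I, fun hcov => hT.phaseRun hI (hne hcov), h4⟩

end Phase

/-! ### Storing the rules in memory, and the main program. -/

section Main

variable {n : ℕ} {O : Oracle n} {F : Set (Biset (Fin n))} {E J : Finset (Fin n × Fin n)}
  {c : Fin n × Fin n → ℝ} {k : ℕ}

/-- The entries `a[u, v, w]` for the pair `u`, `v` in the variables 30, 31 become the values of
an expression. -/
def fillRow (a : ℕ) (g : NExp) : Prog :=
  repeatFor 32 (sc 0) (.setN a (sc 30) (sc 31) (sc 32) g)

theorem runs_fillRow {a : ℕ} {g : NExp} {m : Mem} (hn : m.nat 0 0 0 0 = n) {u v : ℕ}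
    (ha : (fillRow a g).changesNat 0 = false ∧ (fillRow a g).changesNat 30 = false ∧
      (fillRow a g).changesNat 31 = false ∧
      (Prog.setN a (sc 30) (sc 31) (sc 32) g).changesNat 32 = false)
    (h30 : m.nat 30 0 0 0 = u) (h31 : m.nat 31 0 0 0 = v) (h : ℕ → ℕ)
    (hg : ∀ m' w, Frame (fillRow a g) m m' → m'.nat 32 0 0 0 = w → g.eval m' = h w) :
    Runs O (fillRow a g) m (loopTime n 1) fun m' => ∀ x y w,
      m'.nat a x y w = if x = u ∧ y = v ∧ w < n then h w else m.nat a x y w := by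
  have ha32 : a ≠ 32 := (ne_of_beq ha.2.2.2).symm
  refine Runs.loop (fun t m' => ∀ x y w,
    m'.nat a x y w = if x = u ∧ y = v ∧ w < t then h w else m.nat a x y w) ha.2.2.2 ha.1 hn le_rfl
    (fun t m' r hI x y w => by simpa [Mem.setN, ha32] using hI x y w) (by simp) ?_
  intro t ht m' hf hc hI
  refine Runs.setN (fun x y w => ?_) le_rfl
  have h1 : w < t + 1 ↔ w = t ∨ w < t := by omega
  simp only [Mem.setN, sc_eval, hc, hf.nat 30 ha.2.1, hf.nat 31 ha.2.2.1, h30, h31, hg m' t hf hc,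
    true_and, hI x y w, h1]
  by_cases h2 : x = u <;> by_cases h3 : y = v <;> by_cases h4 : w = t <;> simp [h2, h3, h4]

/-- The rule for small bisets is stored. -/
def storeSmall : Prog :=
  .seq (repeatFor 30 (sc 0) (repeatFor 31 (sc 0)
      (.seq (.setN 8 (sc 30) (sc 31) (.const 0) (.const 1)) (fillRow 9 (.const 0)))))
    (assign 28 (.sub (sc 0) (sc 1)))

theorem runs_storeSmall {m : Mem} (hn : m.nat 0 0 0 0 = n) (hk : m.nat 1 0 0 0 = k) :
    Runs O storeSmall m (loopTime n (loopTime n (1 + loopTime n 1)) + 1)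
      (smallRule n k).Stored := by
  refine Runs.seq ((Runs.fill₂ (fun m' u v => (m'.nat 8 u v 0, fun w : Fin n => m'.nat 9 u v w))
    (fun _ _ => (1, fun _ => 0)) rfl rfl rfl hn (fun _ _ => rfl) (fun _ _ => rfl) ?_).mono le_rfl
    fun m₁ hf₁ h₁ _ => Runs.setN ⟨fun u v => ?_, fun u v w => ?_, ?_⟩ le_rfl)
  · intro m' u hu v hv hf hcu hcv
    refine Runs.seq (Runs.setN (fun hf₁ => ?_) le_rfl)
    refine (runs_fillRow (u := u) (v := v) (by rw [hf₁.nat 0 rfl, hf.nat 0 rfl, hn])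
      ⟨rfl, rfl, rfl, rfl⟩ (by rw [hf₁.nat 30 rfl, hcu]) (by rw [hf₁.nat 31 rfl, hcv]) (fun _ => 0)
      fun _ _ _ _ => rfl).mono le_rfl fun m'' hf₂ h x y => ?_
    rw [hf₂.nat 8 rfl]
    simp only [h, Mem.setN, NExp.eval, sc_eval, hcu, hcv]
    by_cases h1 : x = u <;> by_cases h2 : y = v <;> simp [h1, h2]
  · have := congrArg Prod.fst (h₁ u u.2 v v.2)
    simp only at this
    simp [Mem.setN, this, smallRule]
  · have := congrFun (congrArg Prod.snd (h₁ u u.2 v v.2)) w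
    simp only at this
    simp [Mem.setN, this, smallRule]
  · simp [Mem.setN, NExp.eval, hf₁.nat 0 rfl, hf₁.nat 1 rfl, hn, hk, smallRule]

/-- The cores for all pairs of nodes are stored in array 7. -/
def storeCores : Prog :=
  repeatFor 30 (sc 0) (repeatFor 31 (sc 0)
    (.seq (.query false 3 (sc 30) (sc 31) 6) (fillRow 7 (rd₂ 6 (.const 1) (sc 32)))))

open Classical in
theorem runs_storeCores {m : Mem} (hn : m.nat 0 0 0 0 = n) (hJ : m.edgeSet n 3 = J) :
    Runs O storeCores m (loopTime n (loopTime n (1 + loopTime n 1))) fun m' =>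
      ∀ w v x : Fin n, m'.nat 7 w v x = if InCore O J w v x then 1 else 0 := by
  refine (Runs.fill₂ (fun m' w v => fun x : Fin n => m'.nat 7 w v x)
    (fun w v x => if ∃ w' v' : Fin n, (w' : ℕ) = w ∧ (v' : ℕ) = v ∧ InCore O J w' v' x
      then 1 else 0) rfl rfl rfl hn (fun _ _ => rfl) (fun _ _ => rfl) ?_).mono le_rfl ?_
  · intro m' w hw v hv hf hcw hcv
    have h3 : m'.edgeSet n 3 = J := by
      rw [Mem.edgeSet, hf.nat 3 rfl]
      exact hJ
    refine Runs.seq (Runs.query (x := ⟨w, hw⟩) (y := ⟨v, hv⟩) hcw hcv (fun hf₁ => ?_) le_rfl)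
    rw [h3] at hf₁ ⊢
    refine (runs_fillRow (u := w) (v := v) (by rw [hf₁.nat 0 rfl, hf.nat 0 rfl, hn])
      ⟨rfl, rfl, rfl, rfl⟩ (by rw [hf₁.nat 30 rfl, hcw]) (by rw [hf₁.nat 31 rfl, hcv])
      (fun x => encodeAnswer (O false J ⟨w, hw⟩ ⟨v, hv⟩) 1 x 0)
      fun m'' x hf₂ hx => ?_).mono le_rfl fun m'' hf₂ h w' v' => ?_
    · simp only [NExp.eval, sc_eval, hx, hf₂.nat 6 rfl]
      simp [Mem.putAnswer]
    · funext x
      rw [h, hf₁.nat 7 rfl]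
      by_cases h1 : w' = w ∧ v' = v
      · rw [if_pos h1, if_pos ⟨h1.1, h1.2, x.2⟩]
        have h2 : (∃ w' v' : Fin n, (w' : ℕ) = w ∧ (v' : ℕ) = v ∧ InCore O J w' v' x) ↔
            InCore O J ⟨w, hw⟩ ⟨v, hv⟩ x := by
          constructor
          · rintro ⟨w', v', h3, h4, h5⟩
            rwa [show w' = ⟨w, hw⟩ from Fin.ext h3, show v' = ⟨v, hv⟩ from Fin.ext h4] at h5
          · exact fun h => ⟨_, _, rfl, rfl, h⟩
        rw [if_congr h2 rfl rfl]
        rcases hK : O false J ⟨w, hw⟩ ⟨v, hv⟩ with _ | K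
        · simp [encodeAnswer, InCore, hK]
        · simp [encodeAnswer_inner, InCore, hK]
      · rw [if_neg h1, if_neg fun h2 => h1 ⟨h2.1, h2.2.1⟩]
  · intro m' _ h w v x
    rw [show m'.nat 7 w v x = _ from congrFun (h w w.2 v v.2) x]
    refine if_congr ?_ rfl rfl
    simp [Fin.val_inj]

/-- The pairs of nodes whose core is an atom are stored in array 8. -/
def storeAtoms : Prog :=
  repeatFor 30 (sc 0) (repeatFor 31 (sc 0)
    (.seq (.setN 8 (sc 30) (sc 31) (.const 0) (.read 7 (sc 30) (sc 31) (sc 30)))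
      (repeatFor 32 (sc 0) (.setN 8 (sc 30) (sc 31) (.const 0)
        (.sub (rd₂ 8 (sc 30) (sc 31))
          (.sub (.read 7 (sc 30) (sc 31) (sc 32)) (.read 7 (sc 32) (sc 31) (sc 30))))))))

open Classical in
theorem runs_storeAtoms {m : Mem} (hn : m.nat 0 0 0 0 = n)
    (h7 : ∀ w v x : Fin n, m.nat 7 w v x = if InCore O J w v x then 1 else 0) :
    Runs O storeAtoms m (loopTime n (loopTime n (1 + loopTime n 1))) fun m' =>
      ∀ w v : Fin n, m'.nat 8 w v 0 = if InAtom O J w v then 1 else 0 := by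
  refine (Runs.fill₂ (fun m' w v => m'.nat 8 w v 0)
    (fun w v => if ∃ w' v' : Fin n, (w' : ℕ) = w ∧ (v' : ℕ) = v ∧ InAtom O J w' v'
      then 1 else 0) rfl rfl rfl hn (fun _ _ => rfl) (fun _ _ => rfl) ?_).mono le_rfl ?_
  · intro m' w hw v hv hf hcw hcv
    set w₀ : Fin n := ⟨w, hw⟩ with hw₀
    set v₀ : Fin n := ⟨v, hv⟩ with hv₀
    refine Runs.seq (Runs.setN (fun hf₁ => ?_) le_rfl)
    refine (Runs.loop (fun t m'' => ∀ w' v', m''.nat 8 w' v' 0 = if w' = w ∧ v' = v then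
        (if InCore O J w₀ v₀ w₀ ∧ ∀ x : Fin n, (x : ℕ) < t → InCore O J w₀ v₀ x →
          InCore O J x v₀ w₀ then 1 else 0) else m'.nat 8 w' v' 0) rfl rfl
      (by rw [hf₁.nat 0 rfl, hf.nat 0 rfl, hn]) le_rfl (by exact fun _ _ _ h => h) ?_ ?_).mono
      le_rfl fun m'' _ h w' v' => ?_
    · intro w' v'
      simp only [Mem.setN, NExp.eval, sc_eval, hcw, hcv, hf.nat 7 rfl]
      by_cases h1 : w' = w <;> by_cases h2 : v' = v <;> simp [h1, h2, ← h7, hw₀, hv₀]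
    · intro t ht m'' hf₂ hct hI
      refine Runs.setN (fun w' v' => ?_) le_rfl
      have e7 : m''.nat 7 = m.nat 7 := by rw [hf₂.nat 7 rfl, hf₁.nat 7 rfl, hf.nat 7 rfl]
      have e30 : m''.nat 30 0 0 0 = w := by rw [hf₂.nat 30 rfl, hf₁.nat 30 rfl, hcw]
      have e31 : m''.nat 31 0 0 0 = v := by rw [hf₂.nat 31 rfl, hf₁.nat 31 rfl, hcv]
      have hI0 := hI w v
      rw [if_pos ⟨rfl, rfl⟩] at hI0
      have a1 : m.nat 7 w v t = if InCore O J w₀ v₀ ⟨t, ht⟩ then 1 else 0 := h7 w₀ v₀ ⟨t, ht⟩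
      have a2 : m.nat 7 t v w = if InCore O J ⟨t, ht⟩ v₀ w₀ then 1 else 0 := h7 ⟨t, ht⟩ v₀ w₀
      simp only [Mem.setN, NExp.eval, sc_eval, e30, e31, hct, e7, hI0, a1, a2]
      by_cases h1 : w' = w ∧ v' = v
      · have h3 : (∀ x : Fin n, (x : ℕ) < t + 1 → InCore O J w₀ v₀ x → InCore O J x v₀ w₀) ↔
            (∀ x : Fin n, (x : ℕ) < t → InCore O J w₀ v₀ x → InCore O J x v₀ w₀) ∧
              (InCore O J w₀ v₀ ⟨t, ht⟩ → InCore O J ⟨t, ht⟩ v₀ w₀) := by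
          constructor
          · exact fun h => ⟨fun x hx => h x (by omega), h ⟨t, ht⟩ (Nat.lt_succ_self t)⟩
          · rintro ⟨b1, b2⟩ x hx
            rcases Nat.lt_succ_iff_lt_or_eq.1 hx with hx | hx
            · exact b1 x hx
            · rw [show x = ⟨t, ht⟩ from Fin.ext hx]
              exact b2
        rw [if_pos h1, if_pos ⟨trivial, h1.1, h1.2, trivial⟩]
        simp only [h3]
        -- The amount subtracted is one exactly if `t` violates the symmetry test; truncation keeps
        -- the flag at zero after the first violation.
        by_cases p1 : InCore O J w₀ v₀ ⟨t, ht⟩ <;> by_cases p2 : InCore O J ⟨t, ht⟩ v₀ w₀ <;>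
          simp [p1, p2]
        split_ifs <;> rfl
      · rw [if_neg h1, if_neg fun h => h1 ⟨h.2.1, h.2.2.1⟩]
        have := hI w' v'
        rwa [if_neg h1] at this
    · rw [h w' v']
      refine if_congr Iff.rfl (if_congr ?_ rfl rfl) rfl
      constructor
      · rintro ⟨b1, b2⟩
        exact ⟨w₀, v₀, rfl, rfl, b1, fun x => b2 x x.2⟩
      · rintro ⟨w', v', b1, b2, b3, b4⟩
        rw [show w' = w₀ from Fin.ext b1, show v' = v₀ from Fin.ext b2] at b3 b4
        exact ⟨b3, fun x _ => b4 x⟩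
  · intro m' _ h w v
    rw [h w w.2 v v.2]
    refine if_congr ?_ rfl rfl
    simp [Fin.val_inj]

/-- The rule for the members that contain a single atom is stored. -/
def storeHalo : Prog :=
  .seq storeCores (.seq storeAtoms (.seq
    (repeatFor 30 (sc 0) (repeatFor 31 (sc 0) (fillRow 9
      (.sub (rd₂ 8 (sc 32) (sc 31)) (.read 7 (sc 30) (sc 31) (sc 32))))))
    (assign 28 (.add (sc 0) (sc 0)))))

def storeHaloTime (n : ℕ) : ℕ :=
  loopTime n (loopTime n (1 + loopTime n 1)) + (loopTime n (loopTime n (1 + loopTime n 1)) +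
    (loopTime n (loopTime n (loopTime n 1)) + 1))

/-- The truncated difference of two flags encodes "the first and not the second", which is the
forbidding condition. The stored limit `n + n` imposes no restriction on answers. -/
theorem runs_storeHalo {m : Mem} (hn : m.nat 0 0 0 0 = n) (hJ : m.edgeSet n 3 = J) :
    Runs O storeHalo m (storeHaloTime n) (haloRule O J).Stored := by
  classical
  refine Runs.seq ((runs_storeCores hn hJ).mono le_rfl fun m₁ hf₁ h₁ _ => ?_)
  have hn₁ : m₁.nat 0 0 0 0 = n := by rw [hf₁.nat 0 rfl, hn]
  refine Runs.seq ((runs_storeAtoms hn₁ h₁).mono le_rfl fun m₂ hf₂ h₂ _ => ?_)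
  have hn₂ : m₂.nat 0 0 0 0 = n := by rw [hf₂.nat 0 rfl, hn₁]
  refine Runs.seq ((Runs.fill₂ (fun m' u v => fun w : Fin n => m'.nat 9 u v w)
    (fun u v w => m₂.nat 8 w v 0 - m₁.nat 7 u v w) rfl rfl rfl hn₂ (fun _ _ => rfl)
    (fun _ _ => rfl) ?_).mono le_rfl
    fun m₃ hf₃ h₃ _ => Runs.setN ⟨fun u v => ?_, fun u v w => ?_, ?_⟩ le_rfl)
  · intro m' u hu v hv hf hcu hcv
    refine (runs_fillRow (u := u) (v := v) (by rw [hf.nat 0 rfl, hn₂]) ⟨rfl, rfl, rfl, rfl⟩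
      hcu hcv (fun w => m₂.nat 8 w v 0 - m₁.nat 7 u v w) fun m'' w hf' hw => ?_).mono
      le_rfl fun m'' hf' h x y => ?_
    · simp only [NExp.eval, sc_eval, hw, hf'.nat 30 rfl, hf'.nat 31 rfl, hcu, hcv, hf'.nat 8 rfl,
        hf'.nat 7 rfl, hf.nat 8 rfl, hf.nat 7 rfl, hf₂.nat 7 rfl]
    · funext w
      rw [h]
      by_cases h1 : x = u <;> by_cases h2 : y = v <;> simp [h1, h2]
  · have h4 : (m₃.setN 28 0 0 0 0).nat 8 u v 0 = if InAtom O J u v then 1 else 0 := by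
      rw [← h₂ u v, ← hf₃.nat 8 rfl]
      rfl
    change InAtom O J u v ↔ (m₃.setN 28 0 0 0 0).nat 8 u v 0 ≠ 0
    rw [h4]
    simp
  · have h4 := congrFun (h₃ u u.2 v v.2) w
    simp only [h₂ w v, h₁ u v w] at h4
    change InAtom O J w v ∧ ¬ InCore O J u v w ↔ m₃.nat 9 u v w ≠ 0
    rw [h4]
    by_cases h5 : InAtom O J w v <;> by_cases h6 : InCore O J u v w <;> simp [h5, h6]
  · simp [Mem.setN, NExp.eval, hf₃.nat 0 rfl, hn₂, haloRule]

/-- The algorithm. -/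
def mainProg : Prog :=
  .ite (truthy (sc 0))
    (.seq storeSmall (.seq (phase false) (repeatFor 37 (sc 0) (.seq storeHalo (phase true)))))
    .skip

def mainTime (n : ℕ) : ℕ :=
  loopTime n (loopTime n (1 + loopTime n 1)) + 1 +
    (phaseTime n + loopTime n (storeHaloTime n + phaseTime n)) + 1

theorem runs_mainProg (hF : IsCrossing F) (hO : O.IsCoreOracle F) (hc : ∀ f ∈ E, 0 ≤ c f)
    (hn0 : 0 < n) {m : Mem} (hn : m.nat 0 0 0 0 = n) (hk : m.nat 1 0 0 0 = k)
    (hE : m.edgeSet n 2 = E) (hJ : m.edgeSet n 3 = ∅) (hcost : ∀ f ∈ E, m.val 0 f.1 f.2 0 = c f) :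
    Runs O mainProg m (mainTime n) fun m' =>
      ∃ Js, m'.edgeSet n 3 = Js n ∧ (IsEdgeCover E F → AlgRun O k E c Js) := by
  refine Runs.ite (fun _ => ?_) fun h => absurd hn0 (by simpa [hn] using h)
  refine Runs.seq ((runs_storeSmall hn hk).mono le_rfl fun m₁ hf₁ hR₁ _ => ?_)
  refine Runs.seq ((runs_phase hF hO hc hn0 (by rw [hf₁.nat 0 rfl, hn]) hR₁ (E := E) (J := ∅)
    ?_ ?_ ?_).mono le_rfl ?_)
  · rw [← hE, Mem.edgeSet, Mem.edgeSet, hf₁.nat 2 rfl]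
  · rw [← hJ, Mem.edgeSet, Mem.edgeSet, hf₁.nat 3 rfl]
  · rw [hf₁.val 0 rfl]
    exact hcost
  rintro m₂ hf₂ ⟨N, S, e, y, I, hrun, hJ₂⟩ -
  rw [Finset.empty_union] at hJ₂
  change Frame (phase false) m₁ m₂ at hf₂
  refine (Runs.loop (fun r m' => ∃ Js : ℕ → Finset (Fin n × Fin n), m'.edgeSet n 3 = Js r ∧
    (IsEdgeCover E F →
      (∃ N S e y I, PhaseRun O (smallRule n k) E c ∅ N S e y I ∧ Js 0 = I.image e) ∧
      ∀ i < r, ∃ N S e y I, PhaseRun O (haloRule O (Js i)) E c (Js i) N S e y I ∧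
        Js (i + 1) = Js i ∪ I.image e)) rfl rfl (by rw [hf₂.nat 0 rfl, hf₁.nat 0 rfl, hn]) le_rfl
    (by exact fun _ _ _ h => h)
    ⟨fun _ => I.image e, hJ₂, fun h => ⟨⟨N, S, e, y, I, hrun h, rfl⟩, by simp⟩⟩ ?_).mono le_rfl ?_
  · rintro r hr m₃ hf₃ - ⟨Js, h3, hJs⟩
    have hn₃ : m₃.nat 0 0 0 0 = n := by rw [hf₃.nat 0 rfl, hf₂.nat 0 rfl, hf₁.nat 0 rfl, hn]
    refine Runs.seq ((runs_storeHalo hn₃ h3).mono le_rfl fun m₄ hf₄ hR₄ _ => ?_)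
    refine (runs_phase hF hO hc hn0 (by rw [hf₄.nat 0 rfl, hn₃]) hR₄ (E := E) (J := Js r)
      ?_ ?_ ?_).mono le_rfl ?_
    · rw [← hE, Mem.edgeSet, Mem.edgeSet, hf₄.nat 2 rfl, hf₃.nat 2 rfl, hf₂.nat 2 rfl,
        hf₁.nat 2 rfl]
    · rw [← h3, Mem.edgeSet, Mem.edgeSet, hf₄.nat 3 rfl]
    · rw [hf₄.val 0 rfl, hf₃.val 0 rfl, hf₂.val 0 rfl, hf₁.val 0 rfl]
      exact hcost
    rintro m₅ - ⟨N, S, e, y, I, hrun, hJ₅⟩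
    -- The history of edge sets exists only in the invariant; one more term is defined per phase,
    -- and the earlier phases do not see it.
    have hle : ∀ i ≤ r, Function.update Js (r + 1) (Js r ∪ I.image e) i = Js i := fun i hi =>
      Function.update_of_ne (by omega) _ _
    refine ⟨Function.update Js (r + 1) (Js r ∪ I.image e), by rw [hJ₅, Function.update_self],
      fun hcov => ⟨by rw [hle 0 (Nat.zero_le r)]; exact (hJs hcov).1, fun i hi => ?_⟩⟩
    rw [hle i (by omega)]
    rcases Nat.lt_succ_iff_lt_or_eq.1 hi with hi | rfl
    · rw [hle (i + 1) (by omega)]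
      exact (hJs hcov).2 i hi
    · rw [Function.update_self]
      exact ⟨N, S, e, y, I, hrun hcov, rfl⟩
  · rintro m' - ⟨Js, h3, hJs⟩
    exact ⟨Js, h3, fun hcov => ⟨(hJs hcov).1, (hJs hcov).2⟩⟩

/-! ### Polynomiality of the time bound, and the input memory. -/

/-- The function `f` is a polynomial with natural coefficients. -/
def IsPoly (f : ℕ → ℕ) : Prop := ∃ p : Polynomial ℕ, ∀ n, p.eval n = f n

theorem IsPoly.const (a : ℕ) : IsPoly fun _ => a := ⟨.C a, by simp⟩

theorem IsPoly.id : IsPoly fun n => n := ⟨.X, by simp⟩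

theorem IsPoly.add {f g : ℕ → ℕ} (hf : IsPoly f) (hg : IsPoly g) : IsPoly fun n => f n + g n := by
  obtain ⟨p, hp⟩ := hf
  obtain ⟨q, hq⟩ := hg
  exact ⟨p + q, fun n => by rw [Polynomial.eval_add, hp, hq]⟩

theorem IsPoly.mul {f g : ℕ → ℕ} (hf : IsPoly f) (hg : IsPoly g) : IsPoly fun n => f n * g n := by
  obtain ⟨p, hp⟩ := hf
  obtain ⟨q, hq⟩ := hg
  exact ⟨p * q, fun n => by rw [Polynomial.eval_mul, hp, hq]⟩

theorem IsPoly.loopTime {f g : ℕ → ℕ} (hf : IsPoly f) (hg : IsPoly g) :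
    IsPoly fun n => BisetCover.loopTime (f n) (g n) :=
  (hf.mul (hg.add (.const 2))).add (.const 2)

theorem isPoly_growTime : IsPoly growTime := by
  unfold growTime growStepTime findTime tryTime
  repeat' first
    | exact IsPoly.id
    | exact IsPoly.const _
    | refine IsPoly.loopTime ?_ ?_
    | refine IsPoly.mul ?_ ?_
    | refine IsPoly.add ?_ ?_

theorem isPoly_phaseTime : IsPoly phaseTime := by
  unfold phaseTime
  repeat' first
    | exact isPoly_growTime
    | exact IsPoly.id
    | exact IsPoly.const _
    | refine IsPoly.loopTime ?_ ?_
    | refine IsPoly.mul ?_ ?_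
    | refine IsPoly.add ?_ ?_

theorem isPoly_mainTime : IsPoly mainTime := by
  unfold mainTime storeHaloTime
  repeat' first
    | exact isPoly_phaseTime
    | exact IsPoly.id
    | exact IsPoly.const _
    | refine IsPoly.loopTime ?_ ?_
    | refine IsPoly.add ?_ ?_

theorem inputMem_edgeSet_two : (inputMem n k E c).edgeSet n 2 = E := by
  ext ⟨x, y⟩
  rw [mem_edgeSet]
  simp [inputMem, Fin.val_inj]

theorem inputMem_edgeSet_three : (inputMem n k E c).edgeSet n 3 = ∅ := by
  ext ⟨x, y⟩
  rw [mem_edgeSet]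
  simp [inputMem]

theorem inputMem_val {f : Fin n × Fin n} (hf : f ∈ E) :
    (inputMem n k E c).val 0 f.1 f.2 0 = c f := by
  have : E.filter (fun e => e.1.val = f.1.val ∧ e.2.val = f.2.val) = {f} := by
    ext g
    simp only [Finset.mem_filter, Finset.mem_singleton, Fin.val_inj, ← Prod.ext_iff]
    exact ⟨fun h => h.2, fun h => ⟨h ▸ hf, h⟩⟩
  simp [inputMem, this]

theorem exists_run (hF : IsCrossing F) (hO : O.IsCoreOracle F) (hc : ∀ f ∈ E, 0 ≤ c f) :
    ∃ t m, Exec O mainProg (inputMem n k E c) t m ∧ t ≤ mainTime n ∧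
      (0 < n → ∃ Js, output n m = Js n ∧ (IsEdgeCover E F → AlgRun O k E c Js)) := by
  have hn : (inputMem n k E c).nat 0 0 0 0 = n := by simp [inputMem]
  rcases Nat.eq_zero_or_pos n with rfl | hn0
  · refine ⟨2, _, .iteFalse ?_ (.skip _), ?_, fun h => absurd h (lt_irrefl 0)⟩
    · simp [hn]
    · unfold mainTime loopTime
      omega
  · obtain ⟨t, m, h1, h2, h3⟩ := runs_mainProg (k := k) hF hO hc hn0 hn (by simp [inputMem])
      inputMem_edgeSet_two inputMem_edgeSet_three fun f => inputMem_val
    exact ⟨t, m, h1, h2, fun _ => h3⟩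

end Main

end BisetCover

theorem theoremt :
    ∃ (P : Prog) (p : Polynomial ℕ) (C : ℝ),
      ∀ (n k : ℕ) (E : Finset (Fin n × Fin n)) (c : Fin n × Fin n → ℝ)
        (F : Set (Biset (Fin n))) (O : Oracle n),
        (∀ e ∈ E, 0 ≤ c e) → (∀ S ∈ F, S.Proper) → IsCrossing F → O.IsCoreOracle F →
        ∃ (t : ℕ) (m : Mem),
          Exec O P (inputMem n k E c) t m ∧ t ≤ p.eval n ∧
          (IsEdgeCover E F →
            output n m ⊆ E ∧ IsEdgeCover (output n m) F ∧
            -- part (i)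
            (∑ e ∈ output n m, c e
                ≤ C * (1 + Real.log (numCores F)) * lpValue E c F ∧
              (2 ≤ n → 1 + Real.log (numCores F) ≤ C * Real.log n)) ∧
            -- part (ii)
            (k < n → IsRegular k F → IsRegular k (coFamily F) →
              (∀ S ∈ F, S.boundary.card = k) →
              ∑ e ∈ output n m, c e
                ≤ C * (1 + Real.log (min ((n : ℝ) / ((n : ℝ) - k)) ((n : ℝ) - k)))
                    * lpValue E c F) ∧
            -- part (iii)
            (k < n → IsRegular k F → IsRegular k (coFamily F) →
              (∀ S ∈ F, S.boundary.card ≤ k) →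
              ∑ e ∈ output n m, c e
                ≤ C * ((n : ℝ) / ((n : ℝ) - k) * (1 + Real.log ((n : ℝ) / ((n : ℝ) - k))))
                    * lpValue E c F)) := by
  obtain ⟨p, hp⟩ := isPoly_mainTime
  refine ⟨mainProg, p, 6, fun n k E c F O hc hP hF hO => ?_⟩
  obtain ⟨t, m, hrun, ht, h⟩ := exists_run (k := k) hF hO hc
  refine ⟨t, m, hrun, (hp n).symm ▸ ht, fun hE => ?_⟩
  rcases Nat.eq_zero_or_pos n with rfl | hn0
  -- Without nodes there are no edges and no proper bisets, so the output is empty and only the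
  -- nonnegativity of the bound is needed.
  · have hJ : output 0 m = ∅ := Finset.eq_empty_of_forall_notMem fun e _ => e.1.elim0
    refine ⟨fun e _ => e.1.elim0, fun S hS => (hP S hS).1.choose.elim0, ⟨?_, fun h0 => ?_⟩,
      fun hk => absurd hk (Nat.not_lt_zero k), fun hk => absurd hk (Nat.not_lt_zero k)⟩
    · rw [hJ, Finset.sum_empty]
      have := lpValue_nonneg hE hc
      have := Real.log_natCast_nonneg (numCores F)
      positivity
    · omega
  · obtain ⟨Js, hJs, hAlg⟩ := h hn0
    have hA := hAlg hE
    rw [hJs]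
    exact ⟨hA.subset le_rfl, hA.isEdgeCover hF hP hO,
      ⟨hA.cost_le_numCores hF hP hO hE hc, fun h2 => one_add_log_numCores_le hF hP hO h2⟩,
      fun hkn hk _ hΓ => hA.cost_le_min hF hP hO hE hc hk hkn hΓ,
      fun hkn hk _ _ => hA.cost_le_mul hF hP hO hE hc hk hkn⟩
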